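/- **Conventions.** Let $R$ be a commutative ring, $W$ a free $R$-module of finite rank and $q:W\to R$ a quadratic form. $\operatorname{Clf}(q)=T(W)/(w\otimes w+q(w))$ is the Clifford algebra with $w^2=-q(w)$; $W\subset\operatorname{Clf}(q)$, and $\operatorname{Vec}(q)=R+W$. On $\operatorname{Clf}(q)$ let $x\mapsto x'$ be the algebra automorphism with $w'=-w$ on $W$, $x\mapsto x^*$ the anti-automorphism that is the identity on $W$, and $\bar x=(x^*)'$. Write $\operatorname{Clf}(q)_+$ for the even part, $x=x_0+x_1$ for the decomposition into even and odd components, and $\operatorname{Ns}(x)=xx^*$ for the spinor norm. The Clifford monoid is $\operatorname{Clf}(q)^{\mathrm{mon}}=\{x : x\bar x\in R,\ x\operatorname{Vec}(q)x^*\subset\operatorname{Vec}(q)\}$. Put $$\operatorname{Spin}(q)=\{x\in\operatorname{Clf}(q)_+\cap\operatorname{Clf}(q)^{\mathrm{mon}}:\operatorname{Ns}(x)=1,\ xWx^*\subset W\},$$ $$\operatorname{GSpin}(q)=\{x\in\operatorname{Clf}(q)_+\cap\operatorname{Clf}(q)^{\mathrm{mon}}: x\text{ invertible},\ xW(x')^{-1}\subset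 W\}.$$ For $A=\begin{pmatrix}a&b\\c&d\end{pmatrix}\in M_2(\operatorname{Clf}(q))$ let $\Delta(A)=ad^*-bc^*$ be the pseudodeterminant and $\operatorname{Adj}(A)=\begin{pmatrix}d^*&-b^*\\-c^*&a^*\end{pmatrix}$. $\operatorname{GL}_2(\operatorname{Clf}(q))$ is the set of $A$ with (1) $\Delta(A)\in R^\times$; (2) $ab^*=ba^*$, $cd^*=dc^*$; (3) $a\bar a,b\bar b,c\bar c,d\bar d\in R$; (4) $a\bar c,b\bar d\in\operatorname{Vec}(q)$; (5) $ax\bar b+b\bar x\bar a,\ cx\bar d+d\bar x\bar c\in R$ and (6) $ax\bar d+b\bar x\bar c\in\operatorname{Vec}(q)$ for all $x\in\operatorname{Vec}(q)$. $\operatorname{SL}_2(\operatorname{Clf}(q))$ is the subset where $\Delta(A)=1$. For $\varepsilon\in\{1,-1\}$ let $Q=x^2+\varepsilon yz+q$ on $W\oplus R^3$ (orthogonal sum; $\varepsilon=1$ gives $Q=x^2+yz+q$, $\varepsilon=-1$ gives the isometric form $x^2-yz+q$). In $\operatorname{Clf}(Q)$ let $e,f$ be the basis vectors belonging to $x,y$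 and let $g$ be $-\varepsilon$ times the basis vector belonging to $z$, so $e^2=-1$, $f^2=g^2=0$, $fg=1-gf$. **Theorem.** (A) For every such $R,W,q$ and each sign $\varepsilon$, the maps $$\iota:M_2(\operatorname{Clf}(q))\to\operatorname{Clf}(q+\varepsilon yz),\quad \iota\begin{pmatrix}a&b\\c&d\end{pmatrix}=a\,fg+b\,f+c'\,g+d'\,gf,$$ $$\phi:\operatorname{Clf}(q+\varepsilon yz)\to\operatorname{Clf}(Q)_+,\quad \phi(v)=v_0+v_1e$$ are isomorphisms of $R$-algebras. Their composite $\psi=\phi\circ\iota:M_2(\operatorname{Clf}(q))\to\operatorname{Clf}(Q)_+$ is given by $$\psi\begin{pmatrix}a&b\\c&d\end{pmatrix}=(a_0fg+b_1f-c_1g+d_0gf)+(a_1fg+b_0f+c_0g-d_1gf)e ,$$ and satisfies $\psi(\operatorname{Adj}(A))=\psi(A)^*$, hence $$\operatorname{Ns}(\psi(A))=\psi(A\operatorname{Adj}(A))=\psi\begin{pmatrix}ad^*-bc^*&-ab^*+ba^*\\cd^*-dc^*&-cb^*+da^*\end{pmatrix}$$ for all $A$. For $A\in\operatorname{GL}_2(\operatorname{Clf}(q))$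 one has $\operatorname{Ns}(\psi(A))=\Delta(A)\in R^\times$. The sets $\operatorname{GL}_2(\operatorname{Clf}(q))$, $\operatorname{SL}_2(\operatorname{Clf}(q))$, $\operatorname{GSpin}(Q)$, $\operatorname{Spin}(Q)$ are groups under multiplication, and $\psi$ restricts to group isomorphisms $$\operatorname{SL}_2(\operatorname{Clf}(q))\to\operatorname{Spin}(Q),\qquad \operatorname{GL}_2(\operatorname{Clf}(q))\to\operatorname{GSpin}(Q).$$ (B) Let $q$ be an $n$-ary quadratic form over $\mathbb Z$, let $\varepsilon\in\{1,-1\}$ and $Q=x^2+\varepsilon yz+q$. The functors $R\mapsto\operatorname{SL}_2(\operatorname{Clf}(q_R))$ and $R\mapsto\operatorname{Spin}(Q_R)$ on commutative rings are represented by affine group schemes $\operatorname{SL}_2(\operatorname{Clf}_q)$ and $\operatorname{Spin}_Q$ over $\operatorname{Spec}\mathbb Z$, and there is an isomorphism of group schemes $\operatorname{SL}_2(\operatorname{Clf}_q)\cong\operatorname{Spin}_Q$ over $\operatorname{Spec}\mathbb Z$ which on $R$-points is the map $\psi$ of (A) for $q_R$. (C) Let $n\ge1$, let $\mathbb C_n=\operatorname{Clf}(\mathbb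 R^{n-1},x_1^2+\cdots+x_{n-1}^2)$, and let $\operatorname{Spin}_{1,n+1}(\mathbb R)=\operatorname{Spin}(L)$ for the form $L=x_0^2-x_1^2-\cdots-x_{n+1}^2$ on $\mathbb R^{n+2}$. Then $\operatorname{SL}_2(\mathbb C_n)\cong\operatorname{Spin}_{1,n+1}(\mathbb R)$ as groups, by an isomorphism that is the restriction of an isomorphism of $\mathbb R$-algebras $M_2(\mathbb C_n)\cong\operatorname{Clf}(L)_+$. -/

import Mathlib

noncomputable section

namespace Clf

universe u v w

section Algebra

variable {R : Type u} [CommRing R] {W : Type v} [AddCommGroup W] [Module R W]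

/-- The Clifford algebra of `(W, q)` with the sign convention `v ^ 2 = - q v`. -/
abbrev Cliff (q : QuadraticForm R W) : Type (max u v) := CliffordAlgebra (-q)

/-- The canonical map `W → Clf(q)`, satisfying `ofVec q w * ofVec q w = - q w`. -/
def ofVec (q : QuadraticForm R W) : W →ₗ[R] Cliff q := CliffordAlgebra.ι (-q)

/-- Imaginary Clifford vectors: the image of `W`. -/
def imVec (q : QuadraticForm R W) : Submodule R (Cliff q) := LinearMap.range (ofVec q)

/-- Clifford vectors: the `R`-submodule generated by `1` and `W`. -/
def Vec (q : QuadraticForm R W) : Submodule R (Cliff q) :=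
  Submodule.span R ({1} ∪ Set.range (ofVec q))

/-- The image of `R` in `Clf(q)`. -/
def scalars (q : QuadraticForm R W) : Set (Cliff q) := Set.range (algebraMap R (Cliff q))

/-- The image of `Rˣ` in `Clf(q)`. -/
def unitScalars (q : QuadraticForm R W) : Set (Cliff q) :=
  Set.range fun r : Rˣ => algebraMap R (Cliff q) (r : R)

/-- Parity involution `x ↦ x'`. -/
def par {q : QuadraticForm R W} (x : Cliff q) : Cliff q := CliffordAlgebra.involute x

/-- Transpose involution `x ↦ x^*`. -/
def tr {q : QuadraticForm R W} (x : Cliff q) : Cliff q := CliffordAlgebra.reverse x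

/-- Clifford conjugation `x ↦ (x^*)'`. -/
def bar {q : QuadraticForm R W} (x : Cliff q) : Cliff q := par (tr x)

/-- Clifford norm `x x̄`. -/
def nrd {q : QuadraticForm R W} (x : Cliff q) : Cliff q := x * bar x

/-- Spinor norm `x x^*`. -/
def spinorNorm {q : QuadraticForm R W} (x : Cliff q) : Cliff q := x * tr x

/-- The even subalgebra `Clf(q)_+`. -/
abbrev evenSubalgebra (q : QuadraticForm R W) : Subalgebra R (Cliff q) := CliffordAlgebra.even (-q)

/-- The component `x_+` of `x` in `Clf(q)_+`. -/
def evenPart {q : QuadraticForm R W} (x : Cliff q) : Cliff q :=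
  (DirectSum.decompose (CliffordAlgebra.evenOdd (-q)) x 0 : CliffordAlgebra.evenOdd (-q) 0)

/-- The component `x_-` of `x` in `Clf(q)_-`. -/
def oddPart {q : QuadraticForm R W} (x : Cliff q) : Cliff q :=
  (DirectSum.decompose (CliffordAlgebra.evenOdd (-q)) x 1 : CliffordAlgebra.evenOdd (-q) 1)

/-- The Clifford monoid. -/
def cliffordMonoid (q : QuadraticForm R W) : Set (Cliff q) :=
  {x | nrd x ∈ scalars q ∧ ∀ v ∈ Vec q, x * v * tr x ∈ Vec q}

/-- `Spin(W, q)`. -/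
def spin (q : QuadraticForm R W) : Set (Cliff q) :=
  {x | x ∈ evenSubalgebra q ∧ x ∈ cliffordMonoid q ∧ spinorNorm x = 1 ∧
    ∀ w ∈ imVec q, x * w * tr x ∈ imVec q}

/-- `GSpin(W, q)`: the even invertible elements `x` of the Clifford monoid such that
`x W (x')⁻¹ ⊆ W`. -/
def gspin (q : QuadraticForm R W) : Set (Cliff q) :=
  {x | x ∈ evenSubalgebra q ∧ x ∈ cliffordMonoid q ∧ IsUnit x ∧
    ∃ y : Cliff q, par x * y = 1 ∧ y * par x = 1 ∧ ∀ w ∈ imVec q, x * w * y ∈ imVec q}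

/-- The pseudodeterminant `a d^* - b c^*`. -/
def pseudoDet {q : QuadraticForm R W} (A : Matrix (Fin 2) (Fin 2) (Cliff q)) : Cliff q :=
  A 0 0 * tr (A 1 1) - A 0 1 * tr (A 1 0)

/-- The Clifford adjugate. -/
def adj {q : QuadraticForm R W} (A : Matrix (Fin 2) (Fin 2) (Cliff q)) :
    Matrix (Fin 2) (Fin 2) (Cliff q) :=
  !![tr (A 1 1), -tr (A 0 1); -tr (A 1 0), tr (A 0 0)]

/-- The Clifford general linear group `GL₂(Clf(q))`, as a set of matrices. -/
def GL2 (q : QuadraticForm R W) : Set (Matrix (Fin 2) (Fin 2) (Cliff q)) :=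
  {A | ∃ a b c d : Cliff q, A = !![a, b; c, d] ∧
    a * tr d - b * tr c ∈ unitScalars q ∧
    (a * tr b = b * tr a ∧ c * tr d = d * tr c) ∧
    (a * bar a ∈ scalars q ∧ b * bar b ∈ scalars q ∧
      c * bar c ∈ scalars q ∧ d * bar d ∈ scalars q) ∧
    (a * bar c ∈ Vec q ∧ b * bar d ∈ Vec q) ∧
    (∀ x ∈ Vec q, a * x * bar b + b * bar x * bar a ∈ scalars q ∧
      c * x * bar d + d * bar x * bar c ∈ scalars q) ∧
    (∀ x ∈ Vec q, a * x * bar d + b * bar x * bar c ∈ Vec q)}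

/-- The Clifford special linear group `SL₂(Clf(q))`, as a set of matrices. -/
def SL2 (q : QuadraticForm R W) : Set (Matrix (Fin 2) (Fin 2) (Cliff q)) :=
  {A | A ∈ GL2 q ∧ pseudoDet A = 1}

/-- The form `q + ε y z` on `W × (R × R)`, for a sign `ε = ±1`. -/
def addHyp (ε : ℤˣ) (q : QuadraticForm R W) : QuadraticForm R (W × (R × R)) :=
  QuadraticMap.prod q
    (((ε : ℤ) : R) • QuadraticMap.linMulLin (LinearMap.fst R R R) (LinearMap.snd R R R))

/-- The form `p + x ^ 2` on `W × R`. -/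
def addSq (p : QuadraticForm R W) : QuadraticForm R (W × R) :=
  QuadraticMap.prod p QuadraticMap.sq

/-- The form `Q = x ^ 2 + ε y z + q` on `(W × (R × R)) × R`. -/
abbrev bottForm (ε : ℤˣ) (q : QuadraticForm R W) : QuadraticForm R ((W × (R × R)) × R) :=
  addSq (addHyp ε q)

/-- The canonical map `Clf(q) → Clf(q + ε y z)`. -/
def inclHyp (ε : ℤˣ) (q : QuadraticForm R W) : Cliff q →ₐ[R] Cliff (addHyp ε q) :=
  CliffordAlgebra.map
    { LinearMap.inl R W (R × R) with map_app' := fun w => by simp [addHyp] }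

/-- The canonical map `Clf(p) → Clf(p + x ^ 2)`. -/
def inclSq (p : QuadraticForm R W) : Cliff p →ₐ[R] Cliff (addSq p) :=
  CliffordAlgebra.map
    { LinearMap.inl R W R with map_app' := fun w => by simp [addSq] }

/-- The generator `f` of `Clf(q + ε y z)`: the basis vector of the variable `y`. -/
def genF (ε : ℤˣ) (q : QuadraticForm R W) : Cliff (addHyp ε q) := ofVec (addHyp ε q) (0, (1, 0))

/-- The generator `g` of `Clf(q + ε y z)`: `-ε` times the basis vector of the variable `z`,
so that `f * g + g * f = 1`. -/
def genG (ε : ℤˣ) (q : QuadraticForm R W) : Cliff (addHyp ε q) :=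
  (-((ε : ℤ) : R)) • ofVec (addHyp ε q) (0, (0, 1))

/-- The generator `e` of `Clf(p + x ^ 2)`: the basis vector of the variable `x`. -/
def genE (p : QuadraticForm R W) : Cliff (addSq p) := ofVec (addSq p) (0, 1)

/-- The second Bott periodicity map `M₂(Clf(q)) → Clf(q + ε y z)`. -/
def bottTwo (ε : ℤˣ) (q : QuadraticForm R W) (A : Matrix (Fin 2) (Fin 2) (Cliff q)) :
    Cliff (addHyp ε q) :=
  inclHyp ε q (A 0 0) * (genF ε q * genG ε q) + inclHyp ε q (A 0 1) * genF ε q +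
    inclHyp ε q (par (A 1 0)) * genG ε q + inclHyp ε q (par (A 1 1)) * (genG ε q * genF ε q)

/-- The first Bott periodicity map `Clf(p) → Clf(p + x ^ 2)`, `v ↦ v_+ + v_- e`. -/
def bottOne (p : QuadraticForm R W) (v : Cliff p) : Cliff (addSq p) :=
  inclSq p (evenPart v) + inclSq p (oddPart v) * genE p

/-- The composite of the two Bott periodicity maps, `M₂(Clf(q)) → Clf(x ^ 2 + ε y z + q)`. -/
def psi (ε : ℤˣ) (q : QuadraticForm R W) (A : Matrix (Fin 2) (Fin 2) (Cliff q)) :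
    Cliff (bottForm ε q) :=
  bottOne (addHyp ε q) (bottTwo ε q A)

/-- The canonical map `Clf(q) → Clf(x ^ 2 + ε y z + q)`. -/
def inclBott (ε : ℤˣ) (q : QuadraticForm R W) : Cliff q →ₐ[R] Cliff (bottForm ε q) :=
  (inclSq (addHyp ε q)).comp (inclHyp ε q)

/-- The ring homomorphism of Clifford algebras induced by a ring homomorphism `f : R → S` and an
`f`-semilinear map `φ` of quadratic spaces with `p' (φ m) = f (p m)`. -/
def semiMap {S : Type u} [CommRing S] {W' : Type w} [AddCommGroup W'] [Module S W']
    (f : R →+* S) (p : QuadraticForm R W) (p' : QuadraticForm S W') (φ : W →ₛₗ[f] W')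
    (h : ∀ m, p' (φ m) = f (p m)) : Cliff p →+* Cliff p' :=
  letI : Algebra R (Cliff p') :=
    ((algebraMap S (Cliff p')).comp f).toAlgebra' fun r x => Algebra.commutes (f r) x
  (CliffordAlgebra.lift (-p) ⟨
    { toFun := fun m => ofVec p' (φ m)
      map_add' := fun x y => by simp
      map_smul' := fun r x => by
        simp only [LinearMap.map_smulₛₗ, RingHom.id_apply]
        exact Algebra.smul_def (f r) _ }, fun m => by
        have := CliffordAlgebra.ι_sq_scalar (-p') (φ m)
        rw [neg_apply, h, ← map_neg] at this
        exact this⟩ : Cliff p →ₐ[R] Cliff p').toRingHom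

end Algebra

section IntegralForms

variable {n : ℕ}

/-- The base change `q_R` to `R` of an `n`-ary integral quadratic form `q`: the form on `Rⁿ` with
the same coefficients, `∑ i, q(e_i) x_i ^ 2 + ∑ i < j, (q(e_i + e_j) - q(e_i) - q(e_j)) x_i x_j`. -/
def extend (q : QuadraticForm ℤ (Fin n → ℤ)) (R : Type u) [CommRing R] :
    QuadraticForm R (Fin n → R) :=
  ∑ i, ((q (Pi.single i 1) : ℤ) : R) • QuadraticMap.proj i i +
    ∑ i, ∑ j ∈ Finset.Ioi i,
      ((QuadraticMap.polar q (Pi.single i 1) (Pi.single j 1) : ℤ) : R) • QuadraticMap.proj i j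

theorem extend_apply (q : QuadraticForm ℤ (Fin n → ℤ)) (R : Type u) [CommRing R] (x : Fin n → R) :
    extend q R x = ∑ i, ((q (Pi.single i 1) : ℤ) : R) * (x i * x i) +
      ∑ i, ∑ j ∈ Finset.Ioi i,
        ((QuadraticMap.polar q (Pi.single i 1) (Pi.single j 1) : ℤ) : R) * (x i * x j) := by
  simp [extend]

variable {R S : Type u} [CommRing R] [CommRing S]

/-- The coordinatewise map `Rⁿ → Sⁿ`. -/
def coordMap (n : ℕ) (f : R →+* S) : (Fin n → R) →ₛₗ[f] (Fin n → S) where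
  toFun x i := f (x i)
  map_add' x y := by ext i; simp
  map_smul' r x := by ext i; simp

/-- The coordinatewise map `(Rⁿ × (R × R)) × R → (Sⁿ × (S × S)) × S`. -/
def coordMapBott (n : ℕ) (f : R →+* S) :
    (((Fin n → R) × (R × R)) × R) →ₛₗ[f] (((Fin n → S) × (S × S)) × S) where
  toFun x := ((coordMap n f x.1.1, (f x.1.2.1, f x.1.2.2)), f x.2)
  map_add' x y := by simp
  map_smul' r x := by simp

theorem extend_coordMap (q : QuadraticForm ℤ (Fin n → ℤ)) (f : R →+* S) (x : Fin n → R) :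
    extend q S (coordMap n f x) = f (extend q R x) := by
  simp [extend_apply, coordMap]

theorem bottForm_coordMapBott (ε : ℤˣ) (q : QuadraticForm ℤ (Fin n → ℤ)) (f : R →+* S)
    (x : ((Fin n → R) × (R × R)) × R) :
    bottForm ε (extend q S) (coordMapBott n f x) = f (bottForm ε (extend q R) x) := by
  simp [bottForm, addSq, addHyp, coordMapBott, extend_coordMap]

/-- `Clf(q_R) → Clf(q_S)`, induced by a ring homomorphism `R → S`. -/
def cliffMap (q : QuadraticForm ℤ (Fin n → ℤ)) (f : R →+* S) :
    Cliff (extend q R) →+* Cliff (extend q S) :=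
  semiMap f _ _ (coordMap n f) (extend_coordMap q f)

/-- `Clf(Q_R) → Clf(Q_S)` for `Q = x ^ 2 + ε y z + q`, induced by a ring homomorphism `R → S`. -/
def cliffMapBott (ε : ℤˣ) (q : QuadraticForm ℤ (Fin n → ℤ)) (f : R →+* S) :
    Cliff (bottForm ε (extend q R)) →+* Cliff (bottForm ε (extend q S)) :=
  semiMap f _ _ (coordMapBott n f) (bottForm_coordMapBott ε q f)

end IntegralForms

section Schemes

open CategoryTheory AlgebraicGeometry
open scoped MonObj

/-- `Spec R` as a scheme over `Spec ℤ`. -/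
def specOver (R : CommRingCat.{0}) : Over (Spec (CommRingCat.of ℤ)) :=
  Over.mk (Spec.map (CommRingCat.ofHom (Int.castRingHom R)))

/-- The morphism `Spec S → Spec R` over `Spec ℤ` induced by a ring homomorphism `R → S`. -/
def specOverMap {R S : CommRingCat.{0}} (f : R ⟶ S) : specOver S ⟶ specOver R :=
  Over.homMk (Spec.map f) (by
    simp only [specOver, Over.mk_left, Over.mk_hom, ← Spec.map_comp]
    congr 1
    ext
    simp)

/-- The statement that the group scheme `G` over `Spec ℤ` is `SL₂(Clf_q)`: for all commutative
rings `R`, multiplicative identifications `G(R) = SL₂(Clf(q_R))`, natural in `R`. -/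
structure IsSL2Scheme {n : ℕ} (q : QuadraticForm ℤ (Fin n → ℤ))
    (G : Grp (Over (Spec (CommRingCat.of ℤ)))) where
  points (R : CommRingCat.{0}) : (specOver R ⟶ G.X) →* Matrix (Fin 2) (Fin 2) (Cliff (extend q R))
  injective (R : CommRingCat.{0}) : Function.Injective (points R)
  range_eq (R : CommRingCat.{0}) : Set.range (points R) = SL2 (extend q R)
  natural {R S : CommRingCat.{0}} (f : R ⟶ S) (x : specOver R ⟶ G.X) :
    points S (specOverMap f ≫ x) = (points R x).map (cliffMap q f.hom)

/-- The statement that the group scheme `G` over `Spec ℤ` is `Spin_Q`, `Q = x ^ 2 + ε y z + q`: for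
all commutative rings `R`, multiplicative identifications `G(R) = Spin(Q_R)`, natural in `R`. -/
structure IsSpinScheme {n : ℕ} (ε : ℤˣ) (q : QuadraticForm ℤ (Fin n → ℤ))
    (G : Grp (Over (Spec (CommRingCat.of ℤ)))) where
  points (R : CommRingCat.{0}) : (specOver R ⟶ G.X) →* Cliff (bottForm ε (extend q R))
  injective (R : CommRingCat.{0}) : Function.Injective (points R)
  range_eq (R : CommRingCat.{0}) : Set.range (points R) = spin (bottForm ε (extend q R))
  natural {R S : CommRingCat.{0}} (f : R ⟶ S) (x : specOver R ⟶ G.X) :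
    points S (specOverMap f ≫ x) = cliffMapBott ε q f.hom (points R x)

end Schemes

/-- The form `x_1 ^ 2 + ⋯ + x_m ^ 2` on `ℝᵐ`. -/
def sumSq (m : ℕ) : QuadraticForm ℝ (Fin m → ℝ) :=
  QuadraticMap.weightedSumSquares ℝ fun _ => (1 : ℝ)

/-- The form `x_0 ^ 2 - x_1 ^ 2 - ⋯ - x_m ^ 2` on `ℝᵐ⁺¹`, of signature `(1, m)`. -/
def lorentz (m : ℕ) : QuadraticForm ℝ (Fin (m + 1) → ℝ) :=
  QuadraticMap.weightedSumSquares ℝ fun i => if i = 0 then (1 : ℝ) else -1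

end Clf

end

/-!
Two isomorphisms of Clifford algebras are composed. For the first, `Clf(q + ε y z)` acts by `2 × 2`
matrices over `Clf(q)`: a vector `w` of `q` acts as `diag(w, -w)`, while `f` and `g` act as the two
off-diagonal matrix units. This representation `hypMat` and the map `ι` are mutually inverse
(`iotaEquiv`). For the second, if `Q = η (p + x ^ 2)` with a sign `η` and `e` is the vector of the
variable `x`, then `m ↦ m e` extends to an isomorphism of `Clf(p)` with `Clf(Q)_+`
(`SqExt.evenEquiv`). The case `η = 1` is `φ`. The case `η = -1` applies to the Lorentz form, since
`x_0 ^ 2 - x_1 ^ 2` is a hyperbolic plane over `ℝ`.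

The second isomorphism turns Clifford conjugation into transposition, and `ι` turns the adjugate
into Clifford conjugation; hence `ψ(Adj(A)) = ψ(A)^*`. Moreover the vectors of `Q` are the products
`v e` with `v` a Clifford vector of `p`, so an even element preserves them exactly if the
corresponding element `x` of `Clf(p)` satisfies `x Vec(p) x^* ⊆ Vec(p)` (`SqExt.preserves_imVec_iff`).
For `p = q + ε y z` the Clifford vectors are the matrices with rows `(v, s)` and `(t, v̄)`, where
`v ∈ Vec(q)` and `s, t` are scalars. Multiplying out shows that this invariance is precisely the
conjunction of the membership conditions on a Clifford matrix (`preserves_Vec_bottTwo_iff`), whereas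
the conditions on `ad^* - bc^*`, `ab^*` and `cd^*` say that the spinor norm is an invertible scalar.
So `ψ` identifies `GL₂` with `GSpin` and `SL₂` with `Spin` (`mem_GL2_iff`, `mem_SL2_iff`).

That these sets are groups has to be proved for degenerate forms over arbitrary rings. The Clifford
algebra of a free module is the exterior algebra as a module, hence finite and free, with its scalars
and vectors as direct summands. By finiteness one-sided inverses are two-sided, and the inverse of an
inner automorphism is a polynomial in it; so if conjugation by `x` maps the vectors into themselves,
the same is true for `x⁻¹` (`conj_inv_mem`).

For an integral form, `Clf(q_R)` is the base change of `Clf(q_ℤ)`, so it has a basis compatible with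
ring homomorphisms (`natBasis`). Being a scalar or a Clifford vector is a linear condition on the
coordinates with integral coefficients, and so `SL₂` is cut out by polynomial equations
(`isPolyCond_SL2`). The quotient of a polynomial ring by these represents `R ↦ SL₂(Clf(q_R))`, and by
the adjunction between global sections and spectra its spectrum represents
`T ↦ SL₂(Clf(q_Γ(T)))` on all schemes `T` over `ℤ`, which makes it a group scheme. Since `ψ` is
natural in the ring (`cliffMapBott_psiHom`), the same group scheme represents `Spin_Q`.
-/

noncomputable section

namespace Clf

universe u v w

/-! ### The involutions and the grading of a Clifford algebra -/

section Involutions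

variable {R : Type u} [CommRing R] {W : Type v} [AddCommGroup W] [Module R W]
  {q : QuadraticForm R W}

@[simp] theorem par_one : par (1 : Cliff q) = 1 := map_one CliffordAlgebra.involute
@[simp] theorem par_zero : par (0 : Cliff q) = 0 := map_zero CliffordAlgebra.involute
@[simp] theorem par_add (x y : Cliff q) : par (x + y) = par x + par y :=
  map_add CliffordAlgebra.involute x y
@[simp] theorem par_neg (x : Cliff q) : par (-x) = -par x := map_neg CliffordAlgebra.involute x
@[simp] theorem par_mul (x y : Cliff q) : par (x * y) = par x * par y :=
  map_mul CliffordAlgebra.involute x y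
@[simp] theorem par_smul (r : R) (x : Cliff q) : par (r • x) = r • par x :=
  map_smul CliffordAlgebra.involute r x
@[simp] theorem par_algebraMap (r : R) : par (algebraMap R (Cliff q) r) = algebraMap R _ r :=
  CliffordAlgebra.involute.commutes r
@[simp] theorem par_ofVec (w : W) : par (ofVec q w) = -ofVec q w := CliffordAlgebra.involute_ι w
@[simp] theorem par_par (x : Cliff q) : par (par x) = x := CliffordAlgebra.involute_involute x

@[simp] theorem tr_one : tr (1 : Cliff q) = 1 := CliffordAlgebra.reverse.map_one
@[simp] theorem tr_zero : tr (0 : Cliff q) = 0 := map_zero CliffordAlgebra.reverse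
@[simp] theorem tr_add (x y : Cliff q) : tr (x + y) = tr x + tr y :=
  map_add CliffordAlgebra.reverse x y
@[simp] theorem tr_sub (x y : Cliff q) : tr (x - y) = tr x - tr y :=
  map_sub CliffordAlgebra.reverse x y
@[simp] theorem tr_neg (x : Cliff q) : tr (-x) = -tr x := map_neg CliffordAlgebra.reverse x
@[simp] theorem tr_mul (x y : Cliff q) : tr (x * y) = tr y * tr x :=
  CliffordAlgebra.reverse.map_mul x y
@[simp] theorem tr_smul (r : R) (x : Cliff q) : tr (r • x) = r • tr x :=
  map_smul CliffordAlgebra.reverse r x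
@[simp] theorem tr_algebraMap (r : R) : tr (algebraMap R (Cliff q) r) = algebraMap R _ r :=
  CliffordAlgebra.reverse.commutes r
@[simp] theorem tr_ofVec (w : W) : tr (ofVec q w) = ofVec q w := CliffordAlgebra.reverse_ι w
@[simp] theorem tr_tr (x : Cliff q) : tr (tr x) = x := CliffordAlgebra.reverse_reverse x

theorem tr_par (x : Cliff q) : tr (par x) = par (tr x) := CliffordAlgebra.reverse_involute x

@[simp] theorem bar_one : bar (1 : Cliff q) = 1 := by simp [bar]
@[simp] theorem bar_zero : bar (0 : Cliff q) = 0 := by simp [bar]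
@[simp] theorem bar_add (x y : Cliff q) : bar (x + y) = bar x + bar y := by simp [bar]
@[simp] theorem bar_neg (x : Cliff q) : bar (-x) = -bar x := by simp [bar]
@[simp] theorem bar_mul (x y : Cliff q) : bar (x * y) = bar y * bar x := by simp [bar]
@[simp] theorem bar_smul (r : R) (x : Cliff q) : bar (r • x) = r • bar x := by simp [bar]
@[simp] theorem bar_algebraMap (r : R) : bar (algebraMap R (Cliff q) r) = algebraMap R _ r := by
  simp [bar]
@[simp] theorem bar_ofVec (w : W) : bar (ofVec q w) = -ofVec q w := by simp [bar]
@[simp] theorem bar_bar (x : Cliff q) : bar (bar x) = x := by simp [bar, tr_par]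

theorem bar_par (x : Cliff q) : bar (par x) = tr x := by simp [bar, tr_par]
theorem par_tr (x : Cliff q) : par (tr x) = bar x := rfl
theorem par_bar (x : Cliff q) : par (bar x) = tr x := by simp [bar]

theorem ofVec_mul_self (w : W) : ofVec q w * ofVec q w = algebraMap R (Cliff q) (-q w) :=
  CliffordAlgebra.ι_sq_scalar (-q) w

theorem ofVec_mul_swap {w w' : W} (h : QuadraticMap.polar q w w' = 0) :
    ofVec q w * ofVec q w' = -(ofVec q w' * ofVec q w) := by
  have := CliffordAlgebra.ι_mul_ι_add_swap (Q := -q) w w'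
  rw [FunLike.coe_neg, QuadraticMap.polar_neg, h, neg_zero, map_zero] at this
  exact eq_neg_of_add_eq_zero_left this

theorem mem_Vec_iff {x : Cliff q} :
    x ∈ Vec q ↔ ∃ (r : R) (w : W), x = algebraMap R _ r + ofVec q w := by
  rw [Vec, Submodule.span_union, Submodule.mem_sup]
  constructor
  · rintro ⟨y, hy, z, hz, rfl⟩
    obtain ⟨r, rfl⟩ := Submodule.mem_span_singleton.1 hy
    rw [← LinearMap.coe_range, Submodule.span_eq] at hz
    obtain ⟨w, rfl⟩ := hz
    exact ⟨r, w, by rw [Algebra.algebraMap_eq_smul_one]⟩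
  · rintro ⟨r, w, rfl⟩
    exact ⟨_, Submodule.mem_span_singleton.2 ⟨r, rfl⟩, _, Submodule.subset_span ⟨w, rfl⟩,
      by rw [Algebra.algebraMap_eq_smul_one]⟩

theorem algebraMap_mem_Vec (r : R) : algebraMap R (Cliff q) r ∈ Vec q :=
  mem_Vec_iff.2 ⟨r, 0, by simp⟩

theorem ofVec_mem_Vec (w : W) : ofVec q w ∈ Vec q := mem_Vec_iff.2 ⟨0, w, by simp⟩

theorem scalars_subset_Vec {x : Cliff q} (hx : x ∈ scalars q) : x ∈ Vec q := by
  obtain ⟨r, rfl⟩ := hx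
  exact algebraMap_mem_Vec r

theorem add_mem_scalars {x y : Cliff q} (hx : x ∈ scalars q) (hy : y ∈ scalars q) :
    x + y ∈ scalars q := (algebraMap R (Cliff q)).range.add_mem hx hy

theorem smul_mem_scalars (r : R) {x : Cliff q} (hx : x ∈ scalars q) : r • x ∈ scalars q := by
  obtain ⟨s, rfl⟩ := hx
  exact ⟨r * s, by rw [map_mul, Algebra.smul_def]⟩

theorem par_eq_of_mem_even {x : Cliff q} (hx : x ∈ evenSubalgebra q) : par x = x :=
  CliffordAlgebra.involute_eq_of_mem_even hx

theorem tr_mem_even {x : Cliff q} (hx : x ∈ evenSubalgebra q) : tr x ∈ evenSubalgebra q :=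
  (CliffordAlgebra.reverse_mem_evenOdd_iff (-q)).2 hx

theorem evenPart_add_oddPart (x : Cliff q) : evenPart x + oddPart x = x := by
  classical
  conv_rhs => rw [← DirectSum.sum_support_decompose (CliffordAlgebra.evenOdd (-q)) x]
  rw [Finset.sum_subset (Finset.subset_univ _)]
  · exact (Fin.sum_univ_two (fun i : Fin 2 =>
      ((DirectSum.decompose (CliffordAlgebra.evenOdd (-q)) x i : _) : Cliff q))).symm
  · intro i _ hi
    simpa using hi

theorem evenPart_mem (x : Cliff q) : evenPart x ∈ CliffordAlgebra.evenOdd (-q) 0 :=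
  Subtype.coe_prop _

theorem oddPart_mem (x : Cliff q) : oddPart x ∈ CliffordAlgebra.evenOdd (-q) 1 :=
  Subtype.coe_prop _

/-- The even and odd components of `x` are determined by a decomposition of `x` into an even and an
odd element. -/
theorem evenPart_oddPart_eq {x y z : Cliff q} (hy : y ∈ CliffordAlgebra.evenOdd (-q) 0)
    (hz : z ∈ CliffordAlgebra.evenOdd (-q) 1) (h : x = y + z) :
    evenPart x = y ∧ oddPart x = z := by
  subst h
  have h1 := DirectSum.decompose_of_mem_same (CliffordAlgebra.evenOdd (-q)) hy
  have h2 := DirectSum.decompose_of_mem_ne (CliffordAlgebra.evenOdd (-q)) hz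
    (j := 0) (by decide)
  have h3 := DirectSum.decompose_of_mem_same (CliffordAlgebra.evenOdd (-q)) hz
  have h4 := DirectSum.decompose_of_mem_ne (CliffordAlgebra.evenOdd (-q)) hy
    (j := 1) (by decide)
  simp [evenPart, oddPart, DirectSum.decompose_add, h1, h2, h3, h4]

theorem mul_mem_evenOdd {i j k : ZMod 2} (h : i + j = k) {x y : Cliff q}
    (hx : x ∈ CliffordAlgebra.evenOdd (-q) i) (hy : y ∈ CliffordAlgebra.evenOdd (-q) j) :
    x * y ∈ CliffordAlgebra.evenOdd (-q) k := h ▸ SetLike.mul_mem_graded hx hy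

theorem ofVec_mem_odd (w : W) : ofVec q w ∈ CliffordAlgebra.evenOdd (-q) 1 :=
  CliffordAlgebra.ι_mem_evenOdd_one _ w

end Involutions

/-! ### The module underlying a Clifford algebra -/

section Module

variable {R : Type u} [CommRing R] {W : Type v} [AddCommGroup W] [Module R W]

/-- Over a free module the Clifford algebra is, as a module, the exterior algebra, compatibly with
scalars and vectors. No division by two is needed, as the form comes from a bilinear form. -/
theorem exists_equiv_exteriorAlgebra [Module.Free R W] (q : QuadraticForm R W) :
    ∃ θ : Cliff q ≃ₗ[R] ExteriorAlgebra R W, (∀ r, θ (algebraMap R _ r) = algebraMap R _ r) ∧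
      ∀ w, θ (ofVec q w) = ExteriorAlgebra.ι R w := by
  obtain ⟨B, hB⟩ := LinearMap.BilinMap.toQuadraticMap_surjective (R := R) (M := W) (N := R)
    ((0 : QuadraticForm R W) - -q)
  exact ⟨CliffordAlgebra.changeFormEquiv hB, CliffordAlgebra.changeForm_algebraMap hB,
    CliffordAlgebra.changeForm_ι hB⟩

instance instFreeCliff [Module.Free R W] (q : QuadraticForm R W) : Module.Free R (Cliff q) := by
  obtain ⟨θ, -⟩ := exists_equiv_exteriorAlgebra q
  let I := Module.Free.ChooseBasisIndex R W
  classical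
  let : LinearOrder I := linearOrderOfSTO (WellOrderingRel (α := I))
  have := Module.Free.of_basis (Module.Free.chooseBasis R W).ExteriorAlgebra
  exact Module.Free.of_equiv θ.symm

instance instFiniteCliff [Module.Free R W] [Module.Finite R W] (q : QuadraticForm R W) :
    Module.Finite R (Cliff q) := by
  obtain ⟨θ, -⟩ := exists_equiv_exteriorAlgebra q
  rcases subsingleton_or_nontrivial R with h | h
  · have := Module.subsingleton R (Cliff q)
    infer_instance
  let I := Module.Free.ChooseBasisIndex R W
  classical
  let : LinearOrder I := linearOrderOfSTO (WellOrderingRel (α := I))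
  have := Module.Finite.of_basis (Module.Free.chooseBasis R W).ExteriorAlgebra
  exact Module.Finite.equiv θ.symm

/-- The projection of the Clifford algebra to its scalars. -/
theorem exists_scalar_proj [Module.Free R W] (q : QuadraticForm R W) :
    ∃ l : Cliff q →ₗ[R] R, (∀ r, l (algebraMap R _ r) = r) ∧ ∀ w, l (ofVec q w) = 0 := by
  obtain ⟨θ, h1, h2⟩ := exists_equiv_exteriorAlgebra q
  exact ⟨(ExteriorAlgebra.algebraMapInv (R := R) (M := W)).toLinearMap ∘ₗ θ,
    fun r => by simp [h1], fun w => by simp [h2, ExteriorAlgebra.algebraMapInv]⟩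

/-- The projection of the Clifford algebra to its vectors. -/
theorem exists_vector_proj [Module.Free R W] (q : QuadraticForm R W) :
    ∃ l : Cliff q →ₗ[R] W, (∀ r, l (algebraMap R _ r) = 0) ∧ ∀ w, l (ofVec q w) = w := by
  obtain ⟨θ, h1, h2⟩ := exists_equiv_exteriorAlgebra q
  let : Module Rᵐᵒᵖ W := Module.compHom _ ((RingHom.id R).fromOpposite mul_comm)
  have : IsCentralScalar R W := ⟨fun r m => rfl⟩
  refine ⟨(ExteriorAlgebra.ιInv (R := R) (M := W)) ∘ₗ θ, fun r => ?_, fun w => ?_⟩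
  · simp [h1, ExteriorAlgebra.ιInv, TrivSqZeroExt.algebraMap_eq_inl]
  · simp [h2, ExteriorAlgebra.ι_leftInverse w]

/-- A scalar that is invertible in the Clifford algebra is invertible as a scalar. -/
theorem mem_unitScalars [Module.Free R W] {q : QuadraticForm R W} {x : Cliff q}
    (hx : x ∈ scalars q) (hu : IsUnit x) : x ∈ unitScalars q := by
  obtain ⟨r, rfl⟩ := hx
  obtain ⟨l, h1, -⟩ := exists_scalar_proj q
  obtain ⟨y, hy⟩ := hu.exists_right_inv
  have : r * l y = 1 := by
    rw [← smul_eq_mul, ← map_smul, Algebra.smul_def, hy, ← map_one (algebraMap R (Cliff q)), h1]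
  exact ⟨Units.mkOfMulEqOne r _ this, rfl⟩

end Module

/-! ### Units of finite algebras -/

section FiniteAlgebra

variable {R : Type*} [CommRing R] {A : Type*} [Ring A] [Algebra R A] [Module.Finite R A]

/-- In a finite algebra a right inverse is a left inverse: a surjective endomorphism of a finite module
is injective. -/
theorem mul_eq_one_of_finite (R : Type*) [CommRing R] {A : Type*} [Ring A] [Algebra R A]
    [Module.Finite R A] {x y : A} (h : x * y = 1) : y * x = 1 := by
  have hs : Function.Surjective (LinearMap.mulLeft R x) := fun z => ⟨y * z, by
    rw [LinearMap.mulLeft_apply, ← mul_assoc, h, one_mul]⟩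
  apply OrzechProperty.injective_of_surjective_endomorphism _ hs
  change x * (y * x) = x * 1
  rw [← mul_assoc, h, one_mul, mul_one]

/-- The inverse of an integral unit `u` is a polynomial in `u`. -/
theorem inv_mem_adjoin_of_isIntegral {B : Type*} [Ring B] [Algebra R B] (u : Bˣ)
    (h : IsIntegral R (↑u⁻¹ : B)) : (↑u⁻¹ : B) ∈ Algebra.adjoin R {(u : B)} := by
  -- multiplication by a high power of `u` clears the denominators of a polynomial in `u⁻¹`
  have key : ∀ (k : ℕ) (p : Polynomial R), p.natDegree ≤ k →
      (u : B) ^ k * Polynomial.aeval (↑u⁻¹ : B) p ∈ Algebra.adjoin R {(u : B)} := by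
    intro k p hp
    rw [Polynomial.aeval_eq_sum_range' (Nat.lt_succ_of_le hp), Finset.mul_sum]
    refine Subalgebra.sum_mem _ fun i hi => ?_
    have hi : i ≤ k := Nat.lt_succ_iff.1 (Finset.mem_range.1 hi)
    have : (u : B) ^ k * (↑u⁻¹ : B) ^ i = (u : B) ^ (k - i) := by
      rw [← Units.val_pow_eq_pow_val, ← Units.val_pow_eq_pow_val, ← Units.val_pow_eq_pow_val,
        ← Units.val_mul, inv_pow, pow_sub u hi]
    rw [mul_smul_comm, this]
    exact Subalgebra.smul_mem _ (Subalgebra.pow_mem _ (Algebra.self_mem_adjoin_singleton R _) _) _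
  obtain ⟨p, hp, hp0⟩ := h
  rw [← Polynomial.aeval_def] at hp0
  rcases Nat.eq_zero_or_pos p.natDegree with h0 | h0
  · rw [(Polynomial.Monic.natDegree_eq_zero hp).1 h0, map_one] at hp0
    rw [← mul_one (↑u⁻¹ : B), hp0, mul_zero]
    exact Subalgebra.zero_mem _
  · obtain ⟨n, hn⟩ := Nat.exists_eq_succ_of_ne_zero h0.ne'
    -- solve the monic equation of degree `n + 1` for the leading term and multiply by `u ^ n`
    have h1 := key n p.eraseLead (by have := p.eraseLead_natDegree_le; omega)
    rw [← p.eraseLead_add_C_mul_X_pow, hp.leadingCoeff, hn, map_add, map_mul, map_pow,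
      Polynomial.aeval_X, Polynomial.aeval_C, map_one, one_mul, add_eq_zero_iff_eq_neg] at hp0
    rw [hp0, mul_neg] at h1
    have : (u : B) ^ n * (↑u⁻¹ : B) ^ (n + 1) = ↑u⁻¹ := by
      rw [pow_succ, ← mul_assoc, ← Units.val_pow_eq_pow_val, ← Units.val_pow_eq_pow_val,
        ← Units.val_mul, inv_pow, mul_inv_cancel, Units.val_one, one_mul]
    simpa [this] using Subalgebra.neg_mem _ h1

/-- If an inner automorphism of a finite algebra maps a submodule into itself, so does its
inverse. -/
theorem conj_inv_mem (x : Aˣ) (V : Submodule R A) (h : ∀ v ∈ V, ↑x * v * ↑x⁻¹ ∈ V) {v : A}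
    (hv : v ∈ V) : ↑x⁻¹ * v * ↑x ∈ V := by
  let L : (Module.End R A)ˣ :=
    ⟨LinearMap.mulLeftRight R (↑x, ↑x⁻¹), LinearMap.mulLeftRight R (↑x⁻¹, ↑x),
      by ext; simp [mul_assoc], by ext; simp [mul_assoc]⟩
  have h1 := inv_mem_adjoin_of_isIntegral (R := R) L (Algebra.IsIntegral.isIntegral _)
  have h2 : ∀ f ∈ Algebra.adjoin R {(L : Module.End R A)}, ∀ v ∈ V, f v ∈ V := by
    intro f hf
    induction hf using Algebra.adjoin_induction with
    | mem f hf =>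
      rw [Set.mem_singleton_iff.1 hf]
      intro v hv
      simpa [L] using h v hv
    | algebraMap r => exact fun v hv => V.smul_mem r hv
    | add f g _ _ hf hg => exact fun v hv => V.add_mem (hf v hv) (hg v hv)
    | mul f g _ _ hf hg => exact fun v hv => hf _ (hg v hv)
  simpa [L] using h2 _ h1 v hv

end FiniteAlgebra

/-! ### Homomorphisms of Clifford algebras -/

section Homs

variable {R : Type u} [CommRing R] {W : Type v} [AddCommGroup W] [Module R W]
  {W' : Type w} [AddCommGroup W'] [Module R W'] {q : QuadraticForm R W} {q' : QuadraticForm R W'}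

/-- Induction on products of vectors, multiplying on the left. -/
theorem cliff_induction {P : Cliff q → Prop} (h1 : ∀ r, P (algebraMap R _ r))
    (hadd : ∀ x y, P x → P y → P (x + y)) (hmul : ∀ w x, P x → P (ofVec q w * x)) (x : Cliff q) :
    P x :=
  CliffordAlgebra.left_induction (-q) h1 hadd (fun x w hx => hmul w x hx) x

/-- An element anticommuting with all vectors commutes with everything up to parity. -/
theorem mul_map_of_anticomm {A : Type*} [Ring A] [Algebra R A] (α : Cliff q →ₐ[R] A) {h : A}
    (hh : ∀ w, h * α (ofVec q w) = -(α (ofVec q w) * h)) (x : Cliff q) :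
    h * α x = α (par x) * h := by
  induction x using cliff_induction with
  | h1 r => simp [Algebra.commutes]
  | hadd x y hx hy => simp [mul_add, add_mul, hx, hy]
  | hmul w x hx =>
    rw [map_mul, ← mul_assoc, hh, neg_mul, mul_assoc, hx]
    simp [mul_assoc]

theorem map_par (α : Cliff q →ₐ[R] Cliff q') (hα : ∀ w, α (ofVec q w) ∈ imVec q') (x : Cliff q) :
    α (par x) = par (α x) := by
  induction x using cliff_induction with
  | h1 r => simp
  | hadd x y hx hy => simp [hx, hy]
  | hmul w x hx =>
    obtain ⟨w', hw⟩ := hα w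
    simp [hx, ← hw]

theorem map_tr (α : Cliff q →ₐ[R] Cliff q') (hα : ∀ w, α (ofVec q w) ∈ imVec q') (x : Cliff q) :
    α (tr x) = tr (α x) := by
  induction x using cliff_induction with
  | h1 r => simp
  | hadd x y hx hy => simp [hx, hy]
  | hmul w x hx =>
    obtain ⟨w', hw⟩ := hα w
    simp [hx, ← hw]

theorem map_bar (α : Cliff q →ₐ[R] Cliff q') (hα : ∀ w, α (ofVec q w) ∈ imVec q') (x : Cliff q) :
    α (bar x) = bar (α x) := by
  rw [bar, map_par α hα, map_tr α hα, bar]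

@[simp] theorem evenPart_add (x y : Cliff q) : evenPart (x + y) = evenPart x + evenPart y := by
  simp [evenPart, DirectSum.decompose_add]

@[simp] theorem oddPart_add (x y : Cliff q) : oddPart (x + y) = oddPart x + oddPart y := by
  simp [oddPart, DirectSum.decompose_add]

theorem par_evenPart (x : Cliff q) : par (evenPart x) = evenPart x :=
  CliffordAlgebra.involute_eq_of_mem_even (evenPart_mem x)

theorem par_oddPart (x : Cliff q) : par (oddPart x) = -oddPart x :=
  CliffordAlgebra.involute_eq_of_mem_odd (oddPart_mem x)

theorem evenPart_par (x : Cliff q) : evenPart (par x) = evenPart x := by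
  refine (evenPart_oddPart_eq (evenPart_mem x) (neg_mem (oddPart_mem x)) ?_).1
  conv_lhs => rw [← evenPart_add_oddPart x, par_add, par_evenPart, par_oddPart]

theorem oddPart_par (x : Cliff q) : oddPart (par x) = -oddPart x := by
  refine (evenPart_oddPart_eq (evenPart_mem x) (neg_mem (oddPart_mem x)) ?_).2
  conv_lhs => rw [← evenPart_add_oddPart x, par_add, par_evenPart, par_oddPart]

theorem evenPart_algebraMap (r : R) :
    evenPart (algebraMap R (Cliff q) r) = algebraMap R _ r ∧
      oddPart (algebraMap R (Cliff q) r) = 0 :=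
  evenPart_oddPart_eq (SetLike.algebraMap_mem_graded _ r) (zero_mem _) (by simp)

theorem evenPart_mul_odd (x : Cliff q) {y : Cliff q}
    (hy : y ∈ CliffordAlgebra.evenOdd (-q) 1) :
    evenPart (x * y) = oddPart x * y ∧ oddPart (x * y) = evenPart x * y :=
  evenPart_oddPart_eq (mul_mem_evenOdd (by decide) (oddPart_mem x) hy)
    (mul_mem_evenOdd (by decide) (evenPart_mem x) hy)
    (by rw [← add_mul, add_comm, evenPart_add_oddPart])

theorem evenPart_mul_even (x : Cliff q) {y : Cliff q}
    (hy : y ∈ CliffordAlgebra.evenOdd (-q) 0) :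
    evenPart (x * y) = evenPart x * y ∧ oddPart (x * y) = oddPart x * y :=
  evenPart_oddPart_eq (mul_mem_evenOdd (by decide) (evenPart_mem x) hy)
    (mul_mem_evenOdd (by decide) (oddPart_mem x) hy)
    (by rw [← add_mul, evenPart_add_oddPart])

theorem evenPart_ofVec_mul (w : W) (x : Cliff q) :
    evenPart (ofVec q w * x) = ofVec q w * oddPart x ∧
      oddPart (ofVec q w * x) = ofVec q w * evenPart x :=
  evenPart_oddPart_eq (mul_mem_evenOdd (by decide) (ofVec_mem_odd w) (oddPart_mem x))
    (mul_mem_evenOdd (by decide) (ofVec_mem_odd w) (evenPart_mem x))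
    (by rw [← mul_add, add_comm, evenPart_add_oddPart])

theorem evenPart_map (α : Cliff q →ₐ[R] Cliff q') (hα : ∀ w, α (ofVec q w) ∈ imVec q')
    (x : Cliff q) : evenPart (α x) = α (evenPart x) ∧ oddPart (α x) = α (oddPart x) := by
  induction x using cliff_induction with
  | h1 r => simp [evenPart_algebraMap]
  | hadd x y hx hy => simp [hx, hy]
  | hmul w x hx =>
    obtain ⟨w', hw⟩ := hα w
    rw [map_mul, ← hw, (evenPart_ofVec_mul _ _).1, (evenPart_ofVec_mul _ _).2,
      (evenPart_ofVec_mul _ _).1, (evenPart_ofVec_mul _ _).2, hx.1, hx.2, map_mul, map_mul, ← hw]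
    exact ⟨rfl, rfl⟩

end Homs

/-! ### Adding a hyperbolic plane -/

section Hyperbolic

variable {R : Type u} [CommRing R] {W : Type v} [AddCommGroup W] [Module R W]
  (ε : ℤˣ) (q : QuadraticForm R W)

theorem inclHyp_ofVec (w : W) : inclHyp ε q (ofVec q w) = ofVec (addHyp ε q) (w, 0) :=
  CliffordAlgebra.map_apply_ι _ w

theorem inclHyp_ofVec_mem (w : W) : inclHyp ε q (ofVec q w) ∈ imVec (addHyp ε q) :=
  ⟨_, (inclHyp_ofVec ε q w).symm⟩

theorem addHyp_apply (w : W) (s t : R) :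
    addHyp ε q (w, (s, t)) = q w + ((ε : ℤ) : R) * (s * t) := by
  simp [addHyp]

theorem addHyp_inl (w : W) : addHyp ε q (w, 0) = q w := by
  simp [addHyp]

theorem sign_mul_self : ((ε : ℤ) : R) * ((ε : ℤ) : R) = 1 := by
  rw [← Int.cast_mul, Int.units_coe_mul_self, Int.cast_one]

theorem genF_mul_self : genF ε q * genF ε q = 0 := by
  simp [genF, ofVec_mul_self, addHyp_apply]

theorem genG_mul_self : genG ε q * genG ε q = 0 := by
  simp [genG, ofVec_mul_self, addHyp_apply]

theorem genF_mul_genG_add : genF ε q * genG ε q + genG ε q * genF ε q = 1 := by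
  have h := CliffordAlgebra.ι_mul_ι_add_swap (Q := -addHyp ε q) ((0 : W), ((1 : R), (0 : R)))
    (0, (0, 1))
  have h2 : QuadraticMap.polar (-addHyp ε q) ((0 : W), ((1 : R), (0 : R))) (0, (0, 1)) =
      -((ε : ℤ) : R) := by
    simp [QuadraticMap.polar, addHyp_apply]
  rw [genF, genG, mul_smul_comm, smul_mul_assoc, ← smul_add]
  erw [h]
  rw [h2, Algebra.smul_def, ← map_mul, neg_mul_neg, sign_mul_self, map_one]

theorem genF_mul_inclHyp (x : Cliff q) :
    genF ε q * inclHyp ε q x = inclHyp ε q (par x) * genF ε q := by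
  refine mul_map_of_anticomm _ (fun w => ?_) x
  rw [inclHyp_ofVec, genF]
  exact ofVec_mul_swap (by simp [QuadraticMap.polar, addHyp_apply, addHyp_inl])

theorem genG_mul_inclHyp (x : Cliff q) :
    genG ε q * inclHyp ε q x = inclHyp ε q (par x) * genG ε q := by
  refine mul_map_of_anticomm _ (fun w => ?_) x
  rw [inclHyp_ofVec, genG, smul_mul_assoc, mul_smul_comm, ← smul_neg]
  congr 1
  exact ofVec_mul_swap (by simp [QuadraticMap.polar, addHyp_apply, addHyp_inl])

theorem ofVec_addHyp (w : W) (s t : R) : ofVec (addHyp ε q) (w, (s, t)) =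
    inclHyp ε q (ofVec q w) + s • genF ε q + (-((ε : ℤ) : R) * t) • genG ε q := by
  rw [inclHyp_ofVec, genF, genG, smul_smul, ← map_smul, ← map_smul, ← map_add, ← map_add]
  congr 1
  have : -((ε : ℤ) : R) * t * -((ε : ℤ) : R) = t := by
    rw [mul_right_comm, neg_mul_neg, sign_mul_self, one_mul]
  exact Prod.ext (by simp) (Prod.ext (by simp) (by simpa using this.symm))

/-- The linear map underlying the matrix representation of `Clf(q + ε y z)`. -/
def hypMatLin : (W × (R × R)) →ₗ[R] Matrix (Fin 2) (Fin 2) (Cliff q) where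
  toFun x := !![ofVec q x.1, algebraMap R _ x.2.1;
    algebraMap R _ (-((ε : ℤ) : R) * x.2.2), -ofVec q x.1]
  map_add' x y := by
    ext i j
    fin_cases i <;> fin_cases j <;> simp [mul_add, add_comm]
  map_smul' r x := by
    ext i j
    fin_cases i <;> fin_cases j <;> simp [Algebra.smul_def, mul_left_comm]

/-- The matrix representation `Clf(q + ε y z) → M₂(Clf(q))`, sending `w ∈ W` to `diag(w, -w)` and
`f`, `g` to the two off-diagonal matrix units. -/
def hypMat : Cliff (addHyp ε q) →ₐ[R] Matrix (Fin 2) (Fin 2) (Cliff q) :=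
  CliffordAlgebra.lift (-addHyp ε q) ⟨hypMatLin ε q, by
    rintro ⟨w, s, t⟩
    have h := ofVec_mul_self (q := q) w
    have h2 := Algebra.commutes s (ofVec q w)
    have h3 := Algebra.commutes (((ε : ℤ) : R) * t) (ofVec q w)
    have h4 : ((ε : ℤ) : R) * t * s = ((ε : ℤ) : R) * (s * t) := by ring
    have h5 : s * (((ε : ℤ) : R) * t) = ((ε : ℤ) : R) * (s * t) := by ring
    ext i j
    fin_cases i <;> fin_cases j <;>
      simp [hypMatLin, Matrix.mul_apply, Fin.sum_univ_two, h, addHyp_apply, h2, h3, h4, h5,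
        Matrix.algebraMap_matrix_apply, ← map_mul, add_comm]⟩

theorem hypMat_ofVec (w : W) (s t : R) : hypMat ε q (ofVec (addHyp ε q) (w, (s, t))) =
    !![ofVec q w, algebraMap R _ s; algebraMap R _ (-((ε : ℤ) : R) * t), -ofVec q w] :=
  CliffordAlgebra.lift_ι_apply _ _ _

theorem hypMat_genF : hypMat ε q (genF ε q) = !![0, 1; 0, 0] := by
  rw [genF, hypMat_ofVec]
  simp

theorem hypMat_genG : hypMat ε q (genG ε q) = !![0, 0; 1, 0] := by
  have hc : -((ε : ℤ) : R) * -((ε : ℤ) : R) = 1 := by rw [neg_mul_neg, sign_mul_self]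
  rw [genG, map_smul, hypMat_ofVec]
  generalize -((ε : ℤ) : R) = c at hc
  ext i j
  fin_cases i <;> fin_cases j <;> simp [Algebra.smul_def, ← map_mul, hc]

theorem hypMat_inclHyp (x : Cliff q) : hypMat ε q (inclHyp ε q x) = !![x, 0; 0, par x] := by
  induction x using cliff_induction with
  | h1 r =>
    ext i j
    fin_cases i <;> fin_cases j <;> simp [Matrix.algebraMap_matrix_apply]
  | hadd x y hx hy => simp [hx, hy]
  | hmul w x hx =>
    rw [map_mul, map_mul, hx, inclHyp_ofVec]
    erw [hypMat_ofVec]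
    simp

theorem hypMat_bottTwo (A : Matrix (Fin 2) (Fin 2) (Cliff q)) : hypMat ε q (bottTwo ε q A) = A := by
  rw [bottTwo]
  simp only [map_add, map_mul, hypMat_genF, hypMat_genG, hypMat_inclHyp]
  ext i j
  fin_cases i <;> fin_cases j <;> simp

theorem bottTwo_add (A B : Matrix (Fin 2) (Fin 2) (Cliff q)) :
    bottTwo ε q (A + B) = bottTwo ε q A + bottTwo ε q B := by
  simp only [bottTwo, Matrix.add_apply, par_add, map_add, add_mul]
  abel

theorem bottTwo_smul (r : R) (A : Matrix (Fin 2) (Fin 2) (Cliff q)) :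
    bottTwo ε q (r • A) = r • bottTwo ε q A := by
  simp only [bottTwo, Matrix.smul_apply, par_smul, map_smul, smul_mul_assoc, smul_add]

theorem bottTwo_one : bottTwo ε q 1 = 1 := by
  simp [bottTwo, genF_mul_genG_add]

theorem genF_genG_genF : genF ε q * (genG ε q * genF ε q) = genF ε q := by
  rw [eq_sub_of_add_eq' (genF_mul_genG_add ε q), mul_sub, ← mul_assoc, genF_mul_self]
  simp

theorem genG_genF_genG : genG ε q * (genF ε q * genG ε q) = genG ε q := by
  rw [eq_sub_of_add_eq (genF_mul_genG_add ε q), mul_sub, ← mul_assoc, genG_mul_self]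
  simp

/-- The relations between `f`, `g` and the vectors of `q` show that multiplication by a vector on one
side is multiplication by its matrix on the other. -/
theorem bottTwo_hypMat (x : Cliff (addHyp ε q)) : bottTwo ε q (hypMat ε q x) = x := by
  induction x using cliff_induction with
  | h1 r =>
    rw [AlgHom.commutes, Algebra.algebraMap_eq_smul_one, bottTwo_smul, bottTwo_one,
      Algebra.algebraMap_eq_smul_one]
  | hadd x y hx hy => rw [map_add, bottTwo_add, hx, hy]
  | hmul v x hx =>
    obtain ⟨w, s, t⟩ := v
    conv_rhs => rw [← hx]
    rw [map_mul, hypMat_ofVec, ofVec_addHyp]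
    generalize hypMat ε q x = A
    set r : R := -((ε : ℤ) : R) * t
    have hF := genF_mul_inclHyp ε q
    have hG := genG_mul_inclHyp ε q
    have e1 : !![ofVec q w, algebraMap R _ s; algebraMap R _ r, -ofVec q w] * A =
        !![ofVec q w, 0; 0, -ofVec q w] * A + s • (!![0, 1; 0, 0] * A) +
          r • (!![0, 0; 1, 0] * A) := by
      rw [A.eta_fin_two]
      ext i j
      fin_cases i <;> fin_cases j <;> simp [add_comm]
    rw [e1, bottTwo_add, bottTwo_add, bottTwo_smul, bottTwo_smul, add_mul, add_mul,
      smul_mul_assoc, smul_mul_assoc]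
    congr 1
    congr 1
    · simp [bottTwo, Matrix.mul_apply, mul_add, mul_assoc]
    · congr 1
      simp only [bottTwo, mul_add]
      simp only [← mul_assoc, hF]
      simp only [mul_assoc, genF_genG_genF, genF_mul_self]
      simp [Matrix.mul_apply]
    · congr 1
      simp only [bottTwo, mul_add]
      simp only [← mul_assoc, hG]
      simp only [mul_assoc, genG_genF_genG, genG_mul_self]
      simp [Matrix.mul_apply]

/-- The second Bott periodicity isomorphism, with inverse the matrix representation. -/
def iotaEquiv : Matrix (Fin 2) (Fin 2) (Cliff q) ≃ₐ[R] Cliff (addHyp ε q) :=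
  AlgEquiv.symm
    { hypMat ε q with
      invFun := bottTwo ε q
      left_inv := bottTwo_hypMat ε q
      right_inv := hypMat_bottTwo ε q }

theorem iotaEquiv_apply (A : Matrix (Fin 2) (Fin 2) (Cliff q)) :
    iotaEquiv ε q A = bottTwo ε q A := rfl

theorem par_genF : par (genF ε q) = -genF ε q := by simp [genF]
theorem par_genG : par (genG ε q) = -genG ε q := by simp [genG]

/-- Parity on `Clf(q + ε y z)` in terms of matrices. -/
theorem par_bottTwo (A : Matrix (Fin 2) (Fin 2) (Cliff q)) : par (bottTwo ε q A) =
    bottTwo ε q !![par (A 0 0), -par (A 0 1); -par (A 1 0), par (A 1 1)] := by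
  simp [bottTwo, par_genF, par_genG, ← map_par (inclHyp ε q) (inclHyp_ofVec_mem ε q)]

/-- Clifford conjugation on `Clf(q + ε y z)` corresponds to the Clifford adjugate. -/
theorem bar_bottTwo (A : Matrix (Fin 2) (Fin 2) (Cliff q)) :
    bar (bottTwo ε q A) = bottTwo ε q (adj A) := by
  have hF := genF_mul_inclHyp ε q
  have hG := genG_mul_inclHyp ε q
  have hbF : bar (genF ε q) = -genF ε q := by simp [genF]
  have hbG : bar (genG ε q) = -genG ε q := by simp [genG]
  simp only [bottTwo, bar_add, bar_mul, ← map_bar (inclHyp ε q) (inclHyp_ofVec_mem ε q), hbF, hbG,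
    neg_mul, mul_neg, neg_neg, mul_assoc, hF, hG, bar_par, par_bar]
  simp only [← mul_assoc, hF, hG, par_bar, par_tr]
  simp only [adj, Matrix.of_apply, Matrix.cons_val', Matrix.cons_val_zero, Matrix.cons_val_one,
    Matrix.cons_val_fin_one, par_neg, par_tr, map_neg, neg_mul, mul_assoc]
  abel

theorem tr_bottTwo (A : Matrix (Fin 2) (Fin 2) (Cliff q)) : tr (bottTwo ε q A) =
    bottTwo ε q !![bar (A 1 1), bar (A 0 1); bar (A 1 0), bar (A 0 0)] := by
  rw [← par_bar, bar_bottTwo, par_bottTwo]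
  simp [adj, par_tr]

/-- The Clifford vectors of `q + ε y z` as matrices. -/
theorem bottTwo_mem_Vec {A : Matrix (Fin 2) (Fin 2) (Cliff q)} :
    bottTwo ε q A ∈ Vec (addHyp ε q) ↔
      A 0 0 ∈ Vec q ∧ A 0 1 ∈ scalars q ∧ A 1 0 ∈ scalars q ∧ A 1 1 = bar (A 0 0) := by
  constructor
  · intro h
    obtain ⟨r, ⟨w, s, t⟩, h⟩ := mem_Vec_iff.1 h
    have h2 := congrArg (hypMat ε q) h
    rw [hypMat_bottTwo, map_add, hypMat_ofVec, AlgHom.commutes] at h2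
    subst h2
    refine ⟨mem_Vec_iff.2 ⟨r, w, by simp [Matrix.algebraMap_matrix_apply]⟩,
      ⟨s, by simp [Matrix.algebraMap_matrix_apply]⟩,
      ⟨-((ε : ℤ) : R) * t, by simp [Matrix.algebraMap_matrix_apply]⟩,
      by simp [Matrix.algebraMap_matrix_apply]⟩
  · rintro ⟨h1, ⟨s, h2⟩, ⟨t, h3⟩, h4⟩
    obtain ⟨r, w, h1⟩ := mem_Vec_iff.1 h1
    refine mem_Vec_iff.2 ⟨r, (w, s, -((ε : ℤ) : R) * t), ?_⟩
    apply (Function.LeftInverse.injective (bottTwo_hypMat ε q))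
    rw [hypMat_bottTwo, map_add, hypMat_ofVec, AlgHom.commutes, ← mul_assoc, neg_mul_neg,
      sign_mul_self, one_mul, h3]
    ext i j
    fin_cases i <;> fin_cases j <;> simp [Matrix.algebraMap_matrix_apply, h1, h2, h4]

theorem Vec_addHyp_iff {x : Cliff (addHyp ε q)} : x ∈ Vec (addHyp ε q) ↔
    ∃ v ∈ Vec q, ∃ s t : R,
      x = bottTwo ε q !![v, algebraMap R _ s; algebraMap R _ t, bar v] := by
  constructor
  · intro h
    rw [← bottTwo_hypMat ε q x] at h ⊢
    obtain ⟨h1, ⟨s, h2⟩, ⟨t, h3⟩, h4⟩ := (bottTwo_mem_Vec ε q).1 h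
    refine ⟨_, h1, s, t, congrArg _ ?_⟩
    rw [h2, h3, ← h4]
    exact Matrix.eta_fin_two _
  · rintro ⟨v, hv, s, t, rfl⟩
    exact (bottTwo_mem_Vec ε q).2 (by simp [hv, scalars])

end Hyperbolic

/-! ### Adding a square -/

section SquareExtension

variable {R : Type u} [CommRing R] {M : Type v} [AddCommGroup M] [Module R M]
  {V : Type w} [AddCommGroup V] [Module R V]

/-- A presentation of the quadratic space `(V, Q)` as `(M × R, η (p + x ^ 2))`, for a sign `η`. -/
structure SqExt (p : QuadraticForm R M) (Q : QuadraticForm R V) (η : ℤˣ) where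
  /-- The linear isomorphism underlying the presentation. -/
  equiv : (M × R) ≃ₗ[R] V
  map_equiv : ∀ m r, Q (equiv (m, r)) = ((η : ℤ) : R) * (p m + r * r)

namespace SqExt

variable {p : QuadraticForm R M} {Q : QuadraticForm R V} {η : ℤˣ} (k : SqExt p Q η)

/-- The image in `Clf(Q)` of a vector of `M`. -/
def inl : M →ₗ[R] Cliff Q := ofVec Q ∘ₗ k.equiv.toLinearMap ∘ₗ LinearMap.inl R M R

/-- The image `e` in `Clf(Q)` of the additional basis vector. -/
def gen : Cliff Q := ofVec Q (k.equiv (0, 1))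

theorem ofVec_equiv (m : M) (r : R) : ofVec Q (k.equiv (m, r)) = k.inl m + r • k.gen := by
  rw [inl, gen, ← map_smul, ← map_smul]
  simp [← map_add]

theorem gen_mul_self : k.gen * k.gen = algebraMap R _ (-((η : ℤ) : R)) := by
  rw [gen, ofVec_mul_self, k.map_equiv]
  simp

theorem inl_mul_self (m : M) :
    k.inl m * k.inl m = algebraMap R _ (-(((η : ℤ) : R) * p m)) := by
  have := ofVec_mul_self (q := Q) (k.equiv (m, 0))
  rw [k.map_equiv] at this
  simpa [inl] using this

theorem gen_mul_inl (m : M) : k.gen * k.inl m = -(k.inl m * k.gen) := by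
  refine ofVec_mul_swap ?_
  simp only [QuadraticMap.polar, ← map_add, LinearMap.comp_apply, LinearEquiv.coe_coe,
    LinearMap.inl_apply, Prod.mk_add_mk, k.map_equiv]
  simp only [map_zero, add_zero, zero_add, mul_zero, mul_one]
  ring

theorem inl_mul_gen_mul_self (m : M) :
    k.inl m * k.gen * (k.inl m * k.gen) = algebraMap R _ (-p m) := by
  rw [mul_assoc, ← mul_assoc k.gen, gen_mul_inl, neg_mul, mul_assoc, gen_mul_self, mul_neg,
    ← mul_assoc, inl_mul_self, ← map_mul, ← map_neg]
  congr 1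
  rw [neg_mul_neg, mul_right_comm, sign_mul_self, one_mul]

/-- The algebra homomorphism `Clf(p) → Clf(Q)` sending a vector `m` to `m e`. -/
def evenHom : Cliff p →ₐ[R] Cliff Q :=
  CliffordAlgebra.lift (-p) ⟨LinearMap.mulRight R k.gen ∘ₗ k.inl, k.inl_mul_gen_mul_self⟩

@[simp] theorem evenHom_ofVec (m : M) : k.evenHom (ofVec p m) = k.inl m * k.gen :=
  CliffordAlgebra.lift_ι_apply _ _ _

/-- The vector `e` anticommutes with the elements `m e`. -/
theorem gen_mul_evenHom (x : Cliff p) : k.gen * k.evenHom x = k.evenHom (par x) * k.gen := by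
  refine mul_map_of_anticomm _ (fun m => ?_) x
  rw [evenHom_ofVec, ← mul_assoc, gen_mul_inl, neg_mul]

/-- The isomorphism onto the even part turns Clifford conjugation into transposition. -/
theorem tr_evenHom (x : Cliff p) : tr (k.evenHom x) = k.evenHom (bar x) := by
  induction x using cliff_induction with
  | h1 r => simp
  | hadd x y hx hy => simp [hx, hy]
  | hmul m x hx =>
    have h1 : tr (k.inl m) = k.inl m := tr_ofVec _
    have h2 : tr k.gen = k.gen := tr_ofVec _
    rw [map_mul, tr_mul, hx, evenHom_ofVec, tr_mul, h1, h2, gen_mul_inl]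
    simp

theorem evenHom_mem_even (x : Cliff p) : k.evenHom x ∈ evenSubalgebra Q := by
  induction x using cliff_induction with
  | h1 r => rw [AlgHom.commutes]; exact Subalgebra.algebraMap_mem _ r
  | hadd x y hx hy => rw [map_add]; exact Subalgebra.add_mem _ hx hy
  | hmul m x hx =>
    rw [map_mul, evenHom_ofVec]
    exact Subalgebra.mul_mem _ (CliffordAlgebra.ι_mul_ι_mem_evenOdd_zero _ _ _) hx

/-- The linear map underlying `SqExt.mat`. -/
def matLin : V →ₗ[R] Matrix (Fin 2) (Fin 2) (Cliff p) :=
  { toFun := fun x : M × R =>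
      !![0, ofVec p x.1 - algebraMap R _ (((η : ℤ) : R) * x.2);
        ((η : ℤ) : R) • ofVec p x.1 + algebraMap R _ x.2, 0]
    map_add' := fun x y => by
      ext i j
      fin_cases i <;> fin_cases j <;> simp [mul_add]
      · abel
      · abel
    map_smul' := fun r x => by
      ext i j
      fin_cases i <;> fin_cases j <;>
        simp only [Matrix.smul_apply, Matrix.of_apply, Fin.zero_eta, Fin.mk_one, Matrix.cons_val',
          Matrix.cons_val_zero, Matrix.cons_val_one, Matrix.cons_val_fin_one, smul_zero,
          Prod.smul_fst, Prod.smul_snd, map_smul, smul_sub, smul_add, RingHom.id_apply, smul_eq_mul]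
      · rw [mul_left_comm, map_mul _ r, ← Algebra.smul_def r]
      · rw [map_mul _ r, ← Algebra.smul_def r, smul_comm] } ∘ₗ k.equiv.symm.toLinearMap

theorem matLin_equiv (m : M) (r : R) : k.matLin (k.equiv (m, r)) =
    !![0, ofVec p m - algebraMap R _ (((η : ℤ) : R) * r);
      ((η : ℤ) : R) • ofVec p m + algebraMap R _ r, 0] := by
  simp [matLin]

theorem matLin_mul_self (v : V) : k.matLin v * k.matLin v = algebraMap R _ ((-Q) v) := by
  obtain ⟨⟨m, r⟩, rfl⟩ := k.equiv.surjective v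
  have hQ : (-Q) (k.equiv (m, r)) = ((η : ℤ) : R) * (-p m) - ((η : ℤ) : R) * r * r := by
    rw [neg_apply, k.map_equiv]
    ring
  rw [matLin_equiv, hQ, ← neg_apply]
  generalize hc : ((η : ℤ) : R) = c
  have hcc : c * c = 1 := by rw [← hc, sign_mul_self]
  have h := ofVec_mul_self (q := p) m
  have h2 := Algebra.commutes r (ofVec p m)
  ext i j
  fin_cases i <;> fin_cases j <;>
    simp only [Matrix.mul_apply, Fin.sum_univ_two, Matrix.of_apply, Fin.zero_eta, Fin.mk_one,
      Matrix.cons_val', Matrix.cons_val_zero, Matrix.cons_val_one, Matrix.cons_val_fin_one,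
      zero_mul, mul_zero, zero_add, add_zero, Matrix.algebraMap_matrix_apply, if_true, zero_ne_one,
      one_ne_zero, if_false]
  · rw [mul_add, sub_mul, sub_mul, mul_smul_comm, h, ← map_mul, mul_smul_comm, map_mul _ c,
      ← Algebra.smul_def c, smul_mul_assoc, smul_smul, hcc, one_smul, h2, map_sub, neg_apply,
      Algebra.smul_def]
    simp only [map_mul, map_neg, mul_neg, mul_assoc]
    abel
  · rw [add_mul, mul_sub, mul_sub, smul_mul_assoc, h, ← map_mul, map_mul _ c,
      ← Algebra.smul_def c, smul_mul_smul_comm, hcc, one_smul, h2, map_sub, neg_apply,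
      Algebra.smul_def, mul_left_comm r]
    simp only [map_mul, map_neg, mul_neg, mul_assoc]
    abel

/-- The representation of `Clf(Q)` by matrices over `Clf(p)` sending a vector `m` to
`(0, m; η m, 0)` and `e` to `(0, -η; 1, 0)`. Its upper left entry inverts `SqExt.evenHom`. -/
def mat : Cliff Q →ₐ[R] Matrix (Fin 2) (Fin 2) (Cliff p) :=
  CliffordAlgebra.lift (-Q) ⟨k.matLin, k.matLin_mul_self⟩

theorem mat_evenHom (x : Cliff p) : k.mat (k.evenHom x) = !![x, 0; 0, par x] := by
  have hv : ∀ v, k.mat (ofVec Q v) = k.matLin v := CliffordAlgebra.lift_ι_apply _ _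
  induction x using cliff_induction with
  | h1 r =>
    ext i j
    fin_cases i <;> fin_cases j <;> simp [Matrix.algebraMap_matrix_apply]
  | hadd x y hx hy => simp [hx, hy]
  | hmul m x hx =>
    have h1 : k.mat (k.inl m) = !![0, ofVec p m; ((η : ℤ) : R) • ofVec p m, 0] := by
      rw [inl, LinearMap.comp_apply, hv]
      simp [matLin]
    have h2 : k.mat k.gen = !![0, -algebraMap R _ ((η : ℤ) : R); 1, 0] := by
      rw [gen, hv]
      simp [matLin]
    have h3 : (((η : ℤ) : R) • ofVec p m) * algebraMap R _ ((η : ℤ) : R) = ofVec p m := by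
      rw [← Algebra.commutes, ← Algebra.smul_def, smul_smul, sign_mul_self, one_smul]
    rw [map_mul, map_mul, hx, evenHom_ofVec, map_mul, h1, h2]
    simp only [Matrix.mul_fin_two, mul_neg, h3]
    simp

theorem evenHom_injective : Function.Injective k.evenHom := fun x y h => by
  have := congrArg (fun X => k.mat X 0 0) h
  simpa [mat_evenHom] using this

theorem ofVec_mul_gen (m : M) (r : R) : ofVec Q (k.equiv (m, r)) * k.gen =
    k.evenHom (ofVec p m - algebraMap R _ (((η : ℤ) : R) * r)) := by
  rw [ofVec_equiv, add_mul, smul_mul_assoc, gen_mul_self, map_sub, evenHom_ofVec, AlgHom.commutes,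
    Algebra.smul_def, ← map_mul, sub_eq_add_neg, ← map_neg]
  congr 2
  ring

theorem gen_mul_ofVec (m : M) (r : R) : k.gen * ofVec Q (k.equiv (m, r)) =
    k.evenHom (-ofVec p m - algebraMap R _ (((η : ℤ) : R) * r)) := by
  rw [ofVec_equiv, mul_add, mul_smul_comm, gen_mul_self, map_sub, map_neg k.evenHom, evenHom_ofVec,
    AlgHom.commutes, Algebra.smul_def, ← map_mul, sub_eq_add_neg, ← map_neg, gen_mul_inl]
  congr 2
  ring

/-- Every even element is a polynomial in the products `m e`. -/
theorem exists_evenHom_eq {X : Cliff Q} (hX : X ∈ evenSubalgebra Q) : ∃ x, k.evenHom x = X := by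
  change X ∈ k.evenHom.range
  induction X, hX using CliffordAlgebra.even_induction with
  | algebraMap r => exact Subalgebra.algebraMap_mem _ r
  | add x y hx hy hx' hy' => exact Subalgebra.add_mem _ hx' hy'
  | ι_mul_ι_mul v w x hx hx' =>
    refine Subalgebra.mul_mem _ ?_ hx'
    obtain ⟨⟨m, r⟩, rfl⟩ := k.equiv.surjective v
    obtain ⟨⟨m', r'⟩, rfl⟩ := k.equiv.surjective w
    -- insert `-η e e = 1` between the two vectors
    have h : ofVec Q (k.equiv (m, r)) * ofVec Q (k.equiv (m', r')) = (-((η : ℤ) : R)) •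
        ((ofVec Q (k.equiv (m, r)) * k.gen) * (k.gen * ofVec Q (k.equiv (m', r')))) := by
      rw [mul_assoc, ← mul_assoc k.gen, gen_mul_self, ← Algebra.smul_def, mul_smul_comm, smul_smul,
        neg_mul_neg, sign_mul_self, one_smul]
    change ofVec Q (k.equiv (m, r)) * ofVec Q (k.equiv (m', r')) ∈ _
    rw [h, ofVec_mul_gen, gen_mul_ofVec]
    exact Subalgebra.smul_mem _ (Subalgebra.mul_mem _ ((AlgHom.mem_range _).2 ⟨_, rfl⟩)
      ((AlgHom.mem_range _).2 ⟨_, rfl⟩)) _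

/-- The isomorphism of `Clf(p)` with the even subalgebra of `Clf(Q)`. -/
def evenEquiv : Cliff p ≃ₐ[R] evenSubalgebra Q :=
  AlgEquiv.ofBijective (k.evenHom.codRestrict _ k.evenHom_mem_even)
    ⟨fun _ _ h => k.evenHom_injective (congrArg Subtype.val h), fun X => by
      obtain ⟨x, hx⟩ := k.exists_evenHom_eq X.2
      exact ⟨x, Subtype.ext hx⟩⟩

/-- Right multiplication by `e` identifies the Clifford vectors of `p` with the vectors of `Q`. -/
theorem mem_imVec_iff {X : Cliff Q} : X ∈ imVec Q ↔ ∃ v ∈ Vec p, X = k.evenHom v * k.gen := by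
  constructor
  · rintro ⟨v, rfl⟩
    obtain ⟨⟨m, r⟩, rfl⟩ := k.equiv.surjective v
    refine ⟨algebraMap R _ r + ofVec p (-((η : ℤ) : R) • m), mem_Vec_iff.2 ⟨_, _, rfl⟩, ?_⟩
    rw [map_add, AlgHom.commutes, evenHom_ofVec, add_mul, mul_assoc, gen_mul_self, ofVec_equiv,
      ← Algebra.commutes, ← Algebra.smul_def, ← Algebra.smul_def, map_smul, smul_smul, neg_mul_neg,
      sign_mul_self, one_smul, add_comm]
  · rintro ⟨v, hv, rfl⟩
    obtain ⟨r, m, rfl⟩ := mem_Vec_iff.1 hv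
    refine ⟨k.equiv (-((η : ℤ) : R) • m, r), ?_⟩
    rw [map_add, AlgHom.commutes, evenHom_ofVec, add_mul, mul_assoc, gen_mul_self, ofVec_equiv,
      ← Algebra.commutes, ← Algebra.smul_def, ← Algebra.smul_def, map_smul, add_comm]

theorem evenHom_mul_gen_mem_imVec {x : Cliff p} :
    k.evenHom x * k.gen ∈ imVec Q ↔ x ∈ Vec p := by
  rw [k.mem_imVec_iff]
  refine ⟨fun ⟨v, hv, h⟩ => ?_, fun h => ⟨x, h, rfl⟩⟩
  have h2 := congrArg (fun X : Cliff Q => X * (k.gen * algebraMap R _ (-((η : ℤ) : R)))) h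
  simp only [mul_assoc] at h2
  rw [← mul_assoc k.gen k.gen, gen_mul_self, ← map_mul, neg_mul_neg, sign_mul_self, map_one,
    mul_one, mul_one] at h2
  rwa [k.evenHom_injective h2]

/-- The spinor norm of an even element is the Clifford norm of the corresponding element. -/
theorem spinorNorm_evenHom (x : Cliff p) : spinorNorm (k.evenHom x) = k.evenHom (nrd x) := by
  rw [spinorNorm, tr_evenHom, nrd, map_mul]

/-- An even element preserves the vectors of `Q` exactly if the corresponding element preserves
the Clifford vectors of `p`. -/
theorem preserves_imVec_iff (x : Cliff p) :
    (∀ w ∈ imVec Q, k.evenHom x * w * tr (k.evenHom x) ∈ imVec Q) ↔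
      ∀ v ∈ Vec p, x * v * tr x ∈ Vec p := by
  have h : ∀ v, k.evenHom x * (k.evenHom v * k.gen) * tr (k.evenHom x) =
      k.evenHom (x * v * tr x) * k.gen := fun v => by
    rw [tr_evenHom, mul_assoc, mul_assoc, gen_mul_evenHom, par_bar, map_mul, map_mul]
    simp only [mul_assoc]
  constructor
  · intro H v hv
    rw [← k.evenHom_mul_gen_mem_imVec, ← h]
    exact H _ (k.evenHom_mul_gen_mem_imVec.2 hv)
  · intro H w hw
    obtain ⟨v, hv, rfl⟩ := k.mem_imVec_iff.1 hw
    rw [h]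
    exact k.evenHom_mul_gen_mem_imVec.2 (H v hv)

end SqExt

/-- The tautological presentation of `p + x ^ 2`. -/
def sqExtAddSq (p : QuadraticForm R M) : SqExt p (addSq p) 1 where
  equiv := LinearEquiv.refl R _
  map_equiv m r := by simp [addSq]

theorem inclSq_ofVec (p : QuadraticForm R M) (m : M) :
    inclSq p (ofVec p m) = ofVec (addSq p) (m, 0) :=
  CliffordAlgebra.map_apply_ι _ m

theorem genE_mul_self (p : QuadraticForm R M) : genE p * genE p = -1 := by
  have := (sqExtAddSq p).gen_mul_self
  simp only [Units.val_one, Int.cast_one, map_neg, map_one] at this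
  exact this

theorem genE_mul_inclSq (p : QuadraticForm R M) (x : Cliff p) :
    genE p * inclSq p x = inclSq p (par x) * genE p := by
  refine mul_map_of_anticomm _ (fun m => ?_) x
  rw [inclSq_ofVec]
  exact (sqExtAddSq p).gen_mul_inl m

/-- The first Bott periodicity map is the isomorphism onto the even subalgebra. -/
theorem evenHom_sqExtAddSq (p : QuadraticForm R M) (x : Cliff p) :
    (sqExtAddSq p).evenHom x = bottOne p x := by
  induction x using cliff_induction with
  | h1 r => simp [bottOne, evenPart_algebraMap]
  | hadd x y hx hy =>
    rw [map_add, hx, hy]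
    simp only [bottOne, evenPart_add, oddPart_add, map_add, add_mul]
    abel
  | hmul m x hx =>
    have h1 : (sqExtAddSq p).inl m = inclSq p (ofVec p m) := (inclSq_ofVec p m).symm
    have h2 : (sqExtAddSq p).gen = genE p := rfl
    rw [map_mul, hx, SqExt.evenHom_ofVec, h1, h2]
    simp only [bottOne, (evenPart_ofVec_mul m x).1, (evenPart_ofVec_mul m x).2, map_mul]
    rw [mul_add, mul_assoc, genE_mul_inclSq, mul_assoc, ← mul_assoc (genE p), genE_mul_inclSq,
      mul_assoc _ (genE p) (genE p), genE_mul_self, par_evenPart, par_oddPart]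
    simp only [map_neg, mul_neg, mul_one, neg_neg]
    rw [add_comm, mul_assoc]

end SquareExtension

/-! ### The groups `Spin` and `GSpin` -/

section SpinGroups

variable {R : Type u} [CommRing R] {V : Type v} [AddCommGroup V] [Module R V]
  {Q : QuadraticForm R V}

/-- Preserving the vectors implies preserving the Clifford vectors `r + w`, as `x r x^*` is a multiple
of the spinor norm. -/
theorem preserves_Vec_of_even {x : Cliff Q} (hN : spinorNorm x ∈ scalars Q)
    (h : ∀ w ∈ imVec Q, x * w * tr x ∈ imVec Q) : ∀ v ∈ Vec Q, x * v * tr x ∈ Vec Q := by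
  intro v hv
  obtain ⟨r, w, rfl⟩ := mem_Vec_iff.1 hv
  rw [mul_add, add_mul, ← Algebra.commutes, mul_assoc, ← Algebra.smul_def]
  refine Submodule.add_mem _ (Submodule.smul_mem _ _ (scalars_subset_Vec hN)) ?_
  obtain ⟨w', hw'⟩ := h _ ⟨w, rfl⟩
  rw [← hw']
  exact ofVec_mem_Vec _

theorem nrd_eq_spinorNorm {x : Cliff Q} (hx : x ∈ evenSubalgebra Q) :
    nrd x = spinorNorm x := by
  rw [nrd, bar, par_eq_of_mem_even (tr_mem_even hx), spinorNorm]

/-- The condition that an element of `Spin` lies in the Clifford monoid is redundant. -/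
theorem mem_spin_iff {x : Cliff Q} : x ∈ spin Q ↔ x ∈ evenSubalgebra Q ∧ spinorNorm x = 1 ∧
    ∀ w ∈ imVec Q, x * w * tr x ∈ imVec Q := by
  refine ⟨fun ⟨h1, _, h3, h4⟩ => ⟨h1, h3, h4⟩, fun ⟨h1, h3, h4⟩ => ?_⟩
  have hN : spinorNorm x ∈ scalars Q := ⟨1, by rw [map_one, h3]⟩
  exact ⟨h1, ⟨nrd_eq_spinorNorm h1 ▸ hN, preserves_Vec_of_even hN h4⟩, h3, h4⟩

theorem spinorNorm_mul {x y : Cliff Q} {s : R} (hy : spinorNorm y = algebraMap R _ s) :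
    spinorNorm (x * y) = s • spinorNorm x := by
  rw [spinorNorm, tr_mul, mul_assoc, ← mul_assoc y, ← spinorNorm, hy, ← mul_assoc,
    ← Algebra.commutes, mul_assoc, ← Algebra.smul_def, ← spinorNorm]

variable [Module.Free R V] [Module.Finite R V]

/-- If the spinor norm is an invertible scalar `r`, the transpose is `r` times a two-sided inverse.
The other product is known because the Clifford algebra is finite over `R`. -/
theorem tr_mul_self_of_spinorNorm {x : Cliff Q} {r : Rˣ}
    (h : spinorNorm x = algebraMap R _ (r : R)) : tr x * x = algebraMap R _ (r : R) := by
  have h1 : x * ((↑r⁻¹ : R) • tr x) = 1 := by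
    rw [mul_smul_comm, ← spinorNorm, h, Algebra.smul_def, ← map_mul, Units.inv_mul, map_one]
  have h2 := mul_eq_one_of_finite R h1
  rw [smul_mul_assoc, Algebra.smul_def] at h2
  calc tr x * x = algebraMap R _ (r : R) * (algebraMap R _ (↑r⁻¹ : R) * (tr x * x)) := by
        rw [← mul_assoc, ← map_mul, Units.mul_inv, map_one, one_mul]
    _ = _ := by rw [h2, mul_one]

/-- An element whose spinor norm is an invertible scalar, as a unit. -/
def unitOfSpinorNorm {x : Cliff Q} {r : Rˣ} (h : spinorNorm x = algebraMap R _ (r : R)) :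
    (Cliff Q)ˣ where
  val := x
  inv := (↑r⁻¹ : R) • tr x
  val_inv := by
    rw [mul_smul_comm, ← spinorNorm, h, Algebra.smul_def, ← map_mul, Units.inv_mul, map_one]
  inv_val := by
    rw [smul_mul_assoc, tr_mul_self_of_spinorNorm h, Algebra.smul_def, ← map_mul, Units.inv_mul,
      map_one]

/-- On even elements with invertible scalar spinor norm, `x w x^*` and `x w x⁻¹` differ by an
invertible scalar. Thus `GSpin` is described by the same condition as `Spin`, with a weaker
requirement on the spinor norm. -/
theorem mem_gspin_iff {x : Cliff Q} : x ∈ gspin Q ↔ x ∈ evenSubalgebra Q ∧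
    spinorNorm x ∈ unitScalars Q ∧ ∀ w ∈ imVec Q, x * w * tr x ∈ imVec Q := by
  constructor
  · rintro ⟨h1, ⟨hN, -⟩, hu, y, hy1, hy2, hy⟩
    rw [nrd_eq_spinorNorm h1] at hN
    rw [par_eq_of_mem_even h1] at hy1 hy2
    have htr : IsUnit (tr x) :=
      ⟨⟨tr x, tr y, by rw [← tr_mul, hy2, tr_one], by rw [← tr_mul, hy1, tr_one]⟩, rfl⟩
    obtain ⟨r, hr⟩ := mem_unitScalars hN (hu.mul htr)
    refine ⟨h1, ⟨r, hr⟩, fun w hw => ?_⟩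
    have hr' : x * tr x = algebraMap R _ (r : R) := hr.symm
    have h2 : tr x = (r : R) • y := by
      rw [← one_mul (tr x), ← hy2, mul_assoc, hr', ← Algebra.commutes, ← Algebra.smul_def]
    rw [h2, mul_smul_comm]
    exact Submodule.smul_mem _ _ (hy w hw)
  · rintro ⟨h1, ⟨r, hr⟩, h3⟩
    have hN : spinorNorm x ∈ scalars Q := ⟨r, hr⟩
    let u := unitOfSpinorNorm hr.symm
    refine ⟨h1, ⟨nrd_eq_spinorNorm h1 ▸ hN, preserves_Vec_of_even hN h3⟩, u.isUnit,
      (↑u⁻¹ : Cliff Q), ?_, ?_, fun w hw => ?_⟩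
    · rw [par_eq_of_mem_even h1]
      exact u.val_inv
    · rw [par_eq_of_mem_even h1]
      exact u.inv_val
    · change x * w * ((↑r⁻¹ : R) • tr x) ∈ _
      rw [mul_smul_comm]
      exact Submodule.smul_mem _ _ (h3 w hw)

/-- `GSpin(Q)` is a group. For inverses: an inner automorphism mapping the vectors into themselves
maps them onto themselves, even if `Q` is degenerate. -/
def gspinSubgroup (Q : QuadraticForm R V) : Subgroup (Cliff Q)ˣ where
  carrier := {u | (u : Cliff Q) ∈ gspin Q}
  one_mem' := mem_gspin_iff.2 ⟨Subalgebra.one_mem _, ⟨1, by simp [spinorNorm]⟩, by simp⟩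
  mul_mem' := by
    intro a b ha hb
    obtain ⟨a1, ⟨r, hr⟩, a3⟩ := mem_gspin_iff.1 ha
    obtain ⟨b1, ⟨s, hs⟩, b3⟩ := mem_gspin_iff.1 hb
    refine mem_gspin_iff.2 ⟨Subalgebra.mul_mem _ a1 b1, ⟨s * r, ?_⟩, fun w hw => ?_⟩
    · rw [Units.val_mul, spinorNorm_mul hs.symm, ← hr, Algebra.smul_def, ← map_mul]
      rfl
    · have := a3 _ (b3 w hw)
      simpa [mul_assoc] using this
  inv_mem' := by
    intro a ha
    obtain ⟨a1, ⟨r, hr⟩, a3⟩ := mem_gspin_iff.1 ha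
    have hinv : (↑a⁻¹ : Cliff Q) = (↑r⁻¹ : R) • tr (a : Cliff Q) :=
      congrArg (fun u : (Cliff Q)ˣ => (↑u⁻¹ : Cliff Q))
        (Units.ext rfl : a = unitOfSpinorNorm hr.symm)
    have h2 : tr (↑a⁻¹ : Cliff Q) = (↑r⁻¹ : R) • (a : Cliff Q) := by rw [hinv, tr_smul, tr_tr]
    refine mem_gspin_iff.2 ⟨?_, ⟨r⁻¹, ?_⟩, fun w hw => ?_⟩
    · rw [hinv]
      exact Subalgebra.smul_mem _ (tr_mem_even a1) _
    · rw [spinorNorm, h2, mul_smul_comm, Units.inv_mul]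
      exact Algebra.algebraMap_eq_smul_one _
    · rw [h2, mul_smul_comm]
      refine Submodule.smul_mem _ _ (conj_inv_mem (R := R) a (imVec Q) (fun v hv => ?_) hw)
      rw [hinv, mul_smul_comm]
      exact Submodule.smul_mem _ _ (a3 v hv)

theorem spin_eq : spin Q = {x | x ∈ gspin Q ∧ spinorNorm x = 1} := by
  ext x
  rw [mem_spin_iff, Set.mem_ofPred_eq, mem_gspin_iff]
  exact ⟨fun ⟨h1, h2, h3⟩ => ⟨⟨h1, ⟨1, by simp [h2]⟩, h3⟩, h2⟩,
    fun ⟨⟨h1, _, h3⟩, h2⟩ => ⟨h1, h2, h3⟩⟩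

/-- `Spin(Q)` is a group. -/
def spinSubgroup (Q : QuadraticForm R V) : Subgroup (Cliff Q)ˣ where
  carrier := {u | (u : Cliff Q) ∈ spin Q}
  one_mem' := by
    rw [Set.mem_ofPred_eq, spin_eq]
    exact ⟨(gspinSubgroup Q).one_mem, by simp [spinorNorm]⟩
  mul_mem' := by
    intro a b ha hb
    rw [Set.mem_ofPred_eq, spin_eq] at *
    refine ⟨(gspinSubgroup Q).mul_mem ha.1 hb.1, ?_⟩
    rw [Units.val_mul, spinorNorm_mul (s := 1) (by rw [hb.2, map_one]), ha.2, one_smul]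
  inv_mem' := by
    intro a ha
    rw [Set.mem_ofPred_eq, spin_eq] at *
    refine ⟨(gspinSubgroup Q).inv_mem ha.1, ?_⟩
    have h : (↑a⁻¹ : Cliff Q) = tr (a : Cliff Q) := Units.inv_eq_of_mul_eq_one_right ha.2
    have := tr_mul_self_of_spinorNorm (x := (a : Cliff Q)) (r := 1) (by rw [ha.2]; simp)
    rw [spinorNorm, h, tr_tr, this]
    simp

theorem val_image_gspinSubgroup :
    Units.val '' (gspinSubgroup Q : Set (Cliff Q)ˣ) = gspin Q := by
  ext x
  refine ⟨fun ⟨u, hu, h⟩ => h ▸ hu, fun hx => ?_⟩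
  obtain ⟨u, rfl⟩ := hx.2.2.1
  exact ⟨u, hx, rfl⟩

theorem val_image_spinSubgroup :
    Units.val '' (spinSubgroup Q : Set (Cliff Q)ˣ) = spin Q := by
  ext x
  refine ⟨fun ⟨u, hu, h⟩ => h ▸ hu, fun hx => ?_⟩
  have hx' := hx
  rw [spin_eq] at hx'
  obtain ⟨u, rfl⟩ := hx'.1.2.2.1
  exact ⟨u, hx, rfl⟩

end SpinGroups

/-! ### Clifford matrices as even Clifford elements -/

section Matrices

variable {R : Type u} [CommRing R] {W : Type v} [AddCommGroup W] [Module R W]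
  {V : Type w} [AddCommGroup V] [Module R V]
  {q : QuadraticForm R W} {Q : QuadraticForm R V} {ε η : ℤˣ}

theorem mul_adj (a b c d : Cliff q) : !![a, b; c, d] * adj !![a, b; c, d] =
    !![a * tr d - b * tr c, -(a * tr b) + b * tr a;
      c * tr d - d * tr c, -(c * tr b) + d * tr a] := by
  simp [adj, sub_eq_add_neg]

/-- The Clifford norm on `Clf(q + ε y z)` in terms of matrices. -/
theorem nrd_bottTwo (A : Matrix (Fin 2) (Fin 2) (Cliff q)) :
    nrd (bottTwo ε q A) = bottTwo ε q (A * adj A) := by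
  rw [nrd, bar_bottTwo]
  simp only [← iotaEquiv_apply, map_mul]

theorem bottTwo_injective : Function.Injective (bottTwo ε q) := (iotaEquiv ε q).injective

/-- The first two conditions in the definition of `GL₂` say that the Clifford norm of the
corresponding element of `Clf(q + ε y z)` is a given scalar. -/
theorem nrd_bottTwo_eq_iff (a b c d : Cliff q) (r : R) :
    nrd (bottTwo ε q !![a, b; c, d]) = algebraMap R _ r ↔
      a * tr d - b * tr c = algebraMap R _ r ∧ (a * tr b = b * tr a ∧ c * tr d = d * tr c) := by
  have h1 : algebraMap R (Cliff (addHyp ε q)) r = bottTwo ε q (algebraMap R _ r) := by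
    rw [← iotaEquiv_apply, AlgEquiv.commutes]
  rw [nrd_bottTwo, h1, bottTwo_injective.eq_iff, mul_adj, ← Matrix.ext_iff]
  simp only [Fin.forall_fin_two, Matrix.algebraMap_matrix_apply, Matrix.of_apply,
    Matrix.cons_val', Matrix.cons_val_zero, Matrix.cons_val_one, Matrix.cons_val_fin_one, if_true,
    zero_ne_one, one_ne_zero, if_false]
  constructor
  · rintro ⟨⟨h1, h2⟩, h3, -⟩
    exact ⟨h1, (neg_add_eq_zero.1 h2), sub_eq_zero.1 h3⟩
  · rintro ⟨h1, h2, h3⟩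
    refine ⟨⟨h1, neg_add_eq_zero.2 h2⟩, sub_eq_zero.2 h3, ?_⟩
    -- the lower right entry is the transpose of the upper left one
    have := congrArg tr h1
    simp only [tr_sub, tr_mul, tr_tr, tr_algebraMap] at this
    rw [← this]
    abel

/-- The action of a matrix on Clifford vectors of `q + ε y z`. -/
theorem bottTwo_mul_mul_tr (a b c d v : Cliff q) (s t : R) :
    bottTwo ε q !![a, b; c, d] *
        bottTwo ε q !![v, algebraMap R _ s; algebraMap R _ t, bar v] *
        tr (bottTwo ε q !![a, b; c, d]) =
      bottTwo ε q
        !![a * v * bar d + b * bar v * bar c + t • (b * bar d) + s • (a * bar c),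
          a * v * bar b + b * bar v * bar a + t • (b * bar b) + s • (a * bar a);
          c * v * bar d + d * bar v * bar c + t • (d * bar d) + s • (c * bar c),
          bar (a * v * bar d + b * bar v * bar c + t • (b * bar d) + s • (a * bar c))] := by
  rw [tr_bottTwo]
  simp only [← iotaEquiv_apply, ← map_mul]
  congr 1
  have h1 : ∀ x y z : Cliff q, x * algebraMap R _ s * z = s • (x * z) := fun x _ z => by
    rw [← Algebra.commutes, mul_assoc, Algebra.smul_def]
  have h2 : ∀ x z : Cliff q, x * algebraMap R _ t * z = t • (x * z) := fun x z => by
    rw [← Algebra.commutes, mul_assoc, Algebra.smul_def]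
  simp only [Matrix.mul_fin_two, Matrix.of_apply, Matrix.cons_val', Matrix.cons_val_zero,
    Matrix.cons_val_one, Matrix.cons_val_fin_one, add_mul, h1 _ 0, h2, bar_add, bar_mul, bar_bar,
    bar_smul, mul_assoc]
  congr 1
  ext i j
  fin_cases i <;> fin_cases j <;>
    simp only [Fin.zero_eta, Fin.mk_one, Matrix.cons_val', Matrix.cons_val_zero,
      Matrix.cons_val_one, Matrix.cons_val_fin_one] <;> abel

/-- The remaining conditions in the definition of `GL₂` say that the corresponding element of
`Clf(q + ε y z)` preserves the Clifford vectors. -/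
theorem preserves_Vec_bottTwo_iff (a b c d : Cliff q) :
    (∀ v ∈ Vec (addHyp ε q),
      bottTwo ε q !![a, b; c, d] * v * tr (bottTwo ε q !![a, b; c, d]) ∈ Vec (addHyp ε q)) ↔
    (a * bar a ∈ scalars q ∧ b * bar b ∈ scalars q ∧
      c * bar c ∈ scalars q ∧ d * bar d ∈ scalars q) ∧
    (a * bar c ∈ Vec q ∧ b * bar d ∈ Vec q) ∧
    (∀ x ∈ Vec q, a * x * bar b + b * bar x * bar a ∈ scalars q ∧
      c * x * bar d + d * bar x * bar c ∈ scalars q) ∧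
    (∀ x ∈ Vec q, a * x * bar d + b * bar x * bar c ∈ Vec q) := by
  have key : (∀ v ∈ Vec (addHyp ε q),
      bottTwo ε q !![a, b; c, d] * v * tr (bottTwo ε q !![a, b; c, d]) ∈ Vec (addHyp ε q)) ↔
      ∀ v ∈ Vec q, ∀ s t : R,
        a * v * bar d + b * bar v * bar c + t • (b * bar d) + s • (a * bar c) ∈ Vec q ∧
        a * v * bar b + b * bar v * bar a + t • (b * bar b) + s • (a * bar a) ∈ scalars q ∧
        c * v * bar d + d * bar v * bar c + t • (d * bar d) + s • (c * bar c) ∈ scalars q := by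
    constructor
    · intro H v hv s t
      have := H _ ((Vec_addHyp_iff ε q).2 ⟨v, hv, s, t, rfl⟩)
      rw [bottTwo_mul_mul_tr, bottTwo_mem_Vec] at this
      exact ⟨this.1, this.2.1, this.2.2.1⟩
    · intro H x hx
      obtain ⟨v, hv, s, t, rfl⟩ := (Vec_addHyp_iff ε q).1 hx
      rw [bottTwo_mul_mul_tr, bottTwo_mem_Vec]
      obtain ⟨h1, h2, h3⟩ := H v hv s t
      exact ⟨h1, h2, h3, rfl⟩
  rw [key]
  constructor
  · intro H
    -- specialize `(v, s, t)` to `(0, 0, 1)`, `(0, 1, 0)` and `(v, 0, 0)`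
    have h0 := fun s t => H 0 (zero_mem _) s t
    simp only [mul_zero, zero_mul, bar_zero, zero_add] at h0
    obtain ⟨h1, h2, h3⟩ := h0 0 1
    obtain ⟨h4, h5, h6⟩ := h0 1 0
    simp only [one_smul, zero_smul, add_zero, zero_add] at h1 h2 h3 h4 h5 h6
    refine ⟨⟨h5, h2, h6, h3⟩, ⟨h4, h1⟩, fun x hx => ?_, fun x hx => ?_⟩
    · simpa using (H x hx 0 0).2
    · simpa using (H x hx 0 0).1
  · rintro ⟨⟨h1, h2, h3, h4⟩, ⟨h5, h6⟩, h7, h8⟩ v hv s t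
    refine ⟨Submodule.add_mem _ (Submodule.add_mem _ (h8 v hv) (Submodule.smul_mem _ _ h6))
      (Submodule.smul_mem _ _ h5), ?_, ?_⟩
    · exact add_mem_scalars (add_mem_scalars (h7 v hv).1 (smul_mem_scalars _ h2))
        (smul_mem_scalars _ h1)
    · exact add_mem_scalars (add_mem_scalars (h7 v hv).2 (smul_mem_scalars _ h4))
        (smul_mem_scalars _ h3)

variable (k : SqExt (addHyp ε q) Q η)

theorem spinorNorm_evenHom_bottTwo_iff (a b c d : Cliff q) (r : R) :
    spinorNorm (k.evenHom (bottTwo ε q !![a, b; c, d])) = algebraMap R _ r ↔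
      a * tr d - b * tr c = algebraMap R _ r ∧ (a * tr b = b * tr a ∧ c * tr d = d * tr c) := by
  rw [k.spinorNorm_evenHom, ← k.evenHom.commutes, k.evenHom_injective.eq_iff, nrd_bottTwo_eq_iff]

theorem spinorNorm_of_mem_GL2 {A : Matrix (Fin 2) (Fin 2) (Cliff q)} (hA : A ∈ GL2 q) (r : R) :
    spinorNorm (k.evenHom (bottTwo ε q A)) = algebraMap R _ r ↔
      pseudoDet A = algebraMap R _ r := by
  obtain ⟨a, b, c, d, rfl, -, h2, -⟩ := hA
  rw [spinorNorm_evenHom_bottTwo_iff]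
  exact ⟨fun h => h.1, fun h => ⟨h, h2⟩⟩

/-- The isomorphism of algebras `M₂(Clf(q)) ≅ Clf(Q)_+`. -/
def bottEquiv : Matrix (Fin 2) (Fin 2) (Cliff q) ≃ₐ[R] evenSubalgebra Q :=
  (iotaEquiv ε q).trans k.evenEquiv

/-- The homomorphism of unit groups induced by `bottEquiv`. -/
def bottUnits : (Matrix (Fin 2) (Fin 2) (Cliff q))ˣ →* (Cliff Q)ˣ :=
  Units.map (k.evenHom.comp (iotaEquiv ε q).toAlgHom : _ →* Cliff Q)

theorem coe_bottUnits (A : (Matrix (Fin 2) (Fin 2) (Cliff q))ˣ) :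
    (bottUnits k A : Cliff Q) = k.evenHom (bottTwo ε q A) := rfl

section Free

variable [Module.Free R V] [Module.Finite R V]

/-- A matrix lies in `GL₂` exactly if the corresponding even element lies in `GSpin`. -/
theorem mem_GL2_iff (A : Matrix (Fin 2) (Fin 2) (Cliff q)) :
    A ∈ GL2 q ↔ k.evenHom (bottTwo ε q A) ∈ gspin Q := by
  have key : ∀ a b c d : Cliff q, k.evenHom (bottTwo ε q !![a, b; c, d]) ∈ gspin Q ↔
      a * tr d - b * tr c ∈ unitScalars q ∧ (a * tr b = b * tr a ∧ c * tr d = d * tr c) ∧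
      ((a * bar a ∈ scalars q ∧ b * bar b ∈ scalars q ∧
        c * bar c ∈ scalars q ∧ d * bar d ∈ scalars q) ∧
      (a * bar c ∈ Vec q ∧ b * bar d ∈ Vec q) ∧
      (∀ x ∈ Vec q, a * x * bar b + b * bar x * bar a ∈ scalars q ∧
        c * x * bar d + d * bar x * bar c ∈ scalars q) ∧
      (∀ x ∈ Vec q, a * x * bar d + b * bar x * bar c ∈ Vec q)) := by
    intro a b c d
    rw [← preserves_Vec_bottTwo_iff (ε := ε), mem_gspin_iff, k.preserves_imVec_iff]
    constructor
    · rintro ⟨-, ⟨r, hr⟩, h3⟩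
      obtain ⟨h1, h2⟩ := (spinorNorm_evenHom_bottTwo_iff k a b c d r).1 hr.symm
      exact ⟨⟨r, h1.symm⟩, h2, h3⟩
    · rintro ⟨⟨r, hr⟩, h2, h3⟩
      exact ⟨k.evenHom_mem_even _,
        ⟨r, ((spinorNorm_evenHom_bottTwo_iff k a b c d r).2 ⟨hr.symm, h2⟩).symm⟩, h3⟩
  constructor
  · rintro ⟨a, b, c, d, rfl, h⟩
    exact (key a b c d).2 h
  · intro h
    rw [A.eta_fin_two] at h
    exact ⟨_, _, _, _, A.eta_fin_two, (key _ _ _ _).1 h⟩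

/-- A matrix lies in `SL₂` exactly if the corresponding even element lies in `Spin`. -/
theorem mem_SL2_iff (A : Matrix (Fin 2) (Fin 2) (Cliff q)) :
    A ∈ SL2 q ↔ k.evenHom (bottTwo ε q A) ∈ spin Q := by
  rw [spin_eq, Set.mem_ofPred_eq, ← mem_GL2_iff]
  refine and_congr_right fun hA => ?_
  have := spinorNorm_of_mem_GL2 k hA 1
  rw [map_one, map_one] at this
  exact this.symm

end Free

/-- A subgroup of the units of `Clf(Q)` consisting of even elements is isomorphic to its preimage
in the units of `M₂(Clf(q))`. -/
theorem exists_comap_equiv (H : Subgroup (Cliff Q)ˣ)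
    (hH : ∀ u ∈ H, (u : Cliff Q) ∈ evenSubalgebra Q) :
    (∃ Φ : H.comap (bottUnits k) ≃* H, ∀ A : H.comap (bottUnits k),
      ((Φ A : (Cliff Q)ˣ) : Cliff Q) = k.evenHom (bottTwo ε q
        ((A : (Matrix (Fin 2) (Fin 2) (Cliff q))ˣ) : Matrix (Fin 2) (Fin 2) (Cliff q)))) := by
  refine ⟨MulEquiv.ofBijective ((bottUnits k).subgroupComap H) ⟨fun A B h => ?_, fun u => ?_⟩,
    fun A => rfl⟩
  · have h2 := congrArg (fun u : H => ((u : (Cliff Q)ˣ) : Cliff Q)) h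
    exact Subtype.ext (Units.ext (bottTwo_injective (k.evenHom_injective h2)))
  · -- the inverse of an element of `H` is even too, so both come from matrices
    let x : evenSubalgebra Q := ⟨_, hH _ u.2⟩
    let y : evenSubalgebra Q := ⟨_, hH _ (H.inv_mem u.2)⟩
    have hxy : x * y = 1 := Subtype.ext (u : (Cliff Q)ˣ).mul_inv
    have hyx : y * x = 1 := Subtype.ext (u : (Cliff Q)ˣ).inv_mul
    let A : (Matrix (Fin 2) (Fin 2) (Cliff q))ˣ :=
      ⟨(bottEquiv k).symm x, (bottEquiv k).symm y, by rw [← map_mul, hxy, map_one],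
        by rw [← map_mul, hyx, map_one]⟩
    have hA : bottUnits k A = u := by
      apply Units.ext
      change ((bottEquiv k ((bottEquiv k).symm x) : evenSubalgebra Q) : Cliff Q) = (u : (Cliff Q)ˣ)
      rw [AlgEquiv.apply_symm_apply]
    exact ⟨⟨A, by rw [Subgroup.mem_comap, hA]; exact u.2⟩, Subtype.ext hA⟩

/-- A set of matrices is a group once it is the preimage of a group of even elements. -/
theorem val_image_comap (H : Subgroup (Cliff Q)ˣ) (S : Set (Matrix (Fin 2) (Fin 2) (Cliff q)))
    (T : Set (Cliff Q)) (hS : ∀ A, A ∈ S ↔ k.evenHom (bottTwo ε q A) ∈ T)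
    (hT : T ⊆ evenSubalgebra Q) (hH : Units.val '' (H : Set (Cliff Q)ˣ) = T) :
    Units.val '' (H.comap (bottUnits k) : Set (Matrix (Fin 2) (Fin 2) (Cliff q))ˣ) = S := by
  subst hH
  obtain ⟨Φ, hΦ⟩ := exists_comap_equiv k H fun u hu => hT ⟨u, hu, rfl⟩
  ext A
  rw [hS]
  constructor
  · rintro ⟨u, hu, rfl⟩
    exact ⟨_, hu, coe_bottUnits k u⟩
  · rintro ⟨u, hu, h⟩
    obtain ⟨B, hB⟩ := Φ.surjective ⟨u, hu⟩
    refine ⟨_, B.2, bottTwo_injective (ε := ε) (k.evenHom_injective ?_)⟩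
    rw [← h, ← hΦ, hB]

end Matrices

/-! ### The explicit formula for `ψ` -/

section Explicit

variable {R : Type u} [CommRing R] {W : Type v} [AddCommGroup W] [Module R W]
  (ε : ℤˣ) (q : QuadraticForm R W)

theorem evenPart_bottTwo (a b c d : Cliff q) :
    evenPart (bottTwo ε q !![a, b; c, d]) =
      inclHyp ε q (evenPart a) * (genF ε q * genG ε q) + inclHyp ε q (oddPart b) * genF ε q
        - inclHyp ε q (oddPart c) * genG ε q +
        inclHyp ε q (evenPart d) * (genG ε q * genF ε q) ∧
    oddPart (bottTwo ε q !![a, b; c, d]) =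
      inclHyp ε q (oddPart a) * (genF ε q * genG ε q) + inclHyp ε q (evenPart b) * genF ε q
        + inclHyp ε q (evenPart c) * genG ε q -
        inclHyp ε q (oddPart d) * (genG ε q * genF ε q) := by
  have hF : genF ε q ∈ CliffordAlgebra.evenOdd (-addHyp ε q) 1 := ofVec_mem_odd _
  have hG : genG ε q ∈ CliffordAlgebra.evenOdd (-addHyp ε q) 1 :=
    Submodule.smul_mem _ _ (ofVec_mem_odd _)
  have hFG : genF ε q * genG ε q ∈ CliffordAlgebra.evenOdd (-addHyp ε q) 0 :=
    mul_mem_evenOdd (by decide) hF hG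
  have hGF : genG ε q * genF ε q ∈ CliffordAlgebra.evenOdd (-addHyp ε q) 0 :=
    mul_mem_evenOdd (by decide) hG hF
  have hi := fun x => evenPart_map (inclHyp ε q) (inclHyp_ofVec_mem ε q) x
  constructor
  · simp [bottTwo, evenPart_mul_odd _ hF, evenPart_mul_odd _ hG, evenPart_mul_even _ hFG,
      evenPart_mul_even _ hGF, hi, evenPart_par, oddPart_par, sub_eq_add_neg]
  · simp [bottTwo, evenPart_mul_odd _ hF, evenPart_mul_odd _ hG, evenPart_mul_even _ hFG,
      evenPart_mul_even _ hGF, hi, evenPart_par, oddPart_par, sub_eq_add_neg]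

theorem psi_explicit (a b c d : Cliff q) :
    bottOne (addHyp ε q) (bottTwo ε q !![a, b; c, d]) =
      (inclBott ε q (evenPart a) *
            (inclSq (addHyp ε q) (genF ε q) * inclSq (addHyp ε q) (genG ε q)) +
          inclBott ε q (oddPart b) * inclSq (addHyp ε q) (genF ε q)
          - inclBott ε q (oddPart c) * inclSq (addHyp ε q) (genG ε q) +
          inclBott ε q (evenPart d) *
            (inclSq (addHyp ε q) (genG ε q) * inclSq (addHyp ε q) (genF ε q))) +
        (inclBott ε q (oddPart a) *
            (inclSq (addHyp ε q) (genF ε q) * inclSq (addHyp ε q) (genG ε q)) +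
          inclBott ε q (evenPart b) * inclSq (addHyp ε q) (genF ε q)
          + inclBott ε q (evenPart c) * inclSq (addHyp ε q) (genG ε q) -
          inclBott ε q (oddPart d) *
            (inclSq (addHyp ε q) (genG ε q) * inclSq (addHyp ε q) (genF ε q))) *
          genE (addHyp ε q) := by
  rw [bottOne, (evenPart_bottTwo ε q a b c d).1, (evenPart_bottTwo ε q a b c d).2]
  simp only [inclBott, AlgHom.comp_apply, map_add, map_sub, map_mul]

end Explicit

/-! ### The isomorphisms over a ring, and the Lorentz form -/

section Main

/-- The isomorphism `ψ` over an arbitrary commutative ring, its compatibilities, and the induced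
isomorphisms of groups. -/
theorem exists_bott_iso (R : Type*) [CommRing R] (W : Type*) [AddCommGroup W] [Module R W]
      [Module.Free R W] [Module.Finite R W] (q : QuadraticForm R W) (ε : ℤˣ) :
      ∃ (iota : Matrix (Fin 2) (Fin 2) (Clf.Cliff q) ≃ₐ[R] Clf.Cliff (Clf.addHyp ε q))
        (phi : Clf.Cliff (Clf.addHyp ε q) ≃ₐ[R] Clf.evenSubalgebra (Clf.bottForm ε q)),
        (∀ A, iota A = Clf.bottTwo ε q A) ∧
        (∀ x, (phi x : Clf.Cliff (Clf.bottForm ε q)) = Clf.bottOne (Clf.addHyp ε q) x) ∧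
        (Clf.genE (Clf.addHyp ε q) * Clf.genE (Clf.addHyp ε q) = -1 ∧
          Clf.genF ε q * Clf.genF ε q = 0 ∧ Clf.genG ε q * Clf.genG ε q = 0 ∧
          Clf.genF ε q * Clf.genG ε q = 1 - Clf.genG ε q * Clf.genF ε q) ∧
        (∀ a b c d : Clf.Cliff q,
          let j := Clf.inclBott ε q
          let e := Clf.genE (Clf.addHyp ε q)
          let f := Clf.inclSq (Clf.addHyp ε q) (Clf.genF ε q)
          let g := Clf.inclSq (Clf.addHyp ε q) (Clf.genG ε q)
          (phi (iota !![a, b; c, d]) : Clf.Cliff (Clf.bottForm ε q)) =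
            (j (Clf.evenPart a) * (f * g) + j (Clf.oddPart b) * f
              - j (Clf.oddPart c) * g + j (Clf.evenPart d) * (g * f)) +
            (j (Clf.oddPart a) * (f * g) + j (Clf.evenPart b) * f
              + j (Clf.evenPart c) * g - j (Clf.oddPart d) * (g * f)) * e) ∧
        (∀ A, (phi (iota (Clf.adj A)) : Clf.Cliff (Clf.bottForm ε q)) =
          Clf.tr (phi (iota A) : Clf.Cliff (Clf.bottForm ε q))) ∧
        (∀ A, (phi (iota (A * Clf.adj A)) : Clf.Cliff (Clf.bottForm ε q)) =
          Clf.spinorNorm (phi (iota A) : Clf.Cliff (Clf.bottForm ε q))) ∧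
        (∀ a b c d : Clf.Cliff q,
          (phi (iota !![a * Clf.tr d - b * Clf.tr c, -(a * Clf.tr b) + b * Clf.tr a;
              c * Clf.tr d - d * Clf.tr c, -(c * Clf.tr b) + d * Clf.tr a]) :
                Clf.Cliff (Clf.bottForm ε q)) =
            Clf.spinorNorm (phi (iota !![a, b; c, d]) : Clf.Cliff (Clf.bottForm ε q))) ∧
        (∀ A ∈ Clf.GL2 q, ∃ r : Rˣ,
          Clf.pseudoDet A = algebraMap R (Clf.Cliff q) r ∧
          Clf.spinorNorm (phi (iota A) : Clf.Cliff (Clf.bottForm ε q)) =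
            algebraMap R (Clf.Cliff (Clf.bottForm ε q)) r) ∧
        ∃ (gl sl : Subgroup (Matrix (Fin 2) (Fin 2) (Clf.Cliff q))ˣ)
          (gs sp : Subgroup (Clf.Cliff (Clf.bottForm ε q))ˣ),
          Units.val '' (gl : Set (Matrix (Fin 2) (Fin 2) (Clf.Cliff q))ˣ) = Clf.GL2 q ∧
          Units.val '' (sl : Set (Matrix (Fin 2) (Fin 2) (Clf.Cliff q))ˣ) = Clf.SL2 q ∧
          Units.val '' (gs : Set (Clf.Cliff (Clf.bottForm ε q))ˣ) =
            Clf.gspin (Clf.bottForm ε q) ∧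
          Units.val '' (sp : Set (Clf.Cliff (Clf.bottForm ε q))ˣ) =
            Clf.spin (Clf.bottForm ε q) ∧
          (∃ Φ : sl ≃* sp, ∀ A : sl,
            ((Φ A : (Clf.Cliff (Clf.bottForm ε q))ˣ) : Clf.Cliff (Clf.bottForm ε q)) =
              phi (iota ((A : (Matrix (Fin 2) (Fin 2) (Clf.Cliff q))ˣ) :
                Matrix (Fin 2) (Fin 2) (Clf.Cliff q)))) ∧
          (∃ Φ : gl ≃* gs, ∀ A : gl,
            ((Φ A : (Clf.Cliff (Clf.bottForm ε q))ˣ) : Clf.Cliff (Clf.bottForm ε q)) =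
              phi (iota ((A : (Matrix (Fin 2) (Fin 2) (Clf.Cliff q))ˣ) :
                Matrix (Fin 2) (Fin 2) (Clf.Cliff q)))) := by
  let k := sqExtAddSq (addHyp ε q)
  have htr : ∀ A, k.evenHom (bottTwo ε q (adj A)) = tr (k.evenHom (bottTwo ε q A)) := fun A => by
    rw [← bar_bottTwo, ← k.tr_evenHom]
  have hN : ∀ A, k.evenHom (bottTwo ε q (A * adj A)) = spinorNorm (k.evenHom (bottTwo ε q A)) :=
    fun A => by rw [k.spinorNorm_evenHom, nrd_bottTwo]
  have hgs : gspin (bottForm ε q) ⊆ evenSubalgebra (bottForm ε q) := fun x hx => hx.1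
  have hsp : spin (bottForm ε q) ⊆ evenSubalgebra (bottForm ε q) := fun x hx => hx.1
  refine ⟨iotaEquiv ε q, k.evenEquiv, fun A => rfl, evenHom_sqExtAddSq _,
    ⟨genE_mul_self _, genF_mul_self ε q, genG_mul_self ε q,
      eq_sub_of_add_eq (genF_mul_genG_add ε q)⟩, fun a b c d => ?_, htr, hN, fun a b c d => ?_,
    fun A hA => ?_, (gspinSubgroup _).comap (bottUnits k), (spinSubgroup _).comap (bottUnits k),
    gspinSubgroup _, spinSubgroup _,
    val_image_comap k _ _ _ (mem_GL2_iff k) hgs val_image_gspinSubgroup,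
    val_image_comap k _ _ _ (mem_SL2_iff k) hsp val_image_spinSubgroup,
    val_image_gspinSubgroup, val_image_spinSubgroup,
    exists_comap_equiv k _ fun u hu => hsp hu, exists_comap_equiv k _ fun u hu => hgs hu⟩
  · exact (evenHom_sqExtAddSq _ _).trans (psi_explicit ε q a b c d)
  · rw [← mul_adj]
    exact hN _
  · obtain ⟨-, ⟨r, hr⟩, -⟩ := mem_gspin_iff.1 ((mem_GL2_iff k A).1 hA)
    exact ⟨r, (spinorNorm_of_mem_GL2 k hA r).1 hr.symm, hr.symm⟩

/-- The Lorentz form is `-(x ^ 2 + y z + q)` with `q` a sum of squares: the hyperbolic plane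
`-y z` has the orthogonal coordinates `(y - z) / 2` and `(y + z) / 2`. -/
def sqExtLorentz (m : ℕ) : SqExt (addHyp 1 (sumSq m)) (lorentz (m + 2)) (-1) where
  equiv :=
    { toFun := fun x => Fin.cons ((x.1.2.1 - x.1.2.2) / 2)
        (Fin.cons ((x.1.2.1 + x.1.2.2) / 2) (Fin.cons x.2 x.1.1))
      map_add' := fun x y => by
        ext i
        refine Fin.cases ?_ (fun i => Fin.cases ?_ (fun i => Fin.cases ?_ (fun i => ?_) i) i) i
        · simp
          ring
        · simp
          ring
        · rfl
        · rfl
      map_smul' := fun r x => by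
        ext i
        refine Fin.cases ?_ (fun i => Fin.cases ?_ (fun i => Fin.cases ?_ (fun i => ?_) i) i) i
        · simp
          ring
        · simp
          ring
        · rfl
        · rfl
      invFun := fun v => ((fun i => v i.succ.succ.succ, (v 0 + v 1, v 1 - v 0)), v 2)
      left_inv := fun x => by
        refine Prod.ext (Prod.ext (funext fun i => ?_) (Prod.ext ?_ ?_)) ?_
        · simp
        · change (x.1.2.1 - x.1.2.2) / 2 + (x.1.2.1 + x.1.2.2) / 2 = _
          ring
        · change (x.1.2.1 + x.1.2.2) / 2 - (x.1.2.1 - x.1.2.2) / 2 = _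
          ring
        · rfl
      right_inv := fun v => by
        ext i
        refine Fin.cases ?_ (fun i => Fin.cases ?_ (fun i => Fin.cases ?_ (fun i => ?_) i) i) i
        · change (v 0 + v 1 - (v 1 - v 0)) / 2 = _
          ring
        · change (v 0 + v 1 + (v 1 - v 0)) / 2 = v 1
          ring
        · rfl
        · rfl }
  map_equiv := by
    rintro ⟨w, y, z⟩ x
    rw [addHyp_apply]
    simp only [lorentz, sumSq, QuadraticMap.weightedSumSquares_apply, Fin.sum_univ_succ,
      LinearEquiv.coe_mk, LinearMap.coe_mk, AddHom.coe_mk, Fin.cons_zero, Fin.cons_succ,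
      Fin.succ_ne_zero, if_true, if_false, smul_eq_mul, one_mul, neg_mul, Finset.sum_neg_distrib]
    push_cast
    ring

/-- The sign change `L ↦ -L` alters the Clifford algebra, but `SqExt` with `η = -1` still gives its even
part. -/
theorem exists_lorentz_iso (n : ℕ) (hn : 1 ≤ n) :
      ∃ (Ψ : Matrix (Fin 2) (Fin 2) (Clf.Cliff (Clf.sumSq (n - 1))) ≃ₐ[ℝ]
          Clf.evenSubalgebra (Clf.lorentz (n + 1)))
        (sl : Subgroup (Matrix (Fin 2) (Fin 2) (Clf.Cliff (Clf.sumSq (n - 1))))ˣ)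
        (sp : Subgroup (Clf.Cliff (Clf.lorentz (n + 1)))ˣ),
        Units.val '' (sl : Set (Matrix (Fin 2) (Fin 2) (Clf.Cliff (Clf.sumSq (n - 1))))ˣ) =
          Clf.SL2 (Clf.sumSq (n - 1)) ∧
        Units.val '' (sp : Set (Clf.Cliff (Clf.lorentz (n + 1)))ˣ) =
          Clf.spin (Clf.lorentz (n + 1)) ∧
        ∃ Φ : sl ≃* sp, ∀ A : sl,
          ((Φ A : (Clf.Cliff (Clf.lorentz (n + 1)))ˣ) : Clf.Cliff (Clf.lorentz (n + 1))) =
            Ψ ((A : (Matrix (Fin 2) (Fin 2) (Clf.Cliff (Clf.sumSq (n - 1))))ˣ) :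
              Matrix (Fin 2) (Fin 2) (Clf.Cliff (Clf.sumSq (n - 1)))) := by
  obtain ⟨m, rfl⟩ := Nat.exists_eq_add_of_le' hn
  let k := sqExtLorentz m
  exact ⟨bottEquiv k, (spinSubgroup _).comap (bottUnits k), spinSubgroup _,
    val_image_comap k _ _ _ (mem_SL2_iff k) (fun x hx => hx.1) val_image_spinSubgroup,
    val_image_spinSubgroup, exists_comap_equiv k _ fun u hu => hu.1⟩

end Main

/-! ### Change of rings -/

section SemilinearMaps

variable {R S : Type u} [CommRing R] [CommRing S] {W : Type v} [AddCommGroup W] [Module R W]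
  {W' : Type w} [AddCommGroup W'] [Module S W'] (f : R →+* S) (p : QuadraticForm R W)
  (p' : QuadraticForm S W') (φ : W →ₛₗ[f] W') (h : ∀ m, p' (φ m) = f (p m))

theorem semiMap_ofVec (m : W) : semiMap f p p' φ h (ofVec p m) = ofVec p' (φ m) := by
  let : Algebra R (Cliff p') :=
    ((algebraMap S (Cliff p')).comp f).toAlgebra' fun r x => Algebra.commutes (f r) x
  exact CliffordAlgebra.lift_ι_apply _ _ _

theorem semiMap_algebraMap (r : R) :
    semiMap f p p' φ h (algebraMap R _ r) = algebraMap S _ (f r) := by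
  let : Algebra R (Cliff p') :=
    ((algebraMap S (Cliff p')).comp f).toAlgebra' fun r x => Algebra.commutes (f r) x
  exact AlgHom.commutes _ r

theorem semiMap_smul (r : R) (x : Cliff p) :
    semiMap f p p' φ h (r • x) = f r • semiMap f p p' φ h x := by
  rw [Algebra.smul_def, map_mul, semiMap_algebraMap, ← Algebra.smul_def]

theorem semiMap_par (x : Cliff p) :
    semiMap f p p' φ h (par x) = par (semiMap f p p' φ h x) := by
  induction x using cliff_induction with
  | h1 r => simp [semiMap_algebraMap]
  | hadd x y hx hy => simp [hx, hy]
  | hmul w x hx => simp [hx, semiMap_ofVec]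

theorem semiMap_tr (x : Cliff p) :
    semiMap f p p' φ h (tr x) = tr (semiMap f p p' φ h x) := by
  induction x using cliff_induction with
  | h1 r => simp [semiMap_algebraMap]
  | hadd x y hx hy => simp [hx, hy]
  | hmul w x hx => simp [hx, semiMap_ofVec]

end SemilinearMaps

/-- A ring homomorphism out of a Clifford algebra is determined on scalars and vectors. -/
theorem cliff_ringHom_ext {R : Type u} [CommRing R] {W : Type v} [AddCommGroup W] [Module R W]
    {q : QuadraticForm R W} {A : Type*} [Ring A] {α β : Cliff q →+* A}
    (h1 : ∀ r, α (algebraMap R _ r) = β (algebraMap R _ r))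
    (h2 : ∀ w, α (ofVec q w) = β (ofVec q w)) : α = β := by
  ext x
  induction x using cliff_induction with
  | h1 r => exact h1 r
  | hadd x y hx hy => rw [map_add, map_add, hx, hy]
  | hmul w x hx => rw [map_mul, map_mul, hx, h2]

/-! ### Base change of integral forms -/

section IntegralForms

variable {n : ℕ} (q : QuadraticForm ℤ (Fin n → ℤ)) {R S T : Type} [CommRing R] [CommRing S]
  [CommRing T]

theorem cliffMap_ofVec (f : R →+* S) (m : Fin n → R) :
    cliffMap q f (ofVec _ m) = ofVec _ (coordMap n f m) := semiMap_ofVec _ _ _ _ _ m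

theorem cliffMap_algebraMap (f : R →+* S) (r : R) :
    cliffMap q f (algebraMap R _ r) = algebraMap S _ (f r) := semiMap_algebraMap _ _ _ _ _ r

theorem cliffMap_smul (f : R →+* S) (r : R) (x : Cliff (extend q R)) :
    cliffMap q f (r • x) = f r • cliffMap q f x := semiMap_smul _ _ _ _ _ r x

theorem cliffMap_par (f : R →+* S) (x : Cliff (extend q R)) :
    cliffMap q f (par x) = par (cliffMap q f x) := semiMap_par _ _ _ _ _ x

theorem cliffMap_tr (f : R →+* S) (x : Cliff (extend q R)) :
    cliffMap q f (tr x) = tr (cliffMap q f x) := semiMap_tr _ _ _ _ _ x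

theorem cliffMap_bar (f : R →+* S) (x : Cliff (extend q R)) :
    cliffMap q f (bar x) = bar (cliffMap q f x) := by
  rw [bar, cliffMap_par, cliffMap_tr, bar]

theorem cliffMap_comp (g : S →+* T) (f : R →+* S) :
    cliffMap q (g.comp f) = (cliffMap q g).comp (cliffMap q f) := by
  refine cliff_ringHom_ext (fun r => ?_) (fun w => ?_)
  · simp [cliffMap_algebraMap]
  · simp only [RingHom.comp_apply, cliffMap_ofVec]
    rfl

theorem cliffMap_id : cliffMap q (RingHom.id R) = RingHom.id _ := by
  refine cliff_ringHom_ext (fun r => ?_) (fun w => ?_)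
  · simp [cliffMap_algebraMap]
  · simp only [RingHom.id_apply, cliffMap_ofVec]
    rfl

theorem coordMap_single (f : R →+* S) (i : Fin n) :
    coordMap n f (Pi.single i 1) = Pi.single i 1 := by
  ext j
  by_cases h : j = i
  · subst h; simp [coordMap]
  · simp [coordMap, h]

theorem cliffMap_single (f : R →+* S) (i : Fin n) :
    cliffMap q f (ofVec _ (Pi.single i 1)) = ofVec _ (Pi.single i 1) := by
  rw [cliffMap_ofVec, coordMap_single]

theorem cliffMap_mem_Vec (f : R →+* S) {x : Cliff (extend q R)} (hx : x ∈ Vec (extend q R)) :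
    cliffMap q f x ∈ Vec (extend q S) := by
  obtain ⟨r, w, rfl⟩ := mem_Vec_iff.1 hx
  exact mem_Vec_iff.2 ⟨f r, coordMap n f w, by rw [map_add, cliffMap_algebraMap, cliffMap_ofVec]⟩

/-- Together with `polar_extend_single`: `q` and its extension to `ℤ` have the same coefficients. -/
theorem extend_single (i : Fin n) : extend q ℤ (Pi.single i 1) = q (Pi.single i 1) := by
  rw [extend_apply]
  have h1 : ∀ a, ∑ b ∈ Finset.Ioi a,
      ((QuadraticMap.polar q (Pi.single a 1) (Pi.single b 1) : ℤ) : ℤ) *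
        ((Pi.single i 1 : Fin n → ℤ) a * (Pi.single i 1 : Fin n → ℤ) b) = 0 := fun a =>
    Finset.sum_eq_zero fun b hb => by
      have hab : a < b := Finset.mem_Ioi.1 hb
      rcases eq_or_ne a i with rfl | h
      · simp [hab.ne']
      · simp [h]
  simp only [Int.cast_id] at h1 ⊢
  rw [Finset.sum_eq_zero fun a _ => h1 a, add_zero, Finset.sum_eq_single i]
  · simp
  · intro b _ hb
    simp [hb]
  · simp

theorem polar_extend_single {i j : Fin n} (hij : i < j) :
    QuadraticMap.polar (extend q ℤ) (Pi.single i 1) (Pi.single j 1) =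
      QuadraticMap.polar q (Pi.single i 1) (Pi.single j 1) := by
  have h : ∀ x y : Fin n → ℤ, QuadraticMap.polar (extend q ℤ) x y =
      ∑ a, q (Pi.single a 1) * (2 * x a * y a) +
      ∑ a, ∑ b ∈ Finset.Ioi a, QuadraticMap.polar q (Pi.single a 1) (Pi.single b 1) *
        (x a * y b + y a * x b) := by
    intro x y
    simp only [QuadraticMap.polar, extend_apply, Pi.add_apply, Int.cast_id]
    rw [add_sub_add_comm, add_sub_add_comm, ← Finset.sum_sub_distrib, ← Finset.sum_sub_distrib,
      ← Finset.sum_sub_distrib, ← Finset.sum_sub_distrib]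
    simp only [← Finset.sum_sub_distrib]
    congr 1
    · exact Finset.sum_congr rfl fun a _ => by ring
    · exact Finset.sum_congr rfl fun a _ => Finset.sum_congr rfl fun b _ => by ring
  rw [h, Finset.sum_eq_zero, zero_add, Finset.sum_eq_single i, Finset.sum_eq_single j]
  · simp [hij.ne, hij.ne']
  · intro b hb hbj
    have : i ≠ b := (Finset.mem_Ioi.1 hb).ne
    simp [hbj, hij.ne]
  · simp [hij]
  · intro a _ hai
    refine Finset.sum_eq_zero fun b hb => ?_
    have hab : a < b := Finset.mem_Ioi.1 hb
    rcases eq_or_ne b i with rfl | hbi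
    · simp [(hab.trans hij).ne, hab.ne]
    · simp [hai, hbi]
  · simp
  · intro a _
    rcases eq_or_ne a i with rfl | h
    · simp [hij.ne]
    · simp [h]

open scoped TensorProduct

/-- The basis vectors of `Clf(q)` over `ℤ`. -/
def stdVec (i : Fin n) : Cliff (extend q ℤ) := ofVec _ (Pi.single i 1)

theorem stdVec_mul_self (i : Fin n) :
    stdVec q i * stdVec q i = algebraMap ℤ _ (-q (Pi.single i 1)) := by
  rw [stdVec, ofVec_mul_self, extend_single]

theorem stdVec_mul_add {i j : Fin n} (h : i < j) :
    stdVec q j * stdVec q i + stdVec q i * stdVec q j =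
      algebraMap ℤ _ (-QuadraticMap.polar q (Pi.single i 1) (Pi.single j 1)) := by
  have := CliffordAlgebra.ι_mul_ι_add_swap (Q := -extend q ℤ) (Pi.single i 1) (Pi.single j 1)
  rw [FunLike.coe_neg, QuadraticMap.polar_neg, polar_extend_single q h] at this
  rw [add_comm]
  exact this

/-- The linear map `Rⁿ → R ⊗ Clf(q)` underlying `toTensor`. -/
def toTensorLin (R : Type) [CommRing R] : (Fin n → R) →ₗ[R] R ⊗[ℤ] Cliff (extend q ℤ) :=
  ∑ i, (LinearMap.toSpanSingleton R _ (1 ⊗ₜ stdVec q i)) ∘ₗ LinearMap.proj i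

theorem toTensorLin_apply (v : Fin n → R) :
    toTensorLin q R v = ∑ i, v i ⊗ₜ[ℤ] stdVec q i := by
  simp [toTensorLin, TensorProduct.smul_tmul']

/-- The defining relation of `Clf(q_R)` in the tensor product: the off-diagonal terms combine in pairs
to the polar form. -/
theorem toTensorLin_mul_self (v : Fin n → R) :
    toTensorLin q R v * toTensorLin q R v = algebraMap R _ ((-extend q R) v) := by
  have h1 : ∀ (r : R) (m : ℤ), r ⊗ₜ[ℤ] algebraMap ℤ (Cliff (extend q ℤ)) m =
      algebraMap R _ ((m : R) * r) := by
    intro r m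
    rw [Algebra.algebraMap_eq_smul_one, TensorProduct.tmul_smul, TensorProduct.smul_tmul',
      Algebra.TensorProduct.algebraMap_apply, zsmul_eq_mul]
    rfl
  rw [toTensorLin_apply, Finset.sum_mul_sum, neg_apply, extend_apply]
  simp only [Algebra.TensorProduct.tmul_mul_tmul]
  have h2 : ∀ i, ∑ j, (v i * v j) ⊗ₜ[ℤ] (stdVec q i * stdVec q j) =
      (v i * v i) ⊗ₜ[ℤ] (stdVec q i * stdVec q i) +
        ∑ j ∈ {i}ᶜ, (v i * v j) ⊗ₜ[ℤ] (stdVec q i * stdVec q j) := fun i =>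
    Fintype.sum_eq_add_sum_compl i _
  simp only [h2, Finset.sum_add_distrib]
  rw [← Finset.sum_sum_Ioi_add_eq_sum_sum_off_diag
    (fun j i => (v i * v j) ⊗ₜ[ℤ] (stdVec q i * stdVec q j)), neg_add, map_add]
  congr 1
  · rw [← Finset.sum_neg_distrib, map_sum]
    refine Finset.sum_congr rfl fun i _ => ?_
    rw [stdVec_mul_self, h1, Int.cast_neg, neg_mul]
  · rw [← Finset.sum_neg_distrib, map_sum]
    refine Finset.sum_congr rfl fun i _ => ?_
    rw [← Finset.sum_neg_distrib, map_sum]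
    refine Finset.sum_congr rfl fun j hj => ?_
    rw [mul_comm (v j), ← TensorProduct.tmul_add, add_comm,
      stdVec_mul_add q (Finset.mem_Ioi.1 hj), h1, Int.cast_neg, neg_mul]

/-- The algebra homomorphism `Clf(q_R) → R ⊗ Clf(q)`. -/
def toTensor (R : Type) [CommRing R] : Cliff (extend q R) →ₐ[R] R ⊗[ℤ] Cliff (extend q ℤ) :=
  CliffordAlgebra.lift (-extend q R) ⟨toTensorLin q R, toTensorLin_mul_self q⟩

/-- The algebra homomorphism `R ⊗ Clf(q) → Clf(q_R)`. -/
def ofTensor (R : Type) [CommRing R] : R ⊗[ℤ] Cliff (extend q ℤ) →ₐ[R] Cliff (extend q R) :=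
  Algebra.TensorProduct.lift (Algebra.ofId R _)
    { cliffMap q (Int.castRingHom R) with
      commutes' := fun m => by
        change cliffMap q (Int.castRingHom R) (algebraMap ℤ _ m) = _
        rw [cliffMap_algebraMap, eq_intCast, map_intCast, eq_intCast] }
    fun r _ => Algebra.commutes r _

theorem ofTensor_tmul (r : R) (x : Cliff (extend q ℤ)) :
    ofTensor q R (r ⊗ₜ x) = r • cliffMap q (Int.castRingHom R) x := by
  rw [Algebra.smul_def]
  exact Algebra.TensorProduct.lift_tmul _ _ _ r x

theorem ofVec_eq_sum (v : Fin n → R) :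
    ofVec (extend q R) v = ∑ i, v i • ofVec _ (Pi.single i 1) := by
  conv_lhs => rw [pi_eq_sum_univ' v, map_sum]
  simp only [map_smul]

theorem toTensor_ofVec (v : Fin n → R) :
    toTensor q R (ofVec _ v) = ∑ i, v i ⊗ₜ[ℤ] stdVec q i := by
  rw [← toTensorLin_apply]
  exact CliffordAlgebra.lift_ι_apply _ _ _

theorem ofTensor_toTensor (x : Cliff (extend q R)) : ofTensor q R (toTensor q R x) = x := by
  induction x using cliff_induction with
  | h1 r => rw [AlgHom.commutes, AlgHom.commutes]
  | hadd x y hx hy => rw [map_add, map_add, hx, hy]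
  | hmul w x hx =>
    rw [map_mul, map_mul, hx, toTensor_ofVec, map_sum]
    conv_rhs => rw [ofVec_eq_sum]
    simp only [ofTensor_tmul, stdVec, cliffMap_single]

theorem toTensor_cliffMap (x : Cliff (extend q ℤ)) :
    toTensor q R (cliffMap q (Int.castRingHom R) x) = 1 ⊗ₜ x := by
  induction x using cliff_induction with
  | h1 r =>
    rw [cliffMap_algebraMap, AlgHom.commutes, Algebra.algebraMap_eq_smul_one (A := Cliff _),
      TensorProduct.tmul_smul, ← Algebra.TensorProduct.one_def]
    simp
  | hadd x y hx hy => rw [map_add, map_add, hx, hy, TensorProduct.tmul_add]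
  | hmul w x hx =>
    rw [map_mul, map_mul, hx, cliffMap_ofVec, toTensor_ofVec]
    have : ∑ i, coordMap n (Int.castRingHom R) w i ⊗ₜ[ℤ] stdVec q i =
        1 ⊗ₜ[ℤ] ofVec (extend q ℤ) w := by
      rw [ofVec_eq_sum, TensorProduct.tmul_sum]
      refine Finset.sum_congr rfl fun i _ => ?_
      rw [TensorProduct.tmul_smul, TensorProduct.smul_tmul']
      simp [coordMap, stdVec]
    rw [this, Algebra.TensorProduct.tmul_mul_tmul, one_mul]

/-- The Clifford algebra of `q_R` is the base change of the integral Clifford algebra. -/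
def tensorEquiv (R : Type) [CommRing R] :
    (R ⊗[ℤ] Cliff (extend q ℤ)) ≃ₗ[R] Cliff (extend q R) where
  __ := (ofTensor q R).toLinearMap
  invFun := toTensor q R
  right_inv := ofTensor_toTensor q
  left_inv := fun x => by
    change toTensor q R (ofTensor q R x) = x
    induction x using TensorProduct.induction_on with
    | zero => simp
    | tmul r x =>
      rw [ofTensor_tmul, map_smul, toTensor_cliffMap, TensorProduct.smul_tmul', smul_eq_mul,
        mul_one]
    | add x y hx hy => rw [map_add, map_add, hx, hy]

/-- The index type of the chosen basis of the integral Clifford algebra. -/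
abbrev BasisIndex : Type := Module.Free.ChooseBasisIndex ℤ (Cliff (extend q ℤ))

/-- A basis of `Clf(q_R)`, compatible with ring homomorphisms. -/
def natBasis (R : Type) [CommRing R] : Module.Basis (BasisIndex q) R (Cliff (extend q R)) :=
  ((Module.Free.chooseBasis ℤ (Cliff (extend q ℤ))).baseChange R).map (tensorEquiv q R)

theorem natBasis_apply (i : BasisIndex q) : natBasis q R i =
    cliffMap q (Int.castRingHom R) (Module.Free.chooseBasis ℤ (Cliff (extend q ℤ)) i) := by
  rw [natBasis, Module.Basis.map_apply, Module.Basis.baseChange_apply]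
  exact (ofTensor_tmul q 1 _).trans (one_smul _ _)

theorem cliffMap_natBasis (f : R →+* S) (i : BasisIndex q) :
    cliffMap q f (natBasis q R i) = natBasis q S i := by
  rw [natBasis_apply, natBasis_apply, ← RingHom.comp_apply, ← cliffMap_comp]
  congr 2
  exact RingHom.ext_int _ _

theorem natBasis_repr_cliffMap (f : R →+* S) (x : Cliff (extend q R)) (i : BasisIndex q) :
    (natBasis q S).repr (cliffMap q f x) i = f ((natBasis q R).repr x i) := by
  have h : cliffMap q f x = ∑ j, f ((natBasis q R).repr x j) • natBasis q S j := by
    conv_lhs => rw [← (natBasis q R).sum_repr x, map_sum]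
    simp only [cliffMap_smul, cliffMap_natBasis]
  rw [h, Module.Basis.repr_sum_self]

theorem cliffMap_eq_zero_iff (f : R →+* S) (x : Cliff (extend q R)) :
    cliffMap q f x = 0 ↔ ∀ i, f ((natBasis q R).repr x i) = 0 := by
  rw [← (natBasis q S).repr.map_eq_zero_iff, Finsupp.ext_iff]
  simp only [natBasis_repr_cliffMap, Finsupp.coe_zero, Pi.zero_apply]

/-- The extension to all `Clf(q_R)` of a linear endomorphism of the integral Clifford algebra. -/
def extendEnd (L : Cliff (extend q ℤ) →ₗ[ℤ] Cliff (extend q ℤ)) (R : Type) [CommRing R] :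
    Cliff (extend q R) →ₗ[R] Cliff (extend q R) :=
  (natBasis q R).constr R fun i => cliffMap q (Int.castRingHom R)
    (L (Module.Free.chooseBasis ℤ (Cliff (extend q ℤ)) i))

variable (L : Cliff (extend q ℤ) →ₗ[ℤ] Cliff (extend q ℤ))

theorem extendEnd_natBasis (i : BasisIndex q) : extendEnd q L R (natBasis q R i) =
    cliffMap q (Int.castRingHom R) (L (Module.Free.chooseBasis ℤ (Cliff (extend q ℤ)) i)) :=
  (natBasis q R).constr_basis R _ i

theorem cliffMap_extendEnd (f : R →+* S) (x : Cliff (extend q R)) :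
    cliffMap q f (extendEnd q L R x) = extendEnd q L S (cliffMap q f x) := by
  conv_lhs => rw [← (natBasis q R).sum_repr x]
  conv_rhs => rw [← (natBasis q R).sum_repr x]
  simp only [map_sum, map_smul, cliffMap_smul, cliffMap_natBasis, extendEnd_natBasis]
  refine Finset.sum_congr rfl fun i _ => ?_
  rw [← RingHom.comp_apply, ← cliffMap_comp]
  congr 3
  exact RingHom.ext_int _ _

theorem extendEnd_cliffMap (x : Cliff (extend q ℤ)) :
    extendEnd q L R (cliffMap q (Int.castRingHom R) x) = cliffMap q (Int.castRingHom R) (L x) := by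
  conv_lhs => rw [← (Module.Free.chooseBasis ℤ (Cliff (extend q ℤ))).sum_repr x]
  conv_rhs => rw [← (Module.Free.chooseBasis ℤ (Cliff (extend q ℤ))).sum_repr x]
  simp only [map_sum, map_smul, cliffMap_smul, ← natBasis_apply, extendEnd_natBasis]

/-- A submodule containing the images of the integral elements contains the range of the extension. -/
theorem extendEnd_mem (N : Submodule R (Cliff (extend q R)))
    (h : ∀ x, cliffMap q (Int.castRingHom R) (L x) ∈ N) (x : Cliff (extend q R)) :
    extendEnd q L R x ∈ N := by
  rw [← (natBasis q R).sum_repr x, map_sum]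
  refine Submodule.sum_mem _ fun i _ => ?_
  rw [map_smul, extendEnd_natBasis]
  exact N.smul_mem _ (h _)

/-- Being a scalar is a linear condition on the coordinates, with integral coefficients. -/
theorem exists_scalar_end : ∃ L : Cliff (extend q ℤ) →ₗ[ℤ] Cliff (extend q ℤ),
    ∀ (R : Type) [CommRing R] (x : Cliff (extend q R)),
      x ∈ scalars (extend q R) ↔ x - extendEnd q L R x = 0 := by
  obtain ⟨l, h1, -⟩ := exists_scalar_proj (extend q ℤ)
  refine ⟨Algebra.linearMap ℤ _ ∘ₗ l, fun R _ x => ?_⟩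
  rw [sub_eq_zero]
  constructor
  · rintro ⟨r, rfl⟩
    have : extendEnd q (Algebra.linearMap ℤ _ ∘ₗ l) R 1 = 1 := by
      have h := extendEnd_cliffMap q (R := R) (Algebra.linearMap ℤ _ ∘ₗ l) 1
      have h2 := h1 1
      rw [map_one] at h2
      simpa [h2] using h
    rw [Algebra.algebraMap_eq_smul_one, map_smul, this]
  · intro h
    rw [h]
    have := extendEnd_mem q (Algebra.linearMap ℤ _ ∘ₗ l) (1 : Submodule R (Cliff (extend q R)))
      (fun y => by
        rw [Submodule.mem_one]
        exact ⟨_, (cliffMap_algebraMap q _ _).symm⟩) x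
    rwa [Submodule.mem_one] at this

/-- Being a Clifford vector is a linear condition on the coordinates, with integral
coefficients. -/
theorem exists_vector_end : ∃ L : Cliff (extend q ℤ) →ₗ[ℤ] Cliff (extend q ℤ),
    ∀ (R : Type) [CommRing R] (x : Cliff (extend q R)),
      x ∈ Vec (extend q R) ↔ x - extendEnd q L R x = 0 := by
  obtain ⟨l, h1, h2⟩ := exists_scalar_proj (extend q ℤ)
  obtain ⟨m, h3, h4⟩ := exists_vector_proj (extend q ℤ)
  let L : Cliff (extend q ℤ) →ₗ[ℤ] Cliff (extend q ℤ) :=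
    Algebra.linearMap ℤ _ ∘ₗ l + ofVec _ ∘ₗ m
  refine ⟨L, fun R _ x => ?_⟩
  rw [sub_eq_zero]
  constructor
  · intro hx
    obtain ⟨r, w, rfl⟩ := mem_Vec_iff.1 hx
    have e1 : extendEnd q L R 1 = 1 := by
      have h := extendEnd_cliffMap q (R := R) L 1
      have h5 := h1 1
      have h6 := h3 1
      rw [map_one] at h5 h6
      simpa [L, h5, h6] using h
    have e2 : ∀ i, extendEnd q L R (ofVec _ (Pi.single i 1)) = ofVec _ (Pi.single i 1) := by
      intro i
      have h := extendEnd_cliffMap q (R := R) L (ofVec _ (Pi.single i 1))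
      simpa [L, h2, h4, cliffMap_single] using h
    rw [ofVec_eq_sum, Algebra.algebraMap_eq_smul_one, map_add, map_sum]
    simp only [map_smul, e1, e2]
  · intro h
    rw [h]
    refine extendEnd_mem q L _ (fun y => cliffMap_mem_Vec q _ ?_) x
    exact mem_Vec_iff.2 ⟨l y, m y, rfl⟩

end IntegralForms

/-! ### Polynomial equations for `SL₂` -/

section PolynomialConditions

variable {n : ℕ} (q : QuadraticForm ℤ (Fin n → ℤ)) {R S : Type} [CommRing R] [CommRing S]

/-- The coordinate ring of the affine space of matrices over `Clf(q)`. -/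
abbrev MatRing : Type := MvPolynomial (Fin 2 × Fin 2 × BasisIndex q) ℤ

/-- The universal matrix, with coordinates the variables. -/
def univMat : Matrix (Fin 2) (Fin 2) (Cliff (extend q (MatRing q))) :=
  Matrix.of fun i j => ∑ b, (MvPolynomial.X (i, j, b) : MatRing q) • natBasis q (MatRing q) b

/-- Evaluation of polynomials at the coordinates of a matrix. -/
def evalMat (A : Matrix (Fin 2) (Fin 2) (Cliff (extend q R))) : MatRing q →+* R :=
  MvPolynomial.eval₂Hom (Int.castRingHom R) fun x => (natBasis q R).repr (A x.1 x.2.1) x.2.2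

theorem univMat_map (f : MatRing q →+* R) (i j : Fin 2) (b : BasisIndex q) :
    (natBasis q R).repr ((univMat q).map (cliffMap q f) i j) b = f (MvPolynomial.X (i, j, b)) := by
  rw [Matrix.map_apply, natBasis_repr_cliffMap, univMat, Matrix.of_apply,
    Module.Basis.repr_sum_self]

theorem univMat_map_evalMat (A : Matrix (Fin 2) (Fin 2) (Cliff (extend q R))) :
    (univMat q).map (cliffMap q (evalMat q A)) = A := by
  ext i j
  apply (natBasis q R).repr.injective
  ext b
  rw [univMat_map, evalMat, MvPolynomial.coe_eval₂Hom, MvPolynomial.eval₂_X]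

theorem evalMat_univMat_map (f : MatRing q →+* R) :
    evalMat q ((univMat q).map (cliffMap q f)) = f := by
  refine MvPolynomial.ringHom_ext (fun m => ?_) (fun x => ?_)
  · simp
  · rw [evalMat, MvPolynomial.coe_eval₂Hom, MvPolynomial.eval₂_X, univMat_map]

theorem map_cliffMap_comp {T : Type} [CommRing T] (g : S →+* T) (f : R →+* S)
    (A : Matrix (Fin 2) (Fin 2) (Cliff (extend q R))) :
    (A.map (cliffMap q f)).map (cliffMap q g) = A.map (cliffMap q (g.comp f)) := by
  rw [cliffMap_comp, Matrix.map_map, RingHom.coe_comp]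

theorem evalMat_map (f : R →+* S) (A : Matrix (Fin 2) (Fin 2) (Cliff (extend q R))) :
    evalMat q (A.map (cliffMap q f)) = f.comp (evalMat q A) := by
  conv_lhs => rw [← univMat_map_evalMat q A, map_cliffMap_comp, evalMat_univMat_map]

variable {q}

/-- A condition on matrices over all `Clf(q_R)` that amounts to polynomial equations with integral
coefficients, namely those in some ideal, for the coordinates. -/
def IsPolyCond (P : ∀ (R : Type) [CommRing R],
    Matrix (Fin 2) (Fin 2) (Cliff (extend q R)) → Prop) : Prop :=
  ∃ I : Ideal (MatRing q), ∀ (R : Type) [CommRing R]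
    (A : Matrix (Fin 2) (Fin 2) (Cliff (extend q R))), P R A ↔ I ≤ RingHom.ker (evalMat q A)

/-- Compatibility with ring homomorphisms of a map assigning an element of `Clf(q_R)` to each
matrix. -/
def IsNatural (F : ∀ (R : Type) [CommRing R],
    Matrix (Fin 2) (Fin 2) (Cliff (extend q R)) → Cliff (extend q R)) : Prop :=
  ∀ (R S : Type) [CommRing R] [CommRing S] (f : R →+* S)
    (A : Matrix (Fin 2) (Fin 2) (Cliff (extend q R))),
    F S (A.map (cliffMap q f)) = cliffMap q f (F R A)

theorem IsPolyCond.and {P P' : ∀ (R : Type) [CommRing R],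
    Matrix (Fin 2) (Fin 2) (Cliff (extend q R)) → Prop} (h : IsPolyCond P) (h' : IsPolyCond P') :
    IsPolyCond fun R _ A => P R A ∧ P' R A := by
  obtain ⟨I, hI⟩ := h
  obtain ⟨J, hJ⟩ := h'
  exact ⟨I ⊔ J, fun R _ A => by beta_reduce; rw [hI, hJ, sup_le_iff]⟩

theorem IsPolyCond.forall {ι : Type} {P : ι → ∀ (R : Type) [CommRing R],
    Matrix (Fin 2) (Fin 2) (Cliff (extend q R)) → Prop} (h : ∀ i, IsPolyCond (P i)) :
    IsPolyCond fun R _ A => ∀ i, P i R A := by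
  choose I hI using h
  exact ⟨⨆ i, I i, fun R _ A => by simp only [hI, iSup_le_iff]⟩

theorem IsPolyCond.congr {P P' : ∀ (R : Type) [CommRing R],
    Matrix (Fin 2) (Fin 2) (Cliff (extend q R)) → Prop} (h : IsPolyCond P)
    (hP : ∀ (R : Type) [CommRing R] (A : Matrix (Fin 2) (Fin 2) (Cliff (extend q R))),
      P' R A ↔ P R A) : IsPolyCond P' := by
  obtain ⟨I, hI⟩ := h
  exact ⟨I, fun R _ A => (hP R A).trans (hI R A)⟩

/-- The vanishing of a natural map is a polynomial condition: the equations are the coordinates of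
its value at the universal matrix. -/
theorem IsNatural.isPolyCond {F : ∀ (R : Type) [CommRing R],
    Matrix (Fin 2) (Fin 2) (Cliff (extend q R)) → Cliff (extend q R)} (hF : IsNatural F) :
    IsPolyCond fun R _ A => F R A = 0 := by
  refine ⟨Ideal.span (Set.range fun b => (natBasis q (MatRing q)).repr (F _ (univMat q)) b),
    fun R _ A => ?_⟩
  have h := hF _ _ (evalMat q A) (univMat q)
  rw [univMat_map_evalMat] at h
  beta_reduce
  rw [h, cliffMap_eq_zero_iff, Ideal.span_le, Set.range_subset_iff]
  exact forall_congr' fun b => RingHom.mem_ker.symm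

theorem IsNatural.isPolyCond_mem_scalars {F : ∀ (R : Type) [CommRing R],
    Matrix (Fin 2) (Fin 2) (Cliff (extend q R)) → Cliff (extend q R)} (hF : IsNatural F) :
    IsPolyCond fun R _ A => F R A ∈ scalars (extend q R) := by
  obtain ⟨L, hL⟩ := exists_scalar_end q
  refine (IsNatural.isPolyCond (F := fun R _ A => F R A - extendEnd q L R (F R A))
    fun R S _ _ f A => ?_).congr fun R _ A => hL R _
  beta_reduce
  rw [hF, map_sub, cliffMap_extendEnd]

theorem IsNatural.isPolyCond_mem_Vec {F : ∀ (R : Type) [CommRing R],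
    Matrix (Fin 2) (Fin 2) (Cliff (extend q R)) → Cliff (extend q R)} (hF : IsNatural F) :
    IsPolyCond fun R _ A => F R A ∈ Vec (extend q R) := by
  obtain ⟨L, hL⟩ := exists_vector_end q
  refine (IsNatural.isPolyCond (F := fun R _ A => F R A - extendEnd q L R (F R A))
    fun R S _ _ f A => ?_).congr fun R _ A => hL R _
  beta_reduce
  rw [hF, map_sub, cliffMap_extendEnd]

/-- The linear map `x ↦ a x b + c x̄ d`. -/
def sandwich {R : Type u} [CommRing R] {W : Type v} [AddCommGroup W] [Module R W]
    {p : QuadraticForm R W} (a b c d : Cliff p) : Cliff p →ₗ[R] Cliff p where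
  toFun x := a * x * b + c * bar x * d
  map_add' x y := by
    simp only [mul_add, add_mul, bar_add]
    abel
  map_smul' r x := by simp

/-- A linear condition on all Clifford vectors needs only be imposed on `1` and the basis vectors. -/
theorem forall_mem_Vec_iff (g : Cliff (extend q R) →ₗ[R] Cliff (extend q R))
    (N : Submodule R (Cliff (extend q R))) : (∀ x ∈ Vec (extend q R), g x ∈ N) ↔
      g 1 ∈ N ∧ ∀ i, g (ofVec _ (Pi.single i 1)) ∈ N := by
  constructor
  · intro h
    exact ⟨h 1 (by simpa using algebraMap_mem_Vec (q := extend q R) 1),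
      fun i => h _ (ofVec_mem_Vec _)⟩
  · rintro ⟨h1, h2⟩ x hx
    obtain ⟨r, w, rfl⟩ := mem_Vec_iff.1 hx
    rw [ofVec_eq_sum, Algebra.algebraMap_eq_smul_one, map_add, map_sum, map_smul]
    refine N.add_mem (N.smul_mem _ h1) (N.sum_mem fun i _ => ?_)
    rw [map_smul]
    exact N.smul_mem _ (h2 i)

theorem isPolyCond_sandwich_scalars {F₁ F₂ F₃ F₄ : ∀ (R : Type) [CommRing R],
    Matrix (Fin 2) (Fin 2) (Cliff (extend q R)) → Cliff (extend q R)} (h₁ : IsNatural F₁)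
    (h₂ : IsNatural F₂) (h₃ : IsNatural F₃) (h₄ : IsNatural F₄) :
    IsPolyCond fun R _ A => ∀ x ∈ Vec (extend q R),
      F₁ R A * x * F₂ R A + F₃ R A * bar x * F₄ R A ∈ scalars (extend q R) := by
  refine IsPolyCond.congr (.and (IsNatural.isPolyCond_mem_scalars
    (F := fun R _ A => sandwich (F₁ R A) (F₂ R A) (F₃ R A) (F₄ R A) 1) fun R S _ _ f A => ?_)
    (.forall fun i : Fin n => IsNatural.isPolyCond_mem_scalars
    (F := fun R _ A => sandwich (F₁ R A) (F₂ R A) (F₃ R A) (F₄ R A) (ofVec _ (Pi.single i 1)))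
    fun R S _ _ f A => ?_)) fun R _ A => by
      have := forall_mem_Vec_iff (sandwich (F₁ R A) (F₂ R A) (F₃ R A) (F₄ R A)) 1
      simp only [Submodule.mem_one] at this
      exact this
  · simp [sandwich, h₁ R S f A, h₂ R S f A, h₃ R S f A, h₄ R S f A]
  · simp [sandwich, h₁ R S f A, h₂ R S f A, h₃ R S f A, h₄ R S f A, cliffMap_single]

theorem isPolyCond_sandwich_Vec {F₁ F₂ F₃ F₄ : ∀ (R : Type) [CommRing R],
    Matrix (Fin 2) (Fin 2) (Cliff (extend q R)) → Cliff (extend q R)} (h₁ : IsNatural F₁)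
    (h₂ : IsNatural F₂) (h₃ : IsNatural F₃) (h₄ : IsNatural F₄) :
    IsPolyCond fun R _ A => ∀ x ∈ Vec (extend q R),
      F₁ R A * x * F₂ R A + F₃ R A * bar x * F₄ R A ∈ Vec (extend q R) := by
  refine IsPolyCond.congr (.and (IsNatural.isPolyCond_mem_Vec
    (F := fun R _ A => sandwich (F₁ R A) (F₂ R A) (F₃ R A) (F₄ R A) 1) fun R S _ _ f A => ?_)
    (.forall fun i : Fin n => IsNatural.isPolyCond_mem_Vec
    (F := fun R _ A => sandwich (F₁ R A) (F₂ R A) (F₃ R A) (F₄ R A) (ofVec _ (Pi.single i 1)))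
    fun R S _ _ f A => ?_)) fun R _ A =>
      forall_mem_Vec_iff (sandwich (F₁ R A) (F₂ R A) (F₃ R A) (F₄ R A)) (Vec (extend q R))
  · simp [sandwich, h₁ R S f A, h₂ R S f A, h₃ R S f A, h₄ R S f A]
  · simp [sandwich, h₁ R S f A, h₂ R S f A, h₃ R S f A, h₄ R S f A, cliffMap_single]

/-- Membership in `SL₂` as a conjunction of equations and of memberships of natural expressions. -/
theorem mem_SL2_iff_entries {R : Type u} [CommRing R] {W : Type v} [AddCommGroup W] [Module R W]
    {p : QuadraticForm R W} (A : Matrix (Fin 2) (Fin 2) (Cliff p)) : A ∈ SL2 p ↔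
    A 0 0 * tr (A 1 1) - A 0 1 * tr (A 1 0) - 1 = 0 ∧
    (A 0 0 * tr (A 0 1) - A 0 1 * tr (A 0 0) = 0 ∧ A 1 0 * tr (A 1 1) - A 1 1 * tr (A 1 0) = 0) ∧
    (A 0 0 * bar (A 0 0) ∈ scalars p ∧ A 0 1 * bar (A 0 1) ∈ scalars p ∧
      A 1 0 * bar (A 1 0) ∈ scalars p ∧ A 1 1 * bar (A 1 1) ∈ scalars p) ∧
    (A 0 0 * bar (A 1 0) ∈ Vec p ∧ A 0 1 * bar (A 1 1) ∈ Vec p) ∧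
    ((∀ x ∈ Vec p, A 0 0 * x * bar (A 0 1) + A 0 1 * bar x * bar (A 0 0) ∈ scalars p) ∧
      ∀ x ∈ Vec p, A 1 0 * x * bar (A 1 1) + A 1 1 * bar x * bar (A 1 0) ∈ scalars p) ∧
    (∀ x ∈ Vec p, A 0 0 * x * bar (A 1 1) + A 0 1 * bar x * bar (A 1 0) ∈ Vec p) := by
  simp only [sub_eq_zero]
  constructor
  · rintro ⟨⟨a, b, c, d, rfl, -, h2, h3, h4, h5, h6⟩, h1⟩
    exact ⟨h1, h2, h3, h4, ⟨fun x hx => (h5 x hx).1, fun x hx => (h5 x hx).2⟩, h6⟩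
  · rintro ⟨h1, h2, h3, h4, ⟨h5, h6⟩, h7⟩
    exact ⟨⟨_, _, _, _, A.eta_fin_two, ⟨1, by simp [h1]⟩, h2, h3, h4,
      fun x hx => ⟨h5 x hx, h6 x hx⟩, h7⟩, h1⟩

variable (q) in
/-- Membership in `SL₂(Clf(q_R))` is a polynomial condition. -/
theorem isPolyCond_SL2 : IsPolyCond (q := q) fun R _ A => A ∈ SL2 (extend q R) := by
  have e : ∀ i j, IsNatural (q := q) fun R _ A => A i j := fun i j R S _ _ f A => rfl
  have eb : ∀ i j, IsNatural (q := q) fun R _ A => bar (A i j) := fun i j R S _ _ f A =>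
    (cliffMap_bar q f _).symm
  have et : ∀ i j, IsNatural (q := q) fun R _ A => tr (A i j) := fun i j R S _ _ f A =>
    (cliffMap_tr q f _).symm
  have hm : ∀ {F G : ∀ (R : Type) [CommRing R],
      Matrix (Fin 2) (Fin 2) (Cliff (extend q R)) → Cliff (extend q R)}, IsNatural F →
      IsNatural G → IsNatural fun R _ A => F R A * G R A := fun hF hG R S _ _ f A => by
    beta_reduce
    rw [hF, hG, map_mul]
  have hs : ∀ {F G : ∀ (R : Type) [CommRing R],
      Matrix (Fin 2) (Fin 2) (Cliff (extend q R)) → Cliff (extend q R)}, IsNatural F →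
      IsNatural G → IsNatural fun R _ A => F R A - G R A := fun hF hG R S _ _ f A => by
    beta_reduce
    rw [hF, hG, map_sub]
  have h1 : IsNatural (q := q) fun R _ A => 1 := fun R S _ _ f A => (map_one _).symm
  refine IsPolyCond.congr ?_ fun R _ A => mem_SL2_iff_entries A
  refine .and (hs (hs (hm (e 0 0) (et 1 1)) (hm (e 0 1) (et 1 0))) h1).isPolyCond <|
    .and (.and (hs (hm (e 0 0) (et 0 1)) (hm (e 0 1) (et 0 0))).isPolyCond
      (hs (hm (e 1 0) (et 1 1)) (hm (e 1 1) (et 1 0))).isPolyCond) <|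
    .and (.and (hm (e 0 0) (eb 0 0)).isPolyCond_mem_scalars <|
      .and (hm (e 0 1) (eb 0 1)).isPolyCond_mem_scalars <|
      .and (hm (e 1 0) (eb 1 0)).isPolyCond_mem_scalars
        (hm (e 1 1) (eb 1 1)).isPolyCond_mem_scalars) <|
    .and (.and (hm (e 0 0) (eb 1 0)).isPolyCond_mem_Vec (hm (e 0 1) (eb 1 1)).isPolyCond_mem_Vec) <|
    .and (.and (isPolyCond_sandwich_scalars (e 0 0) (eb 0 1) (e 0 1) (eb 0 0))
      (isPolyCond_sandwich_scalars (e 1 0) (eb 1 1) (e 1 1) (eb 1 0)))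
    (isPolyCond_sandwich_Vec (e 0 0) (eb 1 1) (e 0 1) (eb 1 0))

end PolynomialConditions

/-! ### The functor `SL₂` and its coordinate ring -/

section Functor

open CategoryTheory

variable {n : ℕ} (q : QuadraticForm ℤ (Fin n → ℤ)) {R S : Type} [CommRing R] [CommRing S]

/-- The group `SL₂(Clf(q))`, as a subgroup of the unit group of the matrix algebra. -/
def sl2Subgroup {R : Type u} [CommRing R] {W : Type v} [AddCommGroup W] [Module R W]
    [Module.Free R W] [Module.Finite R W] (p : QuadraticForm R W) :
    Subgroup (Matrix (Fin 2) (Fin 2) (Cliff p))ˣ :=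
  (spinSubgroup (bottForm 1 p)).comap (bottUnits (sqExtAddSq (addHyp 1 p)))

theorem val_image_sl2Subgroup {R : Type u} [CommRing R] {W : Type v} [AddCommGroup W] [Module R W]
    [Module.Free R W] [Module.Finite R W] (p : QuadraticForm R W) :
    Units.val '' (sl2Subgroup p : Set (Matrix (Fin 2) (Fin 2) (Cliff p))ˣ) = SL2 p :=
  val_image_comap _ _ _ _ (mem_SL2_iff _) (fun _ hx => hx.1) val_image_spinSubgroup

theorem mem_sl2Subgroup {R : Type u} [CommRing R] {W : Type v} [AddCommGroup W] [Module R W]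
    [Module.Free R W] [Module.Finite R W] {p : QuadraticForm R W}
    {A : (Matrix (Fin 2) (Fin 2) (Cliff p))ˣ} :
    A ∈ sl2Subgroup p ↔ (A : Matrix (Fin 2) (Fin 2) (Cliff p)) ∈ SL2 p :=
  (mem_SL2_iff (sqExtAddSq (addHyp 1 p)) _).symm

/-- Membership in `SL₂` is stable under change of rings, being given by polynomial equations. -/
theorem map_mem_SL2 (f : R →+* S) {A : Matrix (Fin 2) (Fin 2) (Cliff (extend q R))}
    (hA : A ∈ SL2 (extend q R)) : A.map (cliffMap q f) ∈ SL2 (extend q S) := by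
  obtain ⟨I, hI⟩ := isPolyCond_SL2 q
  beta_reduce at hI
  rw [hI] at hA ⊢
  rw [evalMat_map]
  exact fun x hx => by rw [RingHom.mem_ker, RingHom.comp_apply, RingHom.mem_ker.1 (hA hx), map_zero]

/-- The homomorphism `SL₂(Clf(q_R)) → SL₂(Clf(q_S))` induced by a ring homomorphism. -/
def sl2Map (f : R →+* S) : sl2Subgroup (extend q R) →* sl2Subgroup (extend q S) :=
  ((Units.map (RingHom.mapMatrix (m := Fin 2) (cliffMap q f)).toMonoidHom).comp
    (sl2Subgroup (extend q R)).subtype).codRestrict _ fun A =>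
      mem_sl2Subgroup.2 (map_mem_SL2 q f (mem_sl2Subgroup.1 A.2))

/-- The matrix underlying an element of `SL₂`. -/
def sl2Val {R : Type u} [CommRing R] {W : Type v} [AddCommGroup W] [Module R W]
    [Module.Free R W] [Module.Finite R W] (p : QuadraticForm R W) :
    sl2Subgroup p →* Matrix (Fin 2) (Fin 2) (Cliff p) :=
  (Units.coeHom _).comp (sl2Subgroup p).subtype

theorem sl2Val_injective {R : Type u} [CommRing R] {W : Type v} [AddCommGroup W] [Module R W]
    [Module.Free R W] [Module.Finite R W] (p : QuadraticForm R W) :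
    Function.Injective (sl2Val p) := fun _ _ h => Subtype.ext (Units.ext h)

theorem range_sl2Val {R : Type u} [CommRing R] {W : Type v} [AddCommGroup W] [Module R W]
    [Module.Free R W] [Module.Finite R W] (p : QuadraticForm R W) :
    Set.range (sl2Val p) = SL2 p := by
  rw [← val_image_sl2Subgroup, Set.image_eq_range]
  rfl

theorem sl2Val_sl2Map (f : R →+* S) (A : sl2Subgroup (extend q R)) :
    sl2Val _ (sl2Map q f A) = (sl2Val _ A).map (cliffMap q f) := rfl

theorem sl2Map_comp {T : Type} [CommRing T] (f : R →+* S) (g : S →+* T)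
    (A : sl2Subgroup (extend q R)) : sl2Map q (g.comp f) A = sl2Map q g (sl2Map q f A) := by
  apply sl2Val_injective
  rw [sl2Val_sl2Map, sl2Val_sl2Map, sl2Val_sl2Map, map_cliffMap_comp]

theorem sl2Map_id (A : sl2Subgroup (extend q R)) : sl2Map q (RingHom.id R) A = A := by
  apply sl2Val_injective
  rw [sl2Val_sl2Map, cliffMap_id]
  exact Matrix.map_id _

/-- The functor `R ↦ SL₂(Clf(q_R))`. -/
def sl2Functor : CommRingCat.{0} ⥤ GrpCat.{0} where
  obj R := GrpCat.of (sl2Subgroup (extend q R))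
  map f := GrpCat.ofHom (sl2Map q f.hom)
  map_id _ := GrpCat.hom_ext (MonoidHom.ext (sl2Map_id q))
  map_comp f g := GrpCat.hom_ext (MonoidHom.ext (sl2Map_comp q f.hom g.hom))

/-- The equations of `SL₂(Clf_q)`. -/
def sl2Ideal : Ideal (MatRing q) := (isPolyCond_SL2 q).choose

theorem mem_SL2_iff_sl2Ideal (A : Matrix (Fin 2) (Fin 2) (Cliff (extend q R))) :
    A ∈ SL2 (extend q R) ↔ sl2Ideal q ≤ RingHom.ker (evalMat q A) :=
  (isPolyCond_SL2 q).choose_spec R A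

/-- The coordinate ring of `SL₂(Clf_q)`. -/
def sl2Ring : CommRingCat.{0} := CommRingCat.of (MatRing q ⧸ sl2Ideal q)

/-- The universal element of `SL₂(Clf_q)`. -/
theorem univMat_mem_SL2 : (univMat q).map (cliffMap q (Ideal.Quotient.mk (sl2Ideal q))) ∈
    SL2 (extend q (MatRing q ⧸ sl2Ideal q)) := by
  rw [mem_SL2_iff_sl2Ideal, evalMat_univMat_map, Ideal.mk_ker]

theorem exists_univSL2 : ∃ A : sl2Subgroup (extend q (MatRing q ⧸ sl2Ideal q)),
    sl2Val _ A = (univMat q).map (cliffMap q (Ideal.Quotient.mk (sl2Ideal q))) := by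
  have := univMat_mem_SL2 q
  rw [← range_sl2Val] at this
  exact this

/-- The coordinate ring represents the functor `SL₂(Clf_q)` on rings. -/
theorem bijective_sl2Map_univ (A : sl2Subgroup (extend q (MatRing q ⧸ sl2Ideal q)))
    (hA : sl2Val _ A = (univMat q).map (cliffMap q (Ideal.Quotient.mk (sl2Ideal q))))
    (R : Type) [CommRing R] :
    Function.Bijective fun f : (MatRing q ⧸ sl2Ideal q) →+* R => sl2Map q f A := by
  have h : ∀ f : (MatRing q ⧸ sl2Ideal q) →+* R, sl2Val _ (sl2Map q f A) =
      (univMat q).map (cliffMap q (f.comp (Ideal.Quotient.mk (sl2Ideal q)))) := fun f => by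
    rw [sl2Val_sl2Map, hA, map_cliffMap_comp]
  constructor
  · intro f g hfg
    have h1 := congrArg (fun B => evalMat q (sl2Val _ B)) hfg
    beta_reduce at h1
    rw [h, h, evalMat_univMat_map, evalMat_univMat_map] at h1
    exact Ideal.Quotient.ringHom_ext h1
  · intro B
    have hB : sl2Val _ B ∈ SL2 (extend q R) := by
      rw [← range_sl2Val]
      exact ⟨B, rfl⟩
    refine ⟨Ideal.Quotient.lift _ (evalMat q (sl2Val _ B)) fun x hx =>
      RingHom.mem_ker.1 ((mem_SL2_iff_sl2Ideal q _).1 hB hx), sl2Val_injective _ ?_⟩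
    rw [h, Ideal.Quotient.lift_comp_mk, univMat_map_evalMat]

end Functor

/-! ### The scheme representing `SL₂` -/

section Representability

open CategoryTheory AlgebraicGeometry Opposite

/-- Morphisms to an affine scheme are ring homomorphisms to the global sections. -/
def homSpec (X : Scheme.{0}) (B : CommRingCat.{0}) : (X ⟶ Spec B) ≃ (B ⟶ Γ(X, ⊤)) where
  toFun g := (Scheme.ΓSpecIso B).inv ≫ g.appTop
  invFun φ := ΓSpec.adjunction.homEquiv X (op B) φ.op
  left_inv g := by
    obtain ⟨φ, rfl⟩ := (ΓSpec.adjunction.homEquiv X (op B)).surjective g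
    have := ΓSpecIso_inv_ΓSpec_adjunction_homEquiv φ.unop
    exact congrArg (fun χ : B ⟶ Γ(X, ⊤) => ΓSpec.adjunction.homEquiv X (op B) χ.op) this
  right_inv φ := ΓSpecIso_inv_ΓSpec_adjunction_homEquiv φ

theorem homSpec_comp {X Y : Scheme.{0}} {B : CommRingCat.{0}} (f : X ⟶ Y) (g : Y ⟶ Spec B) :
    homSpec X B (f ≫ g) = homSpec Y B g ≫ f.appTop := by
  simp [homSpec]

/-- Morphisms over `Spec ℤ` to `Spec B` are ring homomorphisms from `B` to the global sections. -/
def homSpecOver (T : Over (Spec (CommRingCat.of ℤ))) (B : CommRingCat.{0}) :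
    (T ⟶ specOver B) ≃ (B →+* Γ(T.left, ⊤)) where
  toFun g := (homSpec T.left B g.left).hom
  invFun φ := Over.homMk ((homSpec T.left B).symm (CommRingCat.ofHom φ))
    (specZIsTerminal.hom_ext _ _)
  left_inv g := Over.OverMorphism.ext ((homSpec T.left B).symm_apply_apply g.left)
  right_inv φ := congrArg CommRingCat.Hom.hom
    ((homSpec T.left B).apply_symm_apply (CommRingCat.ofHom φ))

theorem homSpecOver_comp {T T' : Over (Spec (CommRingCat.of ℤ))} {B : CommRingCat.{0}}
    (f : T ⟶ T') (g : T' ⟶ specOver B) :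
    homSpecOver T B (f ≫ g) = f.left.appTop.hom.comp (homSpecOver T' B g) :=
  congrArg CommRingCat.Hom.hom (homSpec_comp f.left g.left)

variable {n : ℕ} (q : QuadraticForm ℤ (Fin n → ℤ))

/-- The functor `T ↦ SL₂(Clf(q_Γ(T)))` on schemes over `Spec ℤ`. -/
def sl2SchemeFunctor : (Over (Spec (CommRingCat.of ℤ)))ᵒᵖ ⥤ GrpCat.{0} :=
  (Over.forget _).op ⋙ Scheme.Γ ⋙ sl2Functor q

/-- The scheme `SL₂(Clf_q)` over `Spec ℤ`. -/
def sl2Scheme : Over (Spec (CommRingCat.of ℤ)) := specOver (sl2Ring q)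

/-- The scheme `SL₂(Clf_q)` represents the functor of `SL₂` of global sections. -/
def sl2RepresentableBy :
    (sl2SchemeFunctor q ⋙ forget GrpCat).RepresentableBy (sl2Scheme q) where
  homEquiv {T} := (homSpecOver T (sl2Ring q)).trans
    (Equiv.ofBijective _ (bijective_sl2Map_univ q _ (exists_univSL2 q).choose_spec Γ(T.left, ⊤)))
  homEquiv_comp f g := (congrArg (fun φ => sl2Map q φ (exists_univSL2 q).choose)
    (homSpecOver_comp f g)).trans
      (sl2Map_comp q _ _ _)

end Representability

/-! ### Naturality of `ψ` -/

section Psi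

/-- The composite of the two Bott periodicity maps, as an algebra homomorphism. -/
def psiHom (ε : ℤˣ) {R : Type u} [CommRing R] {W : Type v} [AddCommGroup W] [Module R W]
    (p : QuadraticForm R W) : Matrix (Fin 2) (Fin 2) (Cliff p) →ₐ[R] Cliff (bottForm ε p) :=
  (sqExtAddSq (addHyp ε p)).evenHom.comp (iotaEquiv ε p).toAlgHom

theorem psiHom_apply (ε : ℤˣ) {R : Type u} [CommRing R] {W : Type v} [AddCommGroup W] [Module R W]
    (p : QuadraticForm R W) (A : Matrix (Fin 2) (Fin 2) (Cliff p)) :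
    psiHom ε p A = psi ε p A := evenHom_sqExtAddSq _ _

theorem psiHom_injective (ε : ℤˣ) {R : Type u} [CommRing R] {W : Type v} [AddCommGroup W]
    [Module R W] (p : QuadraticForm R W) : Function.Injective (psiHom ε p) :=
  (sqExtAddSq (addHyp ε p)).evenHom_injective.comp (iotaEquiv ε p).injective

theorem psiHom_image_SL2 (ε : ℤˣ) {R : Type u} [CommRing R] {W : Type v} [AddCommGroup W]
    [Module R W] [Module.Free R W] [Module.Finite R W] (p : QuadraticForm R W) :
    psiHom ε p '' SL2 p = spin (bottForm ε p) := by
  ext X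
  constructor
  · rintro ⟨A, hA, rfl⟩
    exact (mem_SL2_iff (sqExtAddSq (addHyp ε p)) A).1 hA
  · intro hX
    obtain ⟨x, rfl⟩ := (sqExtAddSq (addHyp ε p)).exists_evenHom_eq hX.1
    obtain ⟨A, rfl⟩ := (iotaEquiv ε p).surjective x
    exact ⟨A, (mem_SL2_iff (sqExtAddSq (addHyp ε p)) A).2 hX, rfl⟩

variable {n : ℕ} (ε : ℤˣ) (q : QuadraticForm ℤ (Fin n → ℤ)) {R S : Type} [CommRing R] [CommRing S]
  (f : R →+* S)

theorem cliffMapBott_evenHom_ofVec (m : (Fin n → R) × (R × R)) :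
    cliffMapBott ε q f ((sqExtAddSq (addHyp ε (extend q R))).evenHom (ofVec _ m)) =
      (sqExtAddSq (addHyp ε (extend q S))).evenHom
        (ofVec _ (coordMap n f m.1, (f m.2.1, f m.2.2))) := by
  have h : ∀ v, cliffMapBott ε q f (ofVec _ v) = ofVec _ (coordMapBott n f v) :=
    semiMap_ofVec _ _ _ _ _
  rw [SqExt.evenHom_ofVec, SqExt.evenHom_ofVec, map_mul]
  congr 1
  · refine (h (m, 0)).trans (congrArg _ ?_)
    change ((coordMap n f m.1, (f m.2.1, f m.2.2)), f 0) = ((_, (_, _)), (0 : S))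
    rw [map_zero]
  · refine (h (0, 1)).trans (congrArg _ ?_)
    change ((coordMap n f 0, (f 0, f 0)), f 1) = ((0, (0, 0)), (1 : S))
    rw [map_zero, map_zero, map_one]

theorem cliffMapBott_evenHom_inclHyp (x : Cliff (extend q R)) :
    cliffMapBott ε q f ((sqExtAddSq (addHyp ε (extend q R))).evenHom (inclHyp ε _ x)) =
      (sqExtAddSq (addHyp ε (extend q S))).evenHom (inclHyp ε _ (cliffMap q f x)) := by
  have h : ((cliffMapBott ε q f).comp ((sqExtAddSq (addHyp ε (extend q R))).evenHom.comp
      (inclHyp ε (extend q R))).toRingHom) =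
      ((sqExtAddSq (addHyp ε (extend q S))).evenHom.comp
        (inclHyp ε (extend q S))).toRingHom.comp (cliffMap q f) := by
    refine cliff_ringHom_ext (fun r => ?_) fun w => ?_
    · change cliffMapBott ε q f ((sqExtAddSq (addHyp ε (extend q R))).evenHom (inclHyp ε _
        (algebraMap R _ r))) = (sqExtAddSq (addHyp ε (extend q S))).evenHom (inclHyp ε _
          (cliffMap q f (algebraMap R _ r)))
      rw [cliffMap_algebraMap, AlgHom.commutes, AlgHom.commutes, AlgHom.commutes, AlgHom.commutes]
      exact semiMap_algebraMap _ _ _ _ _ r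
    · change cliffMapBott ε q f ((sqExtAddSq (addHyp ε (extend q R))).evenHom (inclHyp ε _
        (ofVec _ w))) = (sqExtAddSq (addHyp ε (extend q S))).evenHom (inclHyp ε _
          (cliffMap q f (ofVec _ w)))
      rw [cliffMap_ofVec, inclHyp_ofVec, inclHyp_ofVec, cliffMapBott_evenHom_ofVec]
      simp only [Prod.fst_zero, Prod.snd_zero, map_zero]
      rfl
  exact RingHom.congr_fun h x

/-- The isomorphism `ψ` is compatible with base change. -/
theorem cliffMapBott_psiHom (A : Matrix (Fin 2) (Fin 2) (Cliff (extend q R))) :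
    cliffMapBott ε q f (psiHom ε _ A) = psiHom ε _ (A.map (cliffMap q f)) := by
  have hF : cliffMapBott ε q f ((sqExtAddSq (addHyp ε (extend q R))).evenHom (genF ε _)) =
      (sqExtAddSq (addHyp ε (extend q S))).evenHom (genF ε _) := by
    rw [genF, cliffMapBott_evenHom_ofVec]
    simp [genF]
  have hG : cliffMapBott ε q f ((sqExtAddSq (addHyp ε (extend q R))).evenHom (genG ε _)) =
      (sqExtAddSq (addHyp ε (extend q S))).evenHom (genG ε _) := by
    have hs : ∀ (r : R) x, cliffMapBott ε q f (r • x) = f r • cliffMapBott ε q f x :=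
      semiMap_smul _ _ _ _ _
    rw [genG, map_smul, hs, cliffMapBott_evenHom_ofVec, genG, map_smul]
    simp
  change cliffMapBott ε q f ((sqExtAddSq (addHyp ε (extend q R))).evenHom (iotaEquiv ε _ A)) =
    (sqExtAddSq (addHyp ε (extend q S))).evenHom (iotaEquiv ε _ (A.map (cliffMap q f)))
  simp only [iotaEquiv_apply, bottTwo, map_add, map_mul, hF, hG, cliffMapBott_evenHom_inclHyp,
    cliffMap_par, Matrix.map_apply]

end Psi

/-! ### The group schemes -/

section GroupSchemes

open CategoryTheory AlgebraicGeometry Opposite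
open scoped MonObj

variable {n : ℕ} (q : QuadraticForm ℤ (Fin n → ℤ))

/-- The group scheme `SL₂(Clf_q)` over `Spec ℤ`. -/
def sl2GroupScheme : Grp (Over (Spec (CommRingCat.of ℤ))) :=
  letI := GrpObj.ofRepresentableBy (sl2Scheme q) (sl2SchemeFunctor q) (sl2RepresentableBy q)
  ⟨sl2Scheme q⟩

/-- The points of `SL₂(Clf_q)` over `T` are the elements of `SL₂` over the global sections of
`T`. -/
def sl2PointsGlobal (T : Over (Spec (CommRingCat.of ℤ))) :
    (T ⟶ (sl2GroupScheme q).X) ≃* sl2Subgroup (extend q Γ(T.left, ⊤)) where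
  toEquiv := (sl2RepresentableBy q).homEquiv
  map_mul' := by
    let := GrpObj.ofRepresentableBy (sl2Scheme q) (sl2SchemeFunctor q) (sl2RepresentableBy q)
    exact ((yonedaGrpObjIsoOfRepresentableBy (sl2Scheme q) (sl2SchemeFunctor q)
      (sl2RepresentableBy q)).hom.app (op T)).hom.map_mul

theorem sl2PointsGlobal_comp {T T' : Over (Spec (CommRingCat.of ℤ))} (f : T ⟶ T')
    (x : T' ⟶ (sl2GroupScheme q).X) :
    sl2PointsGlobal q T (f ≫ x) = sl2Map q f.left.appTop.hom (sl2PointsGlobal q T' x) :=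
  (sl2RepresentableBy q).homEquiv_comp f x

theorem sl2Map_bijective {R S : CommRingCat.{0}} (e : R ≅ S) :
    Function.Bijective (sl2Map q e.hom.hom) := by
  refine Function.bijective_iff_has_inverse.2 ⟨sl2Map q e.inv.hom, fun A => ?_, fun A => ?_⟩
  · rw [← sl2Map_comp, ← CommRingCat.hom_comp, e.hom_inv_id]
    exact sl2Map_id q A
  · rw [← sl2Map_comp, ← CommRingCat.hom_comp, e.inv_hom_id]
    exact sl2Map_id q A

/-- The global sections of `Spec R`, regarded as a scheme over `Spec ℤ`. -/
def sectionsIso (R : CommRingCat.{0}) : Γ((specOver R).left, ⊤) ≅ R := Scheme.ΓSpecIso R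

theorem sectionsIso_naturality {R S : CommRingCat.{0}} (f : R ⟶ S) :
    (specOverMap f).left.appTop ≫ (sectionsIso S).hom = (sectionsIso R).hom ≫ f :=
  Scheme.ΓSpecIso_naturality f

/-- The `R`-points of `SL₂(Clf_q)`. -/
def sl2Points (R : CommRingCat.{0}) :
    (specOver R ⟶ (sl2GroupScheme q).X) →* sl2Subgroup (extend q R) :=
  (sl2Map q (sectionsIso R).hom.hom).comp (sl2PointsGlobal q (specOver R)).toMonoidHom

theorem sl2Points_bijective (R : CommRingCat.{0}) : Function.Bijective (sl2Points q R) :=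
  (sl2Map_bijective q (sectionsIso R)).comp (sl2PointsGlobal q (specOver R)).bijective

theorem sl2Points_comp {R S : CommRingCat.{0}} (f : R ⟶ S)
    (x : specOver R ⟶ (sl2GroupScheme q).X) :
    sl2Points q S (specOverMap f ≫ x) = sl2Map q f.hom (sl2Points q R x) := by
  let y := sl2PointsGlobal q (specOver R) x
  have h : sl2PointsGlobal q (specOver S) (specOverMap f ≫ x) =
      sl2Map q (specOverMap f).left.appTop.hom y := sl2PointsGlobal_comp q (specOverMap f) x
  calc sl2Points q S (specOverMap f ≫ x)
      = sl2Map q (sectionsIso S).hom.hom (sl2Map q (specOverMap f).left.appTop.hom y) :=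
        congrArg (sl2Map q (sectionsIso S).hom.hom) h
    _ = sl2Map q ((specOverMap f).left.appTop ≫ (sectionsIso S).hom).hom y :=
        (sl2Map_comp q _ _ y).symm
    _ = sl2Map q ((sectionsIso R).hom ≫ f).hom y :=
        congrArg (fun φ : Γ((specOver R).left, ⊤) ⟶ S => sl2Map q φ.hom y)
          (sectionsIso_naturality f)
    _ = sl2Map q f.hom (sl2Points q R x) := sl2Map_comp q _ _ y

/-- The group scheme representing `SL₂` is `SL₂(Clf_q)`. -/
def isSL2Scheme : IsSL2Scheme q (sl2GroupScheme q) where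
  points R := (sl2Val _).comp (sl2Points q R)
  injective R := (sl2Val_injective _).comp (sl2Points_bijective q R).1
  range_eq R := by
    rw [MonoidHom.coe_comp, (sl2Points_bijective q R).2.range_comp, range_sl2Val]
  natural f x := (congrArg _ (sl2Points_comp q f x)).trans (sl2Val_sl2Map q _ _)

/-- As `ψ` is natural in the ring, the group scheme `SL₂(Clf_q)` is also `Spin_Q`. -/
def isSpinScheme (ε : ℤˣ) : IsSpinScheme ε q (sl2GroupScheme q) where
  points R := (psiHom ε (extend q R) : _ →* _).comp ((isSL2Scheme q).points R)
  injective R := (psiHom_injective ε _).comp ((isSL2Scheme q).injective R)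
  range_eq R := by
    rw [MonoidHom.coe_comp, Set.range_comp, (isSL2Scheme q).range_eq]
    exact psiHom_image_SL2 ε _
  natural f x := by
    change psiHom ε _ ((isSL2Scheme q).points _ _) = _
    rw [(isSL2Scheme q).natural]
    exact (cliffMapBott_psiHom ε q f.hom _).symm

/-- The scheme representing `SL₂(Clf_q)` represents `Spin_Q` as well, with points read off through
`ψ`; the isomorphism of group schemes is then the identity. -/
theorem exists_groupScheme_iso (n : ℕ) (q : QuadraticForm ℤ (Fin n → ℤ)) (ε : ℤˣ) :
    ∃ (G H : Grp (Over (Spec (CommRingCat.of ℤ))))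
      (hG : IsSL2Scheme q G) (hH : IsSpinScheme ε q H) (Θ : G ≅ H),
      IsAffine G.X.left ∧ IsAffine H.X.left ∧
      ∀ (R : CommRingCat.{0}) (x : specOver R ⟶ G.X),
        hH.points R (x ≫ Θ.hom.hom.hom) = psi ε (extend q R) (hG.points R x) := by
  have h : IsAffine (sl2GroupScheme q).X.left := isAffine_Spec (sl2Ring q)
  refine ⟨sl2GroupScheme q, sl2GroupScheme q, isSL2Scheme q, isSpinScheme q ε, Iso.refl _, h, h,
    fun R x => ?_⟩
  rw [← psiHom_apply]
  refine congrArg ((isSpinScheme q ε).points R) ?_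
  exact Category.comp_id x

end GroupSchemes

end Clf

end

theorem mainTheorem2 :
    -- the isomorphism over an arbitrary commutative ring
    (∀ (R : Type*) [CommRing R] (W : Type*) [AddCommGroup W] [Module R W]
      [Module.Free R W] [Module.Finite R W] (q : QuadraticForm R W) (ε : ℤˣ),
      ∃ (iota : Matrix (Fin 2) (Fin 2) (Clf.Cliff q) ≃ₐ[R] Clf.Cliff (Clf.addHyp ε q))
        (phi : Clf.Cliff (Clf.addHyp ε q) ≃ₐ[R] Clf.evenSubalgebra (Clf.bottForm ε q)),
        (∀ A, iota A = Clf.bottTwo ε q A) ∧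
        (∀ x, (phi x : Clf.Cliff (Clf.bottForm ε q)) = Clf.bottOne (Clf.addHyp ε q) x) ∧
        -- the relations between the generators
        (Clf.genE (Clf.addHyp ε q) * Clf.genE (Clf.addHyp ε q) = -1 ∧
          Clf.genF ε q * Clf.genF ε q = 0 ∧ Clf.genG ε q * Clf.genG ε q = 0 ∧
          Clf.genF ε q * Clf.genG ε q = 1 - Clf.genG ε q * Clf.genF ε q) ∧
        -- the explicit formula for the composite
        (∀ a b c d : Clf.Cliff q,
          let j := Clf.inclBott ε q
          let e := Clf.genE (Clf.addHyp ε q)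
          let f := Clf.inclSq (Clf.addHyp ε q) (Clf.genF ε q)
          let g := Clf.inclSq (Clf.addHyp ε q) (Clf.genG ε q)
          (phi (iota !![a, b; c, d]) : Clf.Cliff (Clf.bottForm ε q)) =
            (j (Clf.evenPart a) * (f * g) + j (Clf.oddPart b) * f
              - j (Clf.oddPart c) * g + j (Clf.evenPart d) * (g * f)) +
            (j (Clf.oddPart a) * (f * g) + j (Clf.evenPart b) * f
              + j (Clf.evenPart c) * g - j (Clf.oddPart d) * (g * f)) * e) ∧
        -- compatibility with the adjugate, the pseudodeterminant and the spinor norm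
        (∀ A, (phi (iota (Clf.adj A)) : Clf.Cliff (Clf.bottForm ε q)) =
          Clf.tr (phi (iota A) : Clf.Cliff (Clf.bottForm ε q))) ∧
        (∀ A, (phi (iota (A * Clf.adj A)) : Clf.Cliff (Clf.bottForm ε q)) =
          Clf.spinorNorm (phi (iota A) : Clf.Cliff (Clf.bottForm ε q))) ∧
        (∀ a b c d : Clf.Cliff q,
          (phi (iota !![a * Clf.tr d - b * Clf.tr c, -(a * Clf.tr b) + b * Clf.tr a;
              c * Clf.tr d - d * Clf.tr c, -(c * Clf.tr b) + d * Clf.tr a]) :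
                Clf.Cliff (Clf.bottForm ε q)) =
            Clf.spinorNorm (phi (iota !![a, b; c, d]) : Clf.Cliff (Clf.bottForm ε q))) ∧
        (∀ A ∈ Clf.GL2 q, ∃ r : Rˣ,
          Clf.pseudoDet A = algebraMap R (Clf.Cliff q) r ∧
          Clf.spinorNorm (phi (iota A) : Clf.Cliff (Clf.bottForm ε q)) =
            algebraMap R (Clf.Cliff (Clf.bottForm ε q)) r) ∧
        -- the group isomorphisms
        ∃ (gl sl : Subgroup (Matrix (Fin 2) (Fin 2) (Clf.Cliff q))ˣ)
          (gs sp : Subgroup (Clf.Cliff (Clf.bottForm ε q))ˣ),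
          Units.val '' (gl : Set (Matrix (Fin 2) (Fin 2) (Clf.Cliff q))ˣ) = Clf.GL2 q ∧
          Units.val '' (sl : Set (Matrix (Fin 2) (Fin 2) (Clf.Cliff q))ˣ) = Clf.SL2 q ∧
          Units.val '' (gs : Set (Clf.Cliff (Clf.bottForm ε q))ˣ) =
            Clf.gspin (Clf.bottForm ε q) ∧
          Units.val '' (sp : Set (Clf.Cliff (Clf.bottForm ε q))ˣ) =
            Clf.spin (Clf.bottForm ε q) ∧
          (∃ Φ : sl ≃* sp, ∀ A : sl,
            ((Φ A : (Clf.Cliff (Clf.bottForm ε q))ˣ) : Clf.Cliff (Clf.bottForm ε q)) =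
              phi (iota ((A : (Matrix (Fin 2) (Fin 2) (Clf.Cliff q))ˣ) :
                Matrix (Fin 2) (Fin 2) (Clf.Cliff q)))) ∧
          (∃ Φ : gl ≃* gs, ∀ A : gl,
            ((Φ A : (Clf.Cliff (Clf.bottForm ε q))ˣ) : Clf.Cliff (Clf.bottForm ε q)) =
              phi (iota ((A : (Matrix (Fin 2) (Fin 2) (Clf.Cliff q))ˣ) :
                Matrix (Fin 2) (Fin 2) (Clf.Cliff q))))) ∧
    -- the isomorphism of group schemes over the integers
    (∀ (n : ℕ) (q : QuadraticForm ℤ (Fin n → ℤ)) (ε : ℤˣ),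
      ∃ (G H : CategoryTheory.Grp
          (CategoryTheory.Over (AlgebraicGeometry.Spec (CommRingCat.of ℤ))))
        (hG : Clf.IsSL2Scheme q G) (hH : Clf.IsSpinScheme ε q H) (Θ : G ≅ H),
        AlgebraicGeometry.IsAffine G.X.left ∧ AlgebraicGeometry.IsAffine H.X.left ∧
        ∀ (R : CommRingCat.{0}) (x : Clf.specOver R ⟶ G.X),
          hH.points R (CategoryTheory.CategoryStruct.comp x Θ.hom.hom.hom) =
            Clf.psi ε (Clf.extend q R) (hG.points R x)) ∧
    -- the real Clifford numbers
    (∀ n : ℕ, 1 ≤ n →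
      ∃ (Ψ : Matrix (Fin 2) (Fin 2) (Clf.Cliff (Clf.sumSq (n - 1))) ≃ₐ[ℝ]
          Clf.evenSubalgebra (Clf.lorentz (n + 1)))
        (sl : Subgroup (Matrix (Fin 2) (Fin 2) (Clf.Cliff (Clf.sumSq (n - 1))))ˣ)
        (sp : Subgroup (Clf.Cliff (Clf.lorentz (n + 1)))ˣ),
        Units.val '' (sl : Set (Matrix (Fin 2) (Fin 2) (Clf.Cliff (Clf.sumSq (n - 1))))ˣ) =
          Clf.SL2 (Clf.sumSq (n - 1)) ∧
        Units.val '' (sp : Set (Clf.Cliff (Clf.lorentz (n + 1)))ˣ) =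
          Clf.spin (Clf.lorentz (n + 1)) ∧
        ∃ Φ : sl ≃* sp, ∀ A : sl,
          ((Φ A : (Clf.Cliff (Clf.lorentz (n + 1)))ˣ) : Clf.Cliff (Clf.lorentz (n + 1))) =
            Ψ ((A : (Matrix (Fin 2) (Fin 2) (Clf.Cliff (Clf.sumSq (n - 1))))ˣ) :
              Matrix (Fin 2) (Fin 2) (Clf.Cliff (Clf.sumSq (n - 1))))) := by
  exact ⟨Clf.exists_bott_iso, Clf.exists_groupScheme_iso, Clf.exists_lorentz_iso⟩
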